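/- **Setting.** A layered episodic MDP has a finite state set $\mathcal S$ ($|\mathcal S|=S$) partitioned into $H$ layers $\mathcal S_1=\{s_1\},\mathcal S_2,\dots,\mathcal S_H$, a terminal state $s_{H+1}$, a finite action set $\mathcal A$ ($|\mathcal A|=A$), and a known transition function $\mathbb P$ such that $\mathbb P[\cdot\mid s,a]$ is a probability distribution on $\mathcal S_{h+1}$ for $s\in\mathcal S_h$ (with $\mathcal S_{H+1}=\{s_{H+1}\}$). For a policy $\pi:\mathcal S\to\Delta(\mathcal A)$ and losses $\ell:\mathcal S\times\mathcal A\to\mathbb R$, let $V^{\pi}(s_1;\ell)$ be the expected total loss of one episode, $\rho^{\pi}(s,a)$ the probability of visiting $(s,a)$, and $\mathcal Q=\{\rho^\pi:\pi \text{ a policy}\}$. Fix $\alpha\in(1,2]$ and $\sigma>0$. In each episode $t=1,\dots,T$ the environment chooses, knowing $\mathcal F_{t-1}$, a law $\nu_t$ of the loss function $\ell_t$ with $\mathbb E_{\ell\sim\nu_t}|\ell(s,a)|^\alpha\le\sigma^\alpha$ for all $(s,a)$; the learner plays a policy $\pi_t$; given $\mathcal F_{t-1}$, the trajectory $(s_h^t,a_h^t)_{h\le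 H}$ generated by $\pi_t$ and $\mathbb P$ and the loss $\ell_t\sim\nu_t$ are independent; the learner observes the trajectory and the losses $\ell_t(s_h^t,a_h^t)$ along it. Here $(\mathcal F_t)$ is a filtration to which these observations are adapted. For a deterministic policy $\mathring\pi:\mathcal S\to\mathcal A$ put $\mathrm{Reg}_T(\mathring\pi)=\mathbb E\big[\sum_{t=1}^T (V^{\pi_t}(s_1;\ell_t)-V^{\mathring\pi}(s_1;\ell_t))\big]$. **Algorithm (HT-FTRL-OM).** Let $R=1+HSA+HSA^{2-1/\alpha}$, $$C=\Big(\frac{R}{\alpha-1}\Big)^{-1/\alpha},\qquad \beta=\frac{\alpha-1}{4\alpha^2}\cdot\frac1\alpha\,(\alpha-1)^{1-1/\alpha}R^{1/\alpha-1},\qquad \eta_t=\frac{\beta}{\sigma t^{1/\alpha}} .$$ In episode $t$ the algorithm computes $$x_t\in\operatorname*{arg\,min}_{x\in\mathcal Q}\ \Big\langle x,\sum_{t'<t}(\tilde\ell_{t'}-b_{t'})\Big\rangle-\frac1{\eta_t}\sum_{s,a}x(s,a)^{1/\alpha},$$ and plays $\pi_t(a\mid s)=x_t(s,a)/\sum_{a'}x_t(s,a')$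 (an arbitrary distribution where the denominator is $0$), where $$\tilde\ell_t(s,a)=\frac{\ell_t(s,a)\,\mathbf 1[|\ell_t(s,a)|\le C\sigma t^{1/\alpha}x_t(s,a)^{1/\alpha}]}{x_t(s,a)}\,\mathbf 1[(s,a)\text{ is visited in episode }t],\qquad b_t(s,a)=C^{1-\alpha}\sigma t^{1/\alpha-1}x_t(s,a)^{1/\alpha-1}.$$ **Theorem.** For every $\alpha\in(1,2]$ there are $K>0$ and $d\in\mathbb N$, depending only on $\alpha$, such that for every such MDP, every $\sigma>0$, every $T\ge1$, every such environment and every deterministic $\mathring\pi$, HT-FTRL-OM satisfies simultaneously: 1. (Adversarial regime.) $$\mathrm{Reg}_T(\mathring\pi)\le K\Big(H^{1-\frac1\alpha}S^{2-\frac1\alpha}A^{5-\frac5\alpha}\,\sigma\log T+H^{\alpha+1}S^{2-\frac2\alpha}A^{4-\frac4\alpha}\,\sigma T^{1/\alpha}\Big).$$ 2. (Self-bounding regime.) Let $T\ge2$, $C_{\mathrm{sb}}\ge0$ and $\Delta:\mathcal S\times\mathcal A\to[0,\infty)$ with $\Delta(s,\mathring\pi(s))=0$ and $\Delta(s,a)>0$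 for all $s$ and all $a\ne\mathring\pi(s)$, and suppose that $$\mathrm{Reg}_T(\mathring\pi)\ge\mathbb E\Big[\sum_{t=1}^T\sum_{s,a}\rho^{\pi_t}(s,a)\Delta(s,a)\Big]-C_{\mathrm{sb}}.$$ Then, with $\omega_\Delta(\alpha)=\sum_{(s,a):a\ne\mathring\pi(s)}\Delta(s,a)^{-1/(\alpha-1)}$ and $W=\sigma^{\frac{\alpha}{\alpha-1}}\omega_\Delta(\alpha)\log T$, $$\mathrm{Reg}_T(\mathring\pi)\le K\,(HSA)^d\Big(W+C_{\mathrm{sb}}^{1/\alpha}W^{\frac{\alpha-1}{\alpha}}+\sigma\log T\Big).$$ -/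

import Mathlib

open MeasureTheory ProbabilityTheory

noncomputable section

/-- A layered episodic MDP (without losses) on finite state space `S` and action space `A`.
The terminal state is `none : Option S`.  Layers are numbered `0, …, H - 1`; the layer of `s` is
the time step at which `s` can be visited. -/
structure LayeredMDP (S A : Type*) [Fintype S] where
  /-- horizon -/
  H : ℕ
  /-- initial state -/
  s₁ : S
  /-- layer of a state -/
  layer : S → ℕ
  /-- transition probabilities -/
  P : S → A → Option S → ℝ
  layer_lt : ∀ s, layer s < H
  layer_eq_zero : ∀ s, layer s = 0 ↔ s = s₁
  P_nonneg : ∀ s a s', 0 ≤ P s a s'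
  P_sum : ∀ s a, ∑ s', P s a s' = 1
  P_next : ∀ s a s', P s a (some s') ≠ 0 → layer s' = layer s + 1
  P_terminal : ∀ s a, P s a none ≠ 0 → layer s + 1 = H

namespace LayeredMDP

variable {S A : Type*} [Fintype S] [DecidableEq S] [Fintype A] [DecidableEq A]

/-- A stochastic Markov policy `π s a = π(a | s)`. -/
def IsPolicy (π : S → A → ℝ) : Prop := ∀ s, π s ∈ stdSimplex ℝ A

/-- The policy that plays the action `p s` in state `s`. -/
def detPolicy (p : S → A) : S → A → ℝ := fun s a => if a = p s then 1 else 0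

/-- Expected loss of `π` collected from `s` during the next `n` steps. -/
def valueAux (M : LayeredMDP S A) (π ℓ : S → A → ℝ) : ℕ → S → ℝ
  | 0, _ => 0
  | n + 1, s => ∑ a, π s a * (ℓ s a + ∑ s', M.P s a (some s') * valueAux M π ℓ n s')

/-- The value function `V^{P,π}(s; ℓ)`; from layer `h` there are `H - h` steps to go. -/
def value (M : LayeredMDP S A) (π ℓ : S → A → ℝ) (s : S) : ℝ :=
  M.valueAux π ℓ (M.H - M.layer s) s

/-- Probability that `π` is in state `s` at time step `n` (counted from `0`). -/
def reach (M : LayeredMDP S A) (π : S → A → ℝ) : ℕ → S → ℝ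
  | 0, s => if s = M.s₁ then 1 else 0
  | n + 1, s => ∑ s', ∑ a, reach M π n s' * π s' a * M.P s' a (some s)

/-- The occupancy measure `ρ^{P,π}(s,a)`. -/
def occ (M : LayeredMDP S A) (π : S → A → ℝ) : S → A → ℝ :=
  fun s a => M.reach π (M.layer s) s * π s a

/-- The occupancy polytope `Q(P)`. -/
def occSet (M : LayeredMDP S A) : Set (S → A → ℝ) :=
  {ρ | ∃ π, IsPolicy π ∧ ρ = M.occ π}

/-- A trajectory `(s_h, a_h)` of one episode. -/
abbrev Traj (M : LayeredMDP S A) : Type _ := Fin M.H → S × A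

/-- Probability of the trajectory `τ` under `π`. -/
def trajProb (M : LayeredMDP S A) (π : S → A → ℝ) (τ : M.Traj) : ℝ :=
  ∏ h : Fin M.H,
    (if h.1 = 0 then (if (τ h).1 = M.s₁ then 1 else 0)
      else
        let prev := τ ⟨h.1 - 1, lt_of_le_of_lt (Nat.sub_le _ _) h.2⟩
        M.P prev.1 prev.2 (some (τ h).1)) *
    π (τ h).1 (τ h).2

/-- The interaction of a learner playing the policies `π t` with a heavy-tailed, possibly adaptive
environment during the episodes `1 ≤ t ≤ T`.
`ℓ t` is the loss function of episode `t`; the learner observes only `traj t` and the losses along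
it.  `ℱ t` is the information after episode `t` (at least all observations up to `t`).
The environment picks the law `ν t` of `ℓ t` knowing `ℱ (t - 1)`, and given `ℱ (t - 1)` the
trajectory has law `trajProb (π t)` and is independent of `ℓ t`, which has law `ν t`.
No relation between the losses of different state-action pairs is imposed. -/
structure IsInteraction (M : LayeredMDP S A) (α σ : ℝ) (T : ℕ)
    {Ω : Type*} {mΩ : MeasurableSpace Ω} (μ : Measure Ω) (ℱ : Filtration ℕ mΩ)
    (ν : ℕ → Ω → Measure (S → A → ℝ)) (π : ℕ → Ω → S → A → ℝ)
    (traj : ℕ → Ω → M.Traj) (ℓ : ℕ → Ω → S → A → ℝ) : Prop where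
  policy : ∀ t ∈ Finset.Icc 1 T, ∀ ω, IsPolicy (π t ω)
  policy_meas : ∀ t ∈ Finset.Icc 1 T, ∀ s a, Measurable[ℱ (t - 1)] fun ω => π t ω s a
  law_prob : ∀ t ∈ Finset.Icc 1 T, ∀ ω, IsProbabilityMeasure (ν t ω)
  law_meas : ∀ t ∈ Finset.Icc 1 T, ∀ B, MeasurableSet B → Measurable[ℱ (t - 1)] fun ω => ν t ω B
  moment : ∀ t ∈ Finset.Icc 1 T, ∀ ω s a,
    ∫⁻ l, ENNReal.ofReal (|l s a| ^ α) ∂(ν t ω) ≤ ENNReal.ofReal (σ ^ α)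
  loss_meas : ∀ t ∈ Finset.Icc 1 T, Measurable (ℓ t)
  traj_obs : ∀ t ∈ Finset.Icc 1 T, ∀ τ, MeasurableSet[ℱ t] {ω | traj t ω = τ}
  loss_obs : ∀ t ∈ Finset.Icc 1 T, ∀ h,
    Measurable[ℱ t] fun ω => ℓ t ω (traj t ω h).1 (traj t ω h).2
  law : ∀ t ∈ Finset.Icc 1 T, ∀ E, MeasurableSet[ℱ (t - 1)] E → ∀ τ B, MeasurableSet B →
    μ (E ∩ {ω | traj t ω = τ} ∩ {ω | ℓ t ω ∈ B}) =
      ∫⁻ ω in E, ENNReal.ofReal (M.trajProb (π t ω) τ) * ν t ω B ∂μ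

/-- The learning rate `η_t = β / (σ t^{1/α})`. -/
def learningRate (α σ β : ℝ) (t : ℕ) : ℝ := β / (σ * (t : ℝ) ^ (1 / α))

/-- The `1/α`-Tsallis regularizer `Ψ_t(x) = -(1/η_t) ∑ x(s,a)^{1/α}`. -/
def tsallis (α σ β : ℝ) (t : ℕ) (x : S → A → ℝ) : ℝ :=
  -(1 / learningRate α σ β t) * ∑ s, ∑ a, x s a ^ (1 / α)

/-- The skipping threshold `τ_t(s,a) = C σ t^{1/α} x_t(s,a)^{1/α}`. -/
def skipThreshold (α σ C : ℝ) (t : ℕ) (x : S → A → ℝ) (s : S) (a : A) : ℝ :=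
  C * σ * (t : ℝ) ^ (1 / α) * x s a ^ (1 / α)

/-- The skipped loss `ℓ_t(s,a) 1[|ℓ_t(s,a)| ≤ τ_t(s,a)]`. -/
def skipLoss (α σ C : ℝ) (t : ℕ) (x ℓ : S → A → ℝ) (s : S) (a : A) : ℝ :=
  if |ℓ s a| ≤ skipThreshold α σ C t x s a then ℓ s a else 0

/-- The importance-weighted skipped loss of an episode with trajectory `τ`. -/
def lossEstimate (M : LayeredMDP S A) (α σ C : ℝ) (t : ℕ) (x : S → A → ℝ) (τ : M.Traj)
    (ℓ : S → A → ℝ) (s : S) (a : A) : ℝ :=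
  skipLoss α σ C t x ℓ s a / x s a * (if ∃ h, τ h = (s, a) then 1 else 0)

/-- The skipping bonus `C^{1-α} σ t^{1/α-1} x_t(s,a)^{1/α-1}`.  Its value where `x s a = 0` matters
only for pairs in states that no policy reaches, where all elements of `occSet` vanish. -/
def skipBonus (α σ C : ℝ) (t : ℕ) (x : S → A → ℝ) (s : S) (a : A) : ℝ :=
  C ^ (1 - α) * σ * (t : ℝ) ^ (1 / α - 1) * x s a ^ (1 / α - 1)

/-- `x t` and `π t`, `1 ≤ t ≤ T`, are the occupancy measures and the policies that HT-FTRL-OM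
computes from the past trajectories and losses.  In a state `s` with `∑ a, x t ω s a = 0` (which is
not reached) the policy is arbitrary. -/
structure IsHTFTRLOM (M : LayeredMDP S A) (α σ C β : ℝ) (T : ℕ) {Ω : Type*}
    (x π : ℕ → Ω → S → A → ℝ) (traj : ℕ → Ω → M.Traj) (ℓ : ℕ → Ω → S → A → ℝ) : Prop where
  mem : ∀ t ∈ Finset.Icc 1 T, ∀ ω, x t ω ∈ M.occSet
  isMin : ∀ t ∈ Finset.Icc 1 T, ∀ ω,
    IsMinOn
      (fun y : S → A → ℝ =>
        (∑ s, ∑ a, y s a * ∑ i ∈ Finset.Ico 1 t,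
          (M.lossEstimate α σ C i (x i ω) (traj i ω) (ℓ i ω) s a - skipBonus α σ C i (x i ω) s a))
        + tsallis α σ β t y)
      M.occSet (x t ω)
  policy_eq : ∀ t ∈ Finset.Icc 1 T, ∀ ω s, ∑ b, x t ω s b ≠ 0 →
    ∀ a, π t ω s a = x t ω s a / ∑ b, x t ω s b

/-- `Reg_T(p) = E[∑_t (V^{P,π_t}(s₁; ℓ_t) - V^{P,p}(s₁; ℓ_t))]` for a deterministic policy `p`. -/
def regret (M : LayeredMDP S A) (T : ℕ) {Ω : Type*} {mΩ : MeasurableSpace Ω} (μ : Measure Ω)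
    (π ℓ : ℕ → Ω → S → A → ℝ) (p : S → A) : ℝ :=
  ∫ ω, ∑ t ∈ Finset.Icc 1 T,
    (M.value (π t ω) (ℓ t ω) M.s₁ - M.value (detPolicy p) (ℓ t ω) M.s₁) ∂μ

/-- The `(p, Δ, Csb)` self-bounding constraint. -/
structure SelfBounding (M : LayeredMDP S A) (T : ℕ) {Ω : Type*} {mΩ : MeasurableSpace Ω}
    (μ : Measure Ω) (π ℓ : ℕ → Ω → S → A → ℝ) (p : S → A) (Δ : S → A → ℝ) (Csb : ℝ) : Prop where
  gap_nonneg : ∀ s a, 0 ≤ Δ s a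
  gap_opt : ∀ s, Δ s (p s) = 0
  corruption_nonneg : 0 ≤ Csb
  le_regret :
    (∫ ω, ∑ t ∈ Finset.Icc 1 T, ∑ s, ∑ a, M.occ (π t ω) s a * Δ s a ∂μ) - Csb ≤
      M.regret T μ π ℓ p

/-- `ω_Δ(α) = ∑_{a ≠ p(s)} Δ(s,a)^{-1/(α-1)}` (for gaps that are positive at all these pairs). -/
def gapSum (α : ℝ) (p : S → A) (Δ : S → A → ℝ) : ℝ :=
  ∑ s, ∑ a, if a = p s then 0 else Δ s a ^ (-(1 / (α - 1)))

/-- The quantity `1 + HSA + HSA^{2 - 1/α}` that enters the tuning. -/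
def tuningR (α : ℝ) (H S A : ℕ) : ℝ :=
  1 + (H : ℝ) * S * A + (H : ℝ) * S * (A : ℝ) ^ (2 - 1 / α)

/-- The skipping threshold constant. -/
def tuningC (α : ℝ) (H S A : ℕ) : ℝ := (tuningR α H S A / (α - 1)) ^ (-(1 / α))

/-- The learning rate constant. -/
def tuningBeta (α : ℝ) (H S A : ℕ) : ℝ :=
  (α - 1) / (4 * α ^ 2) * α⁻¹ * (α - 1) ^ (1 - 1 / α) * tuningR α H S A ^ (1 / α - 1)

end LayeredMDP

end

set_option linter.unusedSectionVars false

namespace LayeredMDP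

variable {S A : Type*} [Fintype S] [DecidableEq S] [Fintype A] [DecidableEq A]

/-! ### Occupancy measures as flows -/

/-! Write q = 1/α, x_t for the occupancy measure of the learner and u for that of the comparator. In
each episode the regret is ⟨x_t - u, ℓ_t⟩, which splits into ⟨x_t - u, ℓ̃_t - b_t⟩ and ⟨x_t - u, ℓ_t
- ℓ̃_t + b_t⟩.

The second term is an estimation error. Given the past, ℓ̃_t misses only the skipped part of the
loss. The mean of that part is at most b_t in absolute value, because the bonus equals θ^(1-α) σ^α
at the skipping threshold θ. So the bonus makes the conditional mean of the error nonnegative, and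
only the positive part of x_t - u costs anything (`IsRound.exists_centred_error`).

The first term is regret of FTRL with q-Tsallis regularization (`ftrl_regret`). It is bounded by a
penalty, the increments of 1/η_t times ∑ x_t^q - ∑ u^q, plus a stability term of order η_t ∑
x_t^(2-q) (loss)². Skipping makes the estimates small enough for the local stability estimate, and
it gives them a second moment (`IsRound.integral_weight_mul_sq_le`). The loss in the stability term
may be replaced by its shift by P v - v for any state potential v: all occupancy measures are unit
flows, and this shift has the same pairing with each of them (`IsFlow.pairing_shift`).

`regret_le_sum` collects these bounds: the regret is at most ∑_t σ t^(q-1) E V(π_t) up to constants,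
plus a lower-order contribution of the squared bonuses. Here V is any potential that dominates the
penalty, the bonus and the second moment of the shifted estimates. It is used twice.

Adversarial regime: no shift, and V = ∑ x^q. Hölder's inequality bounds V by H^q (SA)^(1-q), and ∑
t^(q-1) is of order T^q.

Self-bounding regime: V is the sum of x^q over the pairs that p does not choose. For the penalty and
the bonus this works because x can exceed u only through mass that leaves p
(`occ_sub_occ_detPolicy_le`). For the stability term the loss estimate is shifted by the value
function of the current policy, which turns it into an advantage. The advantage of the action of p
is an average of differences over the other actions of the state, so the other actions control it
too. The estimate at a pair c may be as large as x(c)^(q-1). The flow inequality x(s,a) Q(s,a) ≤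
x(c), for the loss that is 1 at c, trades this for a power of x(s,a) (`occ_mul_qvalue_le`,
`sum_rpow_mul_unitAdv_sq_le`). Young's inequality then bounds σ t^(q-1) x^q by λΔx plus a multiple
of 1/t, the self-bounding hypothesis returns the first part to the regret, and
`le_of_forall_self_bounding` optimizes λ. -/

lemma P_init_eq_zero (M : LayeredMDP S A) (s : S) (a : A) : M.P s a (some M.s₁) = 0 := by
  by_contra h
  have h1 := M.P_next s a _ h
  rw [(M.layer_eq_zero M.s₁).2 rfl] at h1
  omega

lemma sum_P_some (M : LayeredMDP S A) (s : S) (a : A) :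
    ∑ s', M.P s a (some s') = 1 - M.P s a none := by
  have := M.P_sum s a
  rw [Fintype.sum_option] at this
  linarith

lemma sum_P_some_le_one (M : LayeredMDP S A) (s : S) (a : A) :
    ∑ s', M.P s a (some s') ≤ 1 := by
  rw [M.sum_P_some]
  linarith [M.P_nonneg s a none]

/-- `ρ` is a nonnegative flow of unit mass through the layers. -/
structure IsFlow (M : LayeredMDP S A) (ρ : S → A → ℝ) : Prop where
  nonneg : ∀ s a, 0 ≤ ρ s a
  conserve : ∀ s, ∑ a, ρ s a =
    (if s = M.s₁ then 1 else 0) + ∑ s', ∑ a, ρ s' a * M.P s' a (some s)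

lemma reach_nonneg (M : LayeredMDP S A) {π : S → A → ℝ} (hπ : IsPolicy π) (n : ℕ) (s : S) :
    0 ≤ M.reach π n s := by
  induction n generalizing s with
  | zero => simp only [reach]; split_ifs <;> norm_num
  | succ n ih =>
    exact Finset.sum_nonneg fun s' _ => Finset.sum_nonneg fun a _ =>
      mul_nonneg (mul_nonneg (ih s') ((hπ s').1 a)) (M.P_nonneg _ _ _)

lemma sum_occ (M : LayeredMDP S A) {π : S → A → ℝ} (hπ : IsPolicy π) (s : S) :
    ∑ a, M.occ π s a = M.reach π (M.layer s) s := by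
  simp only [occ, ← Finset.mul_sum, (hπ s).2, mul_one]

lemma isFlow_occ (M : LayeredMDP S A) {π : S → A → ℝ} (hπ : IsPolicy π) : M.IsFlow (M.occ π) where
  nonneg s a := mul_nonneg (M.reach_nonneg hπ _ _) ((hπ s).1 a)
  conserve s := by
    rw [M.sum_occ hπ]
    rcases hn : M.layer s with _ | n
    · have hs := (M.layer_eq_zero s).1 hn
      subst hs
      simp [reach, P_init_eq_zero]
    · have hs : s ≠ M.s₁ := fun h => by
        rw [(M.layer_eq_zero s).2 h] at hn
        omega
      simp only [reach, hs, if_false, zero_add]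
      refine Finset.sum_congr rfl fun s' _ => Finset.sum_congr rfl fun a _ => ?_
      by_cases hP : M.P s' a (some s) = 0
      · simp [hP]
      · have h1 := M.P_next _ _ _ hP
        have h2 : M.layer s' = n := by omega
        simp only [occ, h2]

/-- By induction on the layer, conservation forces the state marginals of ρ to be the reaching
probabilities of π. -/
lemma IsFlow.occ_eq {M : LayeredMDP S A} {ρ π : S → A → ℝ} (hρ : M.IsFlow ρ)
    (h : ∀ s a, ρ s a = (∑ b, ρ s b) * π s a) : M.occ π = ρ := by
  have key : ∀ n s, M.layer s = n → M.reach π n s = ∑ b, ρ s b := by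
    intro n
    induction n with
    | zero =>
      intro s hs
      have hs' := (M.layer_eq_zero s).1 hs
      rw [hρ.conserve s]
      subst hs'
      simp [reach, P_init_eq_zero]
    | succ n ih =>
      intro s hs
      have hs' : s ≠ M.s₁ := fun h => by
        rw [(M.layer_eq_zero s).2 h] at hs
        omega
      rw [hρ.conserve s]
      simp only [reach, hs', if_false, zero_add]
      refine Finset.sum_congr rfl fun s' _ => Finset.sum_congr rfl fun a _ => ?_
      by_cases hP : M.P s' a (some s) = 0
      · simp [hP]
      · have h1 := M.P_next _ _ _ hP
        rw [ih s' (by omega), ← h]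
  funext s a
  rw [h s a, ← key _ s rfl, occ]

/-- Normalize ρ in each state; a state without mass gets an arbitrary action. Thus `occSet` is cut
out by linear constraints and is convex, which the first-order analysis of the minimizer needs. -/
lemma IsFlow.mem_occSet [Nonempty A] {M : LayeredMDP S A} {ρ : S → A → ℝ} (hρ : M.IsFlow ρ) :
    ρ ∈ M.occSet := by
  classical
  obtain ⟨a₀⟩ := ‹Nonempty A›
  refine ⟨fun s a => if ∑ b, ρ s b = 0 then (if a = a₀ then 1 else 0) else ρ s a / ∑ b, ρ s b,
    fun s => ?_, (hρ.occ_eq fun s a => ?_).symm⟩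
  · by_cases h : ∑ b, ρ s b = 0
    · simp only [h, if_true]
      exact ⟨fun a => by beta_reduce; split_ifs <;> norm_num, by simp⟩
    · simp only [h, if_false]
      refine ⟨fun a => div_nonneg (hρ.nonneg s a) (Finset.sum_nonneg fun b _ => hρ.nonneg s b), ?_⟩
      rw [← Finset.sum_div, div_self h]
  · by_cases h : ∑ b, ρ s b = 0
    · simp only [h, if_true, zero_mul]
      exact (Finset.sum_eq_zero_iff_of_nonneg fun b _ => hρ.nonneg s b).1 h a (Finset.mem_univ a)
    · simp only [h, if_false]
      field_simp

lemma isFlow_of_mem (M : LayeredMDP S A) {ρ : S → A → ℝ} (h : ρ ∈ M.occSet) : M.IsFlow ρ := by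
  obtain ⟨π, hπ, rfl⟩ := h
  exact M.isFlow_occ hπ

lemma IsFlow.segment {M : LayeredMDP S A} {x z : S → A → ℝ} (hx : M.IsFlow x) (hz : M.IsFlow z)
    {ε : ℝ} (h0 : 0 ≤ ε) (h1 : ε ≤ 1) : M.IsFlow fun s a => x s a + ε * (z s a - x s a) where
  nonneg s a := by nlinarith [hx.nonneg s a, hz.nonneg s a]
  conserve s := by
    have e : ∑ s', ∑ a, (x s' a + ε * (z s' a - x s' a)) * M.P s' a (some s) =
        (1 - ε) * ∑ s', ∑ a, x s' a * M.P s' a (some s) +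
          ε * ∑ s', ∑ a, z s' a * M.P s' a (some s) := by
      simp only [Finset.mul_sum, ← Finset.sum_add_distrib]
      exact Finset.sum_congr rfl fun _ _ => Finset.sum_congr rfl fun _ _ => by ring
    rw [e, Finset.sum_add_distrib, ← Finset.mul_sum, Finset.sum_sub_distrib, hx.conserve,
      hz.conserve]
    ring

/-! ### Value functions -/

/-- The inner product `⟨x, ℓ⟩` of two functions on state-action pairs. -/
noncomputable def pairing (x ℓ : S → A → ℝ) : ℝ := ∑ s, ∑ a, x s a * ℓ s a

/-- The expected value of `v` at the next state (`0` at the terminal state). -/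
noncomputable def expNext (M : LayeredMDP S A) (v : S → ℝ) (s : S) (a : A) : ℝ :=
  ∑ s', M.P s a (some s') * v s'

/-- The action-value function `Q^π(s, a; ℓ)`. -/
noncomputable def qvalue (M : LayeredMDP S A) (π ℓ : S → A → ℝ) (s : S) (a : A) : ℝ :=
  ℓ s a + M.expNext (M.value π ℓ) s a

/-- Conservation makes the sum telescope. The right side does not depend on ρ, so adding P v - v to
a loss changes no comparison between two flows. -/
lemma IsFlow.pairing_shift {M : LayeredMDP S A} {ρ : S → A → ℝ} (hρ : M.IsFlow ρ) (v : S → ℝ) :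
    pairing ρ (fun s a => M.expNext v s a - v s) = -v M.s₁ := by
  have h1 : ∑ s, ∑ a, ρ s a * M.expNext v s a
      = ∑ s, (∑ s', ∑ a, ρ s' a * M.P s' a (some s)) * v s := by
    simp only [expNext, Finset.mul_sum, Finset.sum_mul]
    calc ∑ s, ∑ a, ∑ s', ρ s a * (M.P s a (some s') * v s')
        = ∑ s, ∑ s', ∑ a, ρ s a * (M.P s a (some s') * v s') :=
          Finset.sum_congr rfl fun s _ => Finset.sum_comm
      _ = ∑ s', ∑ s, ∑ a, ρ s a * (M.P s a (some s') * v s') := Finset.sum_comm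
      _ = _ := Finset.sum_congr rfl fun s _ => Finset.sum_congr rfl fun _ _ =>
          Finset.sum_congr rfl fun _ _ => by ring
  have h2 : ∑ s, ∑ a, ρ s a * v s
      = v M.s₁ + ∑ s, (∑ s', ∑ a, ρ s' a * M.P s' a (some s)) * v s := by
    simp only [← Finset.sum_mul, hρ.conserve, add_mul, Finset.sum_add_distrib]
    simp
  simp only [pairing, mul_sub, Finset.sum_sub_distrib, h1, h2]
  ring

lemma expNext_value (M : LayeredMDP S A) (π ℓ : S → A → ℝ) {n : ℕ} {s : S}
    (hn : M.H - M.layer s = n + 1) (a : A) :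
    M.expNext (M.value π ℓ) s a = ∑ s', M.P s a (some s') * M.valueAux π ℓ n s' := by
  refine Finset.sum_congr rfl fun s' _ => ?_
  by_cases hP : M.P s a (some s') = 0
  · simp [hP]
  · have h1 := M.P_next _ _ _ hP
    rw [value, show M.H - M.layer s' = n by omega]

lemma value_eq_sum (M : LayeredMDP S A) (π ℓ : S → A → ℝ) (s : S) :
    M.value π ℓ s = ∑ a, π s a * M.qvalue π ℓ s a := by
  have hs := M.layer_lt s
  obtain ⟨n, hn⟩ : ∃ n, M.H - M.layer s = n + 1 := ⟨M.H - M.layer s - 1, by omega⟩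
  simp only [qvalue, M.expNext_value π ℓ hn]
  rw [value, hn]
  rfl

lemma sum_occ_mul_qvalue (M : LayeredMDP S A) (π ℓ : S → A → ℝ) (s : S) :
    ∑ a, M.occ π s a * M.qvalue π ℓ s a = M.reach π (M.layer s) s * M.value π ℓ s := by
  simp only [occ, value_eq_sum M π ℓ s, Finset.mul_sum, mul_assoc]

/-- Adding the shift by the value function turns the loss into Q - V, whose average over the actions
of π vanishes in every state; the shift itself pairs to minus the initial value. -/
lemma pairing_occ (M : LayeredMDP S A) {π : S → A → ℝ} (hπ : IsPolicy π) (ℓ : S → A → ℝ) :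
    pairing (M.occ π) ℓ = M.value π ℓ M.s₁ := by
  have h1 := (M.isFlow_occ hπ).pairing_shift (M.value π ℓ)
  have h2 : pairing (M.occ π) ℓ + pairing (M.occ π)
      (fun s a => M.expNext (M.value π ℓ) s a - M.value π ℓ s) = 0 := by
    simp only [pairing, ← Finset.sum_add_distrib]
    refine Finset.sum_eq_zero fun s _ => ?_
    have h3 := M.sum_occ_mul_qvalue π ℓ s
    rw [← M.sum_occ hπ, Finset.sum_mul, ← sub_eq_zero, ← Finset.sum_sub_distrib] at h3
    rw [← h3]
    refine Finset.sum_congr rfl fun a _ => ?_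
    simp only [qvalue]
    ring
  linarith

lemma valueAux_const_one_le (M : LayeredMDP S A) {π : S → A → ℝ} (hπ : IsPolicy π) (n : ℕ) (s : S) :
    M.valueAux π (fun _ _ => 1) n s ≤ n := by
  induction n generalizing s with
  | zero => simp [valueAux]
  | succ n ih =>
    calc M.valueAux π (fun _ _ => 1) (n + 1) s
        ≤ ∑ a, π s a * ((n + 1 : ℕ) : ℝ) := by
          refine Finset.sum_le_sum fun a _ => mul_le_mul_of_nonneg_left ?_ ((hπ s).1 a)
          have : ∑ s', M.P s a (some s') * M.valueAux π (fun _ _ => 1) n s'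
              ≤ ∑ s', M.P s a (some s') * n :=
            Finset.sum_le_sum fun s' _ => mul_le_mul_of_nonneg_left (ih s') (M.P_nonneg _ _ _)
          rw [← Finset.sum_mul] at this
          push_cast
          nlinarith [M.sum_P_some_le_one s a, (Nat.cast_nonneg n : (0:ℝ) ≤ n)]
      _ = _ := by rw [← Finset.sum_mul, (hπ s).2, one_mul]

lemma sum_occ_le (M : LayeredMDP S A) {π : S → A → ℝ} (hπ : IsPolicy π) :
    ∑ s, ∑ a, M.occ π s a ≤ M.H := by
  have := M.pairing_occ hπ (fun _ _ => 1)
  simp only [pairing, mul_one] at this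
  rw [this, value, (M.layer_eq_zero M.s₁).2 rfl]
  exact M.valueAux_const_one_le hπ _ _

/-- The loss function that is `1` at the pair `c` and `0` elsewhere. -/
def unitLoss (c : S × A) : S → A → ℝ := fun s a => if (s, a) = c then 1 else 0

lemma unitLoss_nonneg (c : S × A) (s : S) (a : A) : 0 ≤ unitLoss c s a := by
  unfold unitLoss
  split_ifs <;> norm_num

lemma unitLoss_le_one (c : S × A) (s : S) (a : A) : unitLoss c s a ≤ 1 := by
  unfold unitLoss
  split_ifs <;> norm_num

lemma sum_mul_unitLoss (ℓ : S → A → ℝ) (s : S) (a : A) :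
    ∑ c : S × A, ℓ c.1 c.2 * unitLoss c s a = ℓ s a := by
  simp [unitLoss]

lemma pairing_unitLoss (x : S → A → ℝ) (c : S × A) : pairing x (unitLoss c) = x c.1 c.2 := by
  rw [pairing, ← Fintype.sum_prod_type' (fun s a => x s a * unitLoss c s a)]
  simp [unitLoss]

/-- Linearity in the loss reduces estimates to unit losses, whose values are visit probabilities and
lie in [0, 1]. -/
lemma valueAux_eq_sum_unitLoss (M : LayeredMDP S A) (π ℓ : S → A → ℝ) (n : ℕ) (s : S) :
    M.valueAux π ℓ n s = ∑ c : S × A, ℓ c.1 c.2 * M.valueAux π (unitLoss c) n s := by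
  induction n generalizing s with
  | zero => simp [valueAux]
  | succ n ih =>
    simp only [valueAux, ih, Finset.mul_sum]
    rw [Finset.sum_comm]
    refine Finset.sum_congr rfl fun a _ => ?_
    simp only [← Finset.mul_sum, mul_left_comm _ (π s a)]
    congr 1
    simp only [mul_add, Finset.sum_add_distrib, sum_mul_unitLoss]
    congr 1
    simp only [Finset.mul_sum]
    rw [Finset.sum_comm]
    exact Finset.sum_congr rfl fun _ _ => Finset.sum_congr rfl fun _ _ => by ring

lemma value_eq_sum_unitLoss (M : LayeredMDP S A) (π ℓ : S → A → ℝ) (s : S) :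
    M.value π ℓ s = ∑ c : S × A, ℓ c.1 c.2 * M.value π (unitLoss c) s :=
  M.valueAux_eq_sum_unitLoss π ℓ _ s

lemma qvalue_eq_sum_unitLoss (M : LayeredMDP S A) (π ℓ : S → A → ℝ) (s : S) (a : A) :
    M.qvalue π ℓ s a = ∑ c : S × A, ℓ c.1 c.2 * M.qvalue π (unitLoss c) s a := by
  simp only [qvalue, mul_add, Finset.sum_add_distrib, sum_mul_unitLoss, expNext]
  congr 1
  simp only [value_eq_sum_unitLoss M π ℓ, Finset.mul_sum]
  rw [Finset.sum_comm]
  exact Finset.sum_congr rfl fun _ _ => Finset.sum_congr rfl fun _ _ => by ring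

lemma valueAux_nonneg (M : LayeredMDP S A) {π ℓ : S → A → ℝ} (hπ : IsPolicy π)
    (hℓ : ∀ s a, 0 ≤ ℓ s a) (n : ℕ) (s : S) : 0 ≤ M.valueAux π ℓ n s := by
  induction n generalizing s with
  | zero => simp [valueAux]
  | succ n ih =>
    exact Finset.sum_nonneg fun a _ => mul_nonneg ((hπ s).1 a) (add_nonneg (hℓ s a)
      (Finset.sum_nonneg fun s' _ => mul_nonneg (M.P_nonneg _ _ _) (ih s')))

lemma value_unitLoss_nonneg (M : LayeredMDP S A) {π : S → A → ℝ} (hπ : IsPolicy π) (c : S × A)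
    (s : S) : 0 ≤ M.value π (unitLoss c) s :=
  M.valueAux_nonneg hπ (unitLoss_nonneg c) _ s

lemma expNext_value_unitLoss_nonneg (M : LayeredMDP S A) {π : S → A → ℝ} (hπ : IsPolicy π)
    (c : S × A) (s : S) (a : A) : 0 ≤ M.expNext (M.value π (unitLoss c)) s a :=
  Finset.sum_nonneg fun s' _ => mul_nonneg (M.P_nonneg _ _ _) (M.value_unitLoss_nonneg hπ c s')

lemma qvalue_unitLoss_nonneg (M : LayeredMDP S A) {π : S → A → ℝ} (hπ : IsPolicy π) (c : S × A)
    (s : S) (a : A) : 0 ≤ M.qvalue π (unitLoss c) s a :=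
  add_nonneg (unitLoss_nonneg c s a) (M.expNext_value_unitLoss_nonneg hπ c s a)

lemma valueAux_unitLoss_eq_zero (M : LayeredMDP S A) (π : S → A → ℝ) (c : S × A) (n : ℕ) {s : S}
    (h : M.layer c.1 < M.layer s) : M.valueAux π (unitLoss c) n s = 0 := by
  induction n generalizing s with
  | zero => simp [valueAux]
  | succ n ih =>
    refine Finset.sum_eq_zero fun a _ => ?_
    have h1 : unitLoss c s a = 0 := by
      unfold unitLoss
      rw [if_neg]
      rintro rfl
      simp at h
    have h2 : ∑ s', M.P s a (some s') * M.valueAux π (unitLoss c) n s' = 0 := by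
      refine Finset.sum_eq_zero fun s' _ => ?_
      by_cases hP : M.P s a (some s') = 0
      · simp [hP]
      · have h1 := M.P_next _ _ _ hP
        rw [ih (by omega), mul_zero]
    rw [h1, h2]
    simp

/-- A pair is visited at most once: in the state of `c` the future contributes nothing, since later
layers cannot return; in any other state the immediate loss is zero. -/
lemma unitLoss_add_expNext_le_one (M : LayeredMDP S A) {v : S → ℝ} (c : S × A)
    (hv : ∀ s, v s ≤ 1) (hv0 : ∀ s, M.layer c.1 < M.layer s → v s = 0) (s : S) (a : A) :
    unitLoss c s a + ∑ s', M.P s a (some s') * v s' ≤ 1 := by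
  by_cases hs : s = c.1
  · have h2 : ∑ s', M.P s a (some s') * v s' = 0 := by
      refine Finset.sum_eq_zero fun s' _ => ?_
      by_cases hP : M.P s a (some s') = 0
      · simp [hP]
      · have h1 := M.P_next _ _ _ hP
        rw [hv0 s' (by rw [h1, hs]; omega), mul_zero]
    rw [h2, add_zero]
    exact unitLoss_le_one c s a
  · have h1 : unitLoss c s a = 0 := by
      unfold unitLoss
      rw [if_neg]
      rintro rfl
      simp at hs
    rw [h1, zero_add]
    calc ∑ s', M.P s a (some s') * v s' ≤ ∑ s', M.P s a (some s') * 1 :=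
          Finset.sum_le_sum fun s' _ => mul_le_mul_of_nonneg_left (hv s') (M.P_nonneg _ _ _)
      _ ≤ 1 := by simpa using M.sum_P_some_le_one s a

lemma valueAux_unitLoss_le_one (M : LayeredMDP S A) {π : S → A → ℝ} (hπ : IsPolicy π) (c : S × A)
    (n : ℕ) (s : S) : M.valueAux π (unitLoss c) n s ≤ 1 := by
  induction n generalizing s with
  | zero => simp [valueAux]
  | succ n ih =>
    calc M.valueAux π (unitLoss c) (n + 1) s ≤ ∑ a, π s a * 1 :=
          Finset.sum_le_sum fun a _ => mul_le_mul_of_nonneg_left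
            (M.unitLoss_add_expNext_le_one c ih
              (fun s' hs' => M.valueAux_unitLoss_eq_zero π c n hs') s a) ((hπ s).1 a)
      _ = 1 := by simp [(hπ s).2]

lemma value_unitLoss_le_one (M : LayeredMDP S A) {π : S → A → ℝ} (hπ : IsPolicy π) (c : S × A)
    (s : S) : M.value π (unitLoss c) s ≤ 1 :=
  M.valueAux_unitLoss_le_one hπ c _ s

lemma qvalue_unitLoss_le_one (M : LayeredMDP S A) {π : S → A → ℝ} (hπ : IsPolicy π) (c : S × A)
    (s : S) (a : A) : M.qvalue π (unitLoss c) s a ≤ 1 :=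
  M.unitLoss_add_expNext_le_one c (M.value_unitLoss_le_one hπ c)
    (fun _ hs' => M.valueAux_unitLoss_eq_zero π c _ hs') s a

/-- Shift by the value function cut off to zero in layers up to `h`. The potential vanishes at `s₁`,
so the total stays x(c). Layers before `h` keep their nonnegative loss, layer `h` contributes the
Q-values, and beyond it the Bellman equation cancels everything. -/
lemma sum_layer_occ_mul_qvalue_le (M : LayeredMDP S A) {π : S → A → ℝ} (hπ : IsPolicy π)
    (c : S × A) (h : ℕ) :
    ∑ s, (if M.layer s = h then ∑ a, M.occ π s a * M.qvalue π (unitLoss c) s a else 0)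
      ≤ M.occ π c.1 c.2 := by
  set V := M.value π (unitLoss c) with hV
  have hflow := M.isFlow_occ hπ
  have h1 := hflow.pairing_shift (fun s => if h < M.layer s then V s else 0)
  rw [if_neg (by rw [(M.layer_eq_zero M.s₁).2 rfl]; omega), neg_zero] at h1
  have h2 := pairing_unitLoss (M.occ π) c
  refine le_of_le_of_eq ?_ (by rw [h1, h2, add_zero] :
    pairing (M.occ π) (unitLoss c) + pairing (M.occ π) (fun s a =>
      M.expNext (fun s => if h < M.layer s then V s else 0) s a -
        if h < M.layer s then V s else 0) = M.occ π c.1 c.2)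
  simp only [pairing, ← Finset.sum_add_distrib]
  refine Finset.sum_le_sum fun s _ => ?_
  have hnn : ∀ a, 0 ≤ M.occ π s a * unitLoss c s a := fun a =>
    mul_nonneg (hflow.nonneg s a) (unitLoss_nonneg c s a)
  have hnext : ∀ a, h ≤ M.layer s → M.expNext (fun s => if h < M.layer s then V s else 0) s a =
      M.expNext V s a := by
    intro a hs
    refine Finset.sum_congr rfl fun s' _ => ?_
    by_cases hP : M.P s a (some s') = 0
    · simp [hP]
    · have h1 := M.P_next _ _ _ hP
      beta_reduce
      rw [if_pos (by omega)]
  rcases lt_trichotomy (M.layer s) h with hs | hs | hs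
  · rw [if_neg hs.ne]
    refine Finset.sum_nonneg fun a _ => ?_
    rw [if_neg (by omega)]
    have : M.expNext (fun s => if h < M.layer s then V s else 0) s a = 0 := by
      refine Finset.sum_eq_zero fun s' _ => ?_
      by_cases hP : M.P s a (some s') = 0
      · simp [hP]
      · have h1 := M.P_next _ _ _ hP
        beta_reduce
        rw [if_neg (by omega), mul_zero]
    rw [this]
    simpa using hnn a
  · rw [if_pos hs]
    refine Finset.sum_le_sum fun a _ => le_of_eq ?_
    rw [hnext a hs.ge, if_neg (by omega), qvalue]
    ring
  · rw [if_neg hs.ne']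
    have h3 := M.sum_occ_mul_qvalue π (unitLoss c) s
    rw [← M.sum_occ hπ, Finset.sum_mul, ← sub_eq_zero, ← Finset.sum_sub_distrib] at h3
    refine le_of_eq_of_le h3.symm (Finset.sum_le_sum fun a _ => le_of_eq ?_)
    rw [hnext a hs.le, if_pos hs, qvalue]
    ring

lemma reach_mul_value_le (M : LayeredMDP S A) {π : S → A → ℝ} (hπ : IsPolicy π) (c : S × A)
    (s : S) : M.reach π (M.layer s) s * M.value π (unitLoss c) s ≤ M.occ π c.1 c.2 := by
  refine le_trans ?_ (M.sum_layer_occ_mul_qvalue_le hπ c (M.layer s))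
  have := Finset.single_le_sum (s := Finset.univ)
    (f := fun s' => if M.layer s' = M.layer s then
      ∑ a, M.occ π s' a * M.qvalue π (unitLoss c) s' a else 0) (fun s' _ => ?_) (Finset.mem_univ s)
  · simpa [sum_occ_mul_qvalue] using this
  · split_ifs
    · exact Finset.sum_nonneg fun a _ => mul_nonneg ((M.isFlow_occ hπ).nonneg _ _)
        (M.qvalue_unitLoss_nonneg hπ _ _ _)
    · exact le_rfl

/-- The probability of passing through (s, a) and then meeting `c` cannot exceed that of meeting
`c`. This is what compares powers of the two occupancies. -/
lemma occ_mul_qvalue_le (M : LayeredMDP S A) {π : S → A → ℝ} (hπ : IsPolicy π) (c : S × A)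
    (s : S) (a : A) : M.occ π s a * M.qvalue π (unitLoss c) s a ≤ M.occ π c.1 c.2 := by
  refine le_trans ?_ (M.reach_mul_value_le hπ c s)
  rw [← M.sum_occ_mul_qvalue]
  exact Finset.single_le_sum (f := fun a => M.occ π s a * M.qvalue π (unitLoss c) s a)
    (fun a _ => mul_nonneg ((M.isFlow_occ hπ).nonneg _ _)
      (M.qvalue_unitLoss_nonneg hπ _ _ _)) (Finset.mem_univ a)

lemma isPolicy_detPolicy (p : S → A) : IsPolicy (detPolicy p) := fun s =>
  ⟨fun a => by unfold detPolicy; split_ifs <;> norm_num, by simp [detPolicy]⟩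

/-- The part of `∑ f (s, a)` at the pairs that `p` does not choose. -/
noncomputable def offSum (p : S → A) (f : S → A → ℝ) : ℝ :=
  ∑ s, ∑ a, if a = p s then 0 else f s a

/-- Performance difference: with the unit loss at (s, p s) and the value function of p as potential,
the left side is the average advantage under the flow of π. The advantage is zero at the actions of
p and at most one elsewhere. -/
lemma occ_sub_occ_detPolicy_le (M : LayeredMDP S A) {π : S → A → ℝ} (hπ : IsPolicy π) (p : S → A)
    (s : S) :
    M.occ π s (p s) - M.occ (detPolicy p) s (p s) ≤ offSum p (M.occ π) := by
  have hp := isPolicy_detPolicy p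
  set c : S × A := (s, p s)
  set V := M.value (detPolicy p) (unitLoss c) with hV
  have h1 := (M.isFlow_occ hπ).pairing_shift V
  have h2 := M.pairing_occ hp (unitLoss c)
  rw [pairing_unitLoss] at h2
  have h3 := pairing_unitLoss (M.occ π) c
  have h4 : M.occ π s (p s) - M.occ (detPolicy p) s (p s) = pairing (M.occ π) (unitLoss c) +
      pairing (M.occ π) (fun s a => M.expNext V s a - V s) := by
    rw [h1, h3, h2]
    ring
  rw [h4]
  simp only [pairing, ← Finset.sum_add_distrib, offSum]
  refine Finset.sum_le_sum fun s' _ => Finset.sum_le_sum fun a _ => ?_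
  have hv : V s' = M.qvalue (detPolicy p) (unitLoss c) s' (p s') := by
    rw [hV, value_eq_sum]
    simp [detPolicy]
  split_ifs with ha
  · rw [hv, ha, qvalue]
    apply le_of_eq
    ring
  · have h5 := M.qvalue_unitLoss_le_one hp c s' a
    rw [qvalue] at h5
    have h6 := M.value_unitLoss_nonneg hp c s'
    nlinarith [(M.isFlow_occ hπ).nonneg s' a]

lemma occ_detPolicy_of_ne (M : LayeredMDP S A) (p : S → A) {s : S} {a : A} (h : a ≠ p s) :
    M.occ (detPolicy p) s a = 0 := by
  simp [occ, detPolicy, h]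

end LayeredMDP

namespace LayeredMDP

variable {S A : Type*} [Fintype S] [DecidableEq S] [Fintype A] [DecidableEq A]

/-! ### Trajectories -/

/-- The probability that the first state is `y.1` and that the action `y.2` is taken there, if no
pair `y'` precedes, and of the corresponding transition from `y'` otherwise. -/
def stepProb (M : LayeredMDP S A) (π : S → A → ℝ) {n : ℕ} (τ : Fin n → S × A) (h : Fin n) : ℝ :=
  (if h.1 = 0 then (if (τ h).1 = M.s₁ then 1 else 0)
    else
      let prev := τ ⟨h.1 - 1, lt_of_le_of_lt (Nat.sub_le _ _) h.2⟩
      M.P prev.1 prev.2 (some (τ h).1)) *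
  π (τ h).1 (τ h).2

/-- The probability that an episode starts with the path `τ`. -/
def pathProb (M : LayeredMDP S A) (π : S → A → ℝ) {n : ℕ} (τ : Fin n → S × A) : ℝ :=
  ∏ h : Fin n, M.stepProb π τ h

lemma trajProb_eq (M : LayeredMDP S A) (π : S → A → ℝ) (τ : M.Traj) :
    M.trajProb π τ = M.pathProb π τ := rfl

lemma pathProb_nonneg (M : LayeredMDP S A) {π : S → A → ℝ} (hπ : IsPolicy π) {n : ℕ}
    (τ : Fin n → S × A) : 0 ≤ M.pathProb π τ := by
  refine Finset.prod_nonneg fun h _ => mul_nonneg ?_ ((hπ _).1 _)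
  split_ifs
  · norm_num
  · norm_num
  · exact M.P_nonneg _ _ _

lemma layer_of_pathProb_ne_zero (M : LayeredMDP S A) {π : S → A → ℝ} {n : ℕ} {τ : Fin n → S × A}
    (h : M.pathProb π τ ≠ 0) (i : Fin n) : M.layer (τ i).1 = i := by
  obtain ⟨i, hi⟩ := i
  induction i with
  | zero =>
    have h1 := left_ne_zero_of_mul (Finset.prod_ne_zero_iff.1 h ⟨0, hi⟩ (Finset.mem_univ _))
    rw [if_pos rfl] at h1
    exact (M.layer_eq_zero _).2 (by by_contra h2; simp [h2] at h1)
  | succ i ih =>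
    have h1 := left_ne_zero_of_mul (Finset.prod_ne_zero_iff.1 h ⟨i + 1, hi⟩ (Finset.mem_univ _))
    rw [if_neg (Nat.succ_ne_zero i)] at h1
    have h2 := M.P_next _ _ _ h1
    rw [h2]
    have h3 := ih (by omega)
    simp only [Nat.add_sub_cancel] at h3 ⊢
    rw [h3]

lemma stepProb_snoc_castSucc (M : LayeredMDP S A) (π : S → A → ℝ) {n : ℕ} (τ : Fin n → S × A)
    (y : S × A) (i : Fin n) :
    M.stepProb π (Fin.snoc τ y : Fin (n + 1) → S × A) i.castSucc = M.stepProb π τ i := by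
  have h : ∀ (hi : i.1 - 1 < n + 1), (⟨i.1 - 1, hi⟩ : Fin (n + 1)) =
      (⟨i.1 - 1, lt_of_le_of_lt (Nat.sub_le _ _) i.2⟩ : Fin n).castSucc := fun _ => rfl
  have e : ∀ j : Fin n, (Fin.snoc τ y : Fin (n + 1) → S × A) j.castSucc = τ j := fun j => by
    simp
  simp only [stepProb, Fin.val_castSucc, h, e]

lemma pathProb_snoc (M : LayeredMDP S A) (π : S → A → ℝ) {n : ℕ} (τ : Fin (n + 1) → S × A)
    (y : S × A) :
    M.pathProb π (Fin.snoc τ y : Fin (n + 2) → S × A) =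
      M.pathProb π τ *
        (M.P (τ (Fin.last n)).1 (τ (Fin.last n)).2 (some y.1) * π y.1 y.2) := by
  rw [pathProb, Fin.prod_univ_castSucc]
  congr 1
  · exact Finset.prod_congr rfl fun i _ => M.stepProb_snoc_castSucc π τ y i
  · have h : ∀ (hi : n + 1 - 1 < n + 2), (⟨n + 1 - 1, hi⟩ : Fin (n + 2)) =
      (Fin.last n).castSucc := fun _ => rfl
    have e : ∀ j : Fin (n + 1), (Fin.snoc τ y : Fin (n + 2) → S × A) j.castSucc = τ j :=
      fun j => by simp
    simp only [stepProb, Fin.val_last, h, e, Fin.snoc_last]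
    simp

lemma sum_snoc {X : Type*} [Fintype X] {n : ℕ} (F : (Fin (n + 1) → X) → ℝ) :
    ∑ τ, F τ = ∑ τ : Fin n → X, ∑ y : X, F (Fin.snoc τ y) := by
  rw [← (Fin.snocEquiv fun _ : Fin (n + 1) => X).sum_comp, Fintype.sum_prod_type, Finset.sum_comm]
  rfl

/-- The law of the `h`-th pair of a path. -/
lemma sum_pathProb_mul (M : LayeredMDP S A) {π : S → A → ℝ} (hπ : IsPolicy π) {n : ℕ}
    (hn : n ≤ M.H) (h : Fin n) (f : S × A → ℝ) :
    ∑ τ : Fin n → S × A, M.pathProb π τ * f (τ h) =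
      ∑ s, ∑ a, M.reach π h s * π s a * f (s, a) := by
  induction n generalizing f with
  | zero => exact h.elim0
  | succ n ih =>
    rcases n with _ | n
    · obtain rfl : h = (0 : Fin 1) := Fin.fin_one_eq_zero h
      rw [sum_snoc, Fintype.sum_unique, Fintype.sum_prod_type]
      refine Finset.sum_congr rfl fun s _ => Finset.sum_congr rfl fun a _ => ?_
      have e : (Fin.snoc default (s, a) : Fin 1 → S × A) 0 = (s, a) := rfl
      rw [e, pathProb, Fin.prod_univ_castSucc, Finset.univ_eq_empty, Finset.prod_empty, one_mul]
      congr 1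
    · rw [sum_snoc]
      refine Fin.lastCases ?_ (fun i => ?_) h
      -- For the last pair, averaging `f` over one transition gives a function of the preceding
      -- pair, to which the induction hypothesis applies.
      · have e : ∀ τ : Fin (n + 1) → S × A, ∑ y : S × A,
            M.pathProb π (Fin.snoc τ y : Fin (n + 2) → S × A) *
              f ((Fin.snoc τ y : Fin (n + 2) → S × A) (Fin.last (n + 1))) =
            M.pathProb π τ * (fun z : S × A => ∑ y : S × A,
              M.P z.1 z.2 (some y.1) * π y.1 y.2 * f y) (τ (Fin.last n)) := by
          intro τ
          simp only [pathProb_snoc, Fin.snoc_last, Finset.mul_sum]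
          exact Finset.sum_congr rfl fun _ _ => by ring
        rw [Finset.sum_congr rfl fun τ _ => e τ, ih (by omega) (Fin.last n) (fun z : S × A =>
          ∑ y : S × A, M.P z.1 z.2 (some y.1) * π y.1 y.2 * f y)]
        simp only [Fin.val_last, reach, Fintype.sum_prod_type, Finset.mul_sum, Finset.sum_mul]
        rw [← Fintype.sum_prod_type' (fun s a => ∑ s', ∑ a', M.reach π n s * π s a *
          (M.P s a (some s') * π s' a' * f (s', a'))), Finset.sum_comm]
        refine Finset.sum_congr rfl fun s _ => ?_
        rw [Finset.sum_comm]
        refine Finset.sum_congr rfl fun a _ => ?_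
        rw [Fintype.sum_prod_type]
        exact Finset.sum_congr rfl fun _ _ => Finset.sum_congr rfl fun _ _ => by ring
      · rw [Fin.val_castSucc, ← ih (by omega) i f]
        refine Finset.sum_congr rfl fun τ _ => ?_
        have e : ∀ y : S × A, M.pathProb π (Fin.snoc τ y : Fin (n + 2) → S × A) *
              f ((Fin.snoc τ y : Fin (n + 2) → S × A) i.castSucc) =
            M.pathProb π τ * f (τ i) *
              (M.P (τ (Fin.last n)).1 (τ (Fin.last n)).2 (some y.1) * π y.1 y.2) := by
          intro y
          rw [pathProb_snoc, show (Fin.snoc τ y : Fin (n + 2) → S × A) i.castSucc = τ i by simp]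
          ring
        rw [Finset.sum_congr rfl fun y _ => e y, ← Finset.mul_sum, Fintype.sum_prod_type]
        by_cases hτ : M.pathProb π τ = 0
        · simp [hτ]
        · have hl := M.layer_of_pathProb_ne_zero hτ (Fin.last n)
          -- The preceding pair is not in the final layer, so no mass goes to the terminal state and
          -- the last pair sums out to one.
          have h0 : M.P (τ (Fin.last n)).1 (τ (Fin.last n)).2 none = 0 := by
            by_contra hP
            have := M.P_terminal _ _ hP
            rw [hl, Fin.val_last] at this
            omega
          simp only [← Finset.mul_sum, (hπ _).2, mul_one, sum_P_some, h0, sub_zero]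

/-- The probability of visiting a pair is its occupancy measure. -/
lemma sum_trajProb_visit (M : LayeredMDP S A) {π : S → A → ℝ} (hπ : IsPolicy π) (s : S) (a : A) :
    ∑ τ : M.Traj, M.trajProb π τ * (if ∃ h, τ h = (s, a) then 1 else 0) = M.occ π s a := by
  have h := M.sum_pathProb_mul hπ le_rfl ⟨M.layer s, M.layer_lt s⟩
    (fun y => if y = (s, a) then 1 else 0)
  have e : ∑ s', ∑ a', M.reach π (M.layer s) s' * π s' a' * (if (s', a') = (s, a) then 1 else 0) =
      M.occ π s a := by
    rw [← Fintype.sum_prod_type' (fun s' a' => M.reach π (M.layer s) s' * π s' a' *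
      (if (s', a') = (s, a) then 1 else 0))]
    simp [occ]
  rw [← e, ← h]
  refine Finset.sum_congr rfl fun τ _ => ?_
  rw [trajProb_eq]
  by_cases hτ : M.pathProb π τ = 0
  · simp [hτ]
  -- On a path of positive probability the pair can occur only at the time given by its layer.
  · congr 2
    refine propext ⟨?_, fun h => ⟨_, h⟩⟩
    rintro ⟨i, hi⟩
    have := M.layer_of_pathProb_ne_zero hτ i
    rw [hi] at this
    rw [← hi]
    congr 1
    exact Fin.ext this

end LayeredMDP

/-! ### Inequalities for real powers -/

namespace Real

lemma rpow_sum_le_sum_rpow_of_le_one {ι : Type*} (s : Finset ι) {f : ι → ℝ} (hf : ∀ i, 0 ≤ f i)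
    {q : ℝ} (hq0 : 0 < q) (hq1 : q ≤ 1) : (∑ i ∈ s, f i) ^ q ≤ ∑ i ∈ s, f i ^ q := by
  classical
  induction s using Finset.induction_on with
  | empty => simp [hq0.ne']
  | insert i s hi ih =>
    rw [Finset.sum_insert hi, Finset.sum_insert hi]
    exact (Real.rpow_add_le_add_rpow (hf i) (Finset.sum_nonneg fun j _ => hf j) hq0.le hq1).trans
      (by linarith)

lemma rpow_sub_rpow_le {x u q : ℝ} (hx : 0 ≤ x) (hu : 0 ≤ u) (hq0 : 0 < q) (hq1 : q ≤ 1) :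
    x ^ q - u ^ q ≤ (max (x - u) 0) ^ q := by
  rcases le_total x u with h | h
  · have h1 := Real.rpow_le_rpow hx h hq0.le
    have h2 : 0 ≤ (max (x - u) 0) ^ q := Real.rpow_nonneg (le_max_right _ _) _
    linarith
  · rw [max_eq_left (by linarith)]
    have := Real.rpow_add_le_add_rpow (a := x - u) (b := u) (by linarith) hu hq0.le hq1
    rw [sub_add_cancel] at this
    linarith

lemma mul_rpow_sub_one_le {x u q : ℝ} (hu : 0 ≤ u) (hq0 : 0 < q) (hq1 : q ≤ 1) :
    max (x - u) 0 * x ^ (q - 1) ≤ (max (x - u) 0) ^ q := by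
  rcases le_or_gt (x - u) 0 with h | h
  · rw [max_eq_right h, zero_mul, Real.zero_rpow hq0.ne']
  · rw [max_eq_left h.le]
    calc (x - u) * x ^ (q - 1) ≤ (x - u) * (x - u) ^ (q - 1) :=
          mul_le_mul_of_nonneg_left
            (Real.rpow_le_rpow_of_nonpos h (by linarith) (by linarith)) h.le
      _ = (x - u) ^ q := by
          rw [Real.rpow_sub_one h.ne']
          field_simp

/-- The hypotheses say y ≤ min(1, z/x), and either bound suffices according to whether x ≤ z. It is
used with y a visit probability and x, z the masses at its two ends. -/
lemma mul_rpow_sub_one_le_rpow_sub_one {x y z q : ℝ} (hx : 0 < x) (hz : 0 < z)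
    (hy1 : y ≤ 1) (hxy : x * y ≤ z) (hq0 : 0 < q) (hq1 : q ≤ 1) :
    y * z ^ (q - 1) ≤ x ^ (q - 1) := by
  rcases le_total x z with h | h
  · calc y * z ^ (q - 1) ≤ 1 * z ^ (q - 1) :=
          mul_le_mul_of_nonneg_right hy1 (Real.rpow_nonneg hz.le _)
      _ ≤ x ^ (q - 1) := by
          rw [one_mul]
          exact Real.rpow_le_rpow_of_nonpos hx h (by linarith)
  · have h1 : y ≤ z / x := by
      rw [le_div_iff₀ hx]
      linarith
    calc y * z ^ (q - 1) ≤ z / x * z ^ (q - 1) :=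
          mul_le_mul_of_nonneg_right h1 (Real.rpow_nonneg hz.le _)
      _ = z ^ q / x := by
          rw [Real.rpow_sub_one hz.ne']
          field_simp
      _ ≤ x ^ q / x := by
          gcongr
      _ = x ^ (q - 1) := by rw [Real.rpow_sub_one hx.ne']

end Real

/-! ### Power sums of occupancy measures. -/

namespace LayeredMDP

variable {S A : Type*} [Fintype S] [DecidableEq S] [Fintype A] [DecidableEq A]

/-- The sum `∑ x(s,a)^q`. -/
noncomputable def powSum (q : ℝ) (x : S → A → ℝ) : ℝ := ∑ s, ∑ a, x s a ^ q

lemma powSum_nonneg {q : ℝ} {x : S → A → ℝ} (hx : ∀ s a, 0 ≤ x s a) : 0 ≤ powSum q x :=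
  Finset.sum_nonneg fun s _ => Finset.sum_nonneg fun a _ => Real.rpow_nonneg (hx s a) _

lemma offSum_nonneg (p : S → A) {f : S → A → ℝ} (hf : ∀ s a, 0 ≤ f s a) : 0 ≤ offSum p f :=
  Finset.sum_nonneg fun s _ => Finset.sum_nonneg fun a _ => by
    split_ifs
    exacts [le_rfl, hf s a]

lemma occ_nonneg (M : LayeredMDP S A) {π : S → A → ℝ} (hπ : IsPolicy π) (s : S) (a : A) :
    0 ≤ M.occ π s a := (M.isFlow_occ hπ).nonneg s a

lemma occ_le_one (M : LayeredMDP S A) {π : S → A → ℝ} (hπ : IsPolicy π) (s : S) (a : A) :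
    M.occ π s a ≤ 1 := by
  have h := M.pairing_occ hπ (unitLoss (s, a))
  rw [pairing_unitLoss] at h
  rw [h]
  exact M.value_unitLoss_le_one hπ _ _

lemma powSum_occ_le_card (M : LayeredMDP S A) {π : S → A → ℝ} (hπ : IsPolicy π) {q : ℝ}
    (hq : 0 ≤ q) : powSum q (M.occ π) ≤ Fintype.card S * Fintype.card A := by
  calc powSum q (M.occ π) ≤ ∑ _s : S, ∑ _a : A, (1 : ℝ) :=
        Finset.sum_le_sum fun s _ => Finset.sum_le_sum fun a _ =>
          Real.rpow_le_one (M.occ_nonneg hπ s a) (M.occ_le_one hπ s a) hq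
    _ = _ := by simp

/-- The power mean inequality over the SA pairs, with total mass at most H. -/
lemma powSum_occ_le (M : LayeredMDP S A) {π : S → A → ℝ} (hπ : IsPolicy π) {α : ℝ}
    (hα : 1 ≤ α) : powSum (1 / α) (M.occ π) ≤
      (M.H : ℝ) ^ (1 / α) * ((Fintype.card S : ℝ) * Fintype.card A) ^ (1 - 1 / α) := by
  have hα0 : 0 < α := by linarith
  have hx := M.occ_nonneg hπ
  have hnn : ∀ c : S × A, 0 ≤ M.occ π c.1 c.2 ^ (1 / α) := fun c => Real.rpow_nonneg (hx _ _) _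
  have h := Real.rpow_sum_le_const_mul_sum_rpow_of_nonneg (Finset.univ : Finset (S × A)) hα
    (fun c _ => hnn c)
  have e : ∀ c : S × A, (M.occ π c.1 c.2 ^ (1 / α)) ^ α = M.occ π c.1 c.2 := fun c => by
    rw [← Real.rpow_mul (hx _ _), one_div_mul_cancel hα0.ne', Real.rpow_one]
  simp only [e] at h
  have h1 : ∑ c : S × A, M.occ π c.1 c.2 ≤ M.H := by
    rw [Fintype.sum_prod_type]
    exact M.sum_occ_le hπ
  rw [powSum, ← Fintype.sum_prod_type' (fun s a => M.occ π s a ^ (1 / α))]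
  have hS : 0 ≤ ∑ c : S × A, M.occ π c.1 c.2 ^ (1 / α) := Finset.sum_nonneg fun c _ => hnn c
  calc ∑ c : S × A, M.occ π c.1 c.2 ^ (1 / α)
      = ((∑ c : S × A, M.occ π c.1 c.2 ^ (1 / α)) ^ α) ^ (1 / α) := by
        rw [← Real.rpow_mul hS, mul_one_div_cancel hα0.ne', Real.rpow_one]
    _ ≤ (((Fintype.card S : ℝ) * Fintype.card A) ^ (α - 1) * M.H) ^ (1 / α) := by
        refine Real.rpow_le_rpow (Real.rpow_nonneg hS _) (h.trans ?_) (by positivity)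
        rw [Finset.card_univ, Fintype.card_prod, Nat.cast_mul]
        gcongr
    _ = _ := by
        rw [Real.mul_rpow (by positivity) (by positivity), ← Real.rpow_mul (by positivity), mul_comm]
        congr 2
        field_simp

/-- At a pair that p does not choose the comparator has no mass and the term is x^q. Each of the S
remaining pairs has excess at most the total off-policy mass, whose q-th power is at most the
off-policy sum of x^q by subadditivity. Hence the factor 1 + S. -/
lemma max_occ_sub_rpow_le (M : LayeredMDP S A) {π : S → A → ℝ} (hπ : IsPolicy π) (p : S → A)
    {q : ℝ} (hq0 : 0 < q) (hq1 : q ≤ 1) :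
    ∑ s, ∑ a, (max (M.occ π s a - M.occ (detPolicy p) s a) 0) ^ q ≤
      (1 + Fintype.card S) * offSum p (fun s a => M.occ π s a ^ q) := by
  have hx := M.occ_nonneg hπ
  have h0 : (offSum p (M.occ π)) ^ q ≤ offSum p (fun s a => M.occ π s a ^ q) := by
    unfold offSum
    refine (Real.rpow_sum_le_sum_rpow_of_le_one _ (fun s => Finset.sum_nonneg fun a _ => ?_)
      hq0 hq1).trans (Finset.sum_le_sum fun s _ =>
        (Real.rpow_sum_le_sum_rpow_of_le_one _ (fun a => ?_) hq0 hq1).trans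
          (Finset.sum_le_sum fun a _ => ?_))
    · split_ifs
      exacts [le_rfl, hx s a]
    · split_ifs
      exacts [le_rfl, hx s a]
    · split_ifs
      · rw [Real.zero_rpow hq0.ne']
      · exact le_rfl
  have h1 : ∀ s, (max (M.occ π s (p s) - M.occ (detPolicy p) s (p s)) 0) ^ q ≤
      offSum p (fun s a => M.occ π s a ^ q) := fun s =>
    (Real.rpow_le_rpow (le_max_right _ _)
      (max_le (M.occ_sub_occ_detPolicy_le hπ p s) (offSum_nonneg p hx)) hq0.le).trans h0
  calc ∑ s, ∑ a, (max (M.occ π s a - M.occ (detPolicy p) s a) 0) ^ q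
      ≤ ∑ s, ((∑ a, if a = p s then 0 else M.occ π s a ^ q) +
          offSum p (fun s a => M.occ π s a ^ q)) := by
        refine Finset.sum_le_sum fun s _ => ?_
        rw [← Finset.add_sum_erase _ _ (Finset.mem_univ (p s)),
          ← Finset.add_sum_erase _ (fun a => if a = p s then 0 else M.occ π s a ^ q)
            (Finset.mem_univ (p s)), if_pos rfl, zero_add, add_comm]
        refine add_le_add (Finset.sum_le_sum fun a ha => ?_) (h1 s)
        have ha' := Finset.ne_of_mem_erase ha
        rw [if_neg ha', M.occ_detPolicy_of_ne p ha', sub_zero, max_eq_left (hx s a)]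
    _ = _ := by
        rw [Finset.sum_add_distrib, Finset.sum_const, Finset.card_univ, nsmul_eq_mul, offSum]
        ring

lemma powSum_sub_le (M : LayeredMDP S A) {π : S → A → ℝ} (hπ : IsPolicy π) (p : S → A)
    {q : ℝ} (hq0 : 0 < q) (hq1 : q ≤ 1) :
    powSum q (M.occ π) - powSum q (M.occ (detPolicy p)) ≤
      (1 + Fintype.card S) * offSum p (fun s a => M.occ π s a ^ q) := by
  refine le_trans ?_ (M.max_occ_sub_rpow_le hπ p hq0 hq1)
  simp only [powSum, ← Finset.sum_sub_distrib]
  exact Finset.sum_le_sum fun s _ => Finset.sum_le_sum fun a _ =>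
    Real.rpow_sub_rpow_le (M.occ_nonneg hπ s a) (M.occ_nonneg (isPolicy_detPolicy p) s a) hq0 hq1

lemma sum_max_mul_rpow_le_offSum (M : LayeredMDP S A) {π : S → A → ℝ} (hπ : IsPolicy π)
    (p : S → A) {q : ℝ} (hq0 : 0 < q) (hq1 : q ≤ 1) :
    ∑ s, ∑ a, max (M.occ π s a - M.occ (detPolicy p) s a) 0 * M.occ π s a ^ (q - 1) ≤
      (1 + Fintype.card S) * offSum p (fun s a => M.occ π s a ^ q) :=
  le_trans (Finset.sum_le_sum fun s _ => Finset.sum_le_sum fun a _ =>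
    Real.mul_rpow_sub_one_le (M.occ_nonneg (isPolicy_detPolicy p) s a)
      hq0 hq1) (M.max_occ_sub_rpow_le hπ p hq0 hq1)

lemma sum_max_mul_rpow_le_powSum (M : LayeredMDP S A) {π : S → A → ℝ} (hπ : IsPolicy π)
    (p : S → A) {q : ℝ} (hq0 : 0 < q) (hq1 : q ≤ 1) :
    ∑ s, ∑ a, max (M.occ π s a - M.occ (detPolicy p) s a) 0 * M.occ π s a ^ (q - 1) ≤
      powSum q (M.occ π) := by
  refine Finset.sum_le_sum fun s _ => Finset.sum_le_sum fun a _ => ?_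
  have hx := M.occ_nonneg hπ s a
  have hu := M.occ_nonneg (isPolicy_detPolicy p) s a
  exact (Real.mul_rpow_sub_one_le hu hq0 hq1).trans
    (Real.rpow_le_rpow (le_max_right _ _) (max_le (by linarith) hx) hq0.le)

/-! ### The advantage of unit losses -/

/-- The advantage `Q^π(s, a) - V^π(s)` of the unit loss at `c`. -/
noncomputable def unitAdv (M : LayeredMDP S A) (π : S → A → ℝ) (c : S × A) (s : S) (a : A) : ℝ :=
  M.qvalue π (unitLoss c) s a - M.value π (unitLoss c) s

lemma policy_le_one {π : S → A → ℝ} (hπ : IsPolicy π) (s : S) (a : A) : π s a ≤ 1 := by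
  rw [← (hπ s).2]
  exact Finset.single_le_sum (f := π s) (fun b _ => (hπ s).1 b) (Finset.mem_univ a)

lemma occ_le_reach (M : LayeredMDP S A) {π : S → A → ℝ} (hπ : IsPolicy π) (s : S) (a : A) :
    M.occ π s a ≤ M.reach π (M.layer s) s :=
  mul_le_of_le_one_right (M.reach_nonneg hπ _ _) (policy_le_one hπ s a)

lemma qvalue_unitLoss_mul_rpow_le (M : LayeredMDP S A) {π : S → A → ℝ} (hπ : IsPolicy π)
    {c : S × A} (hc : 0 < M.occ π c.1 c.2) {s : S} {a : A} (hx : 0 < M.occ π s a) {q : ℝ}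
    (hq0 : 0 < q) (hq1 : q ≤ 1) :
    M.qvalue π (unitLoss c) s a * M.occ π c.1 c.2 ^ (q - 1) ≤ M.occ π s a ^ (q - 1) :=
  Real.mul_rpow_sub_one_le_rpow_sub_one hx hc (M.qvalue_unitLoss_le_one hπ c s a)
    (M.occ_mul_qvalue_le hπ c s a) hq0 hq1

/-- An estimate at `c` can be of size x(c)^(q-1). Its effect on the advantage at (s, a) is only of
size x(s,a)^(q-1), the scale that FTRL tolerates there. -/
lemma abs_unitAdv_mul_rpow_le (M : LayeredMDP S A) {π : S → A → ℝ} (hπ : IsPolicy π)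
    {c : S × A} (hc : 0 < M.occ π c.1 c.2) {s : S} {a : A} (hx : 0 < M.occ π s a) {q : ℝ}
    (hq0 : 0 < q) (hq1 : q ≤ 1) :
    |M.unitAdv π c s a| * M.occ π c.1 c.2 ^ (q - 1) ≤ 2 * M.occ π s a ^ (q - 1) := by
  have h1 := M.qvalue_unitLoss_mul_rpow_le hπ hc hx hq0 hq1
  have hxr := M.occ_le_reach hπ s a
  have h2 : M.value π (unitLoss c) s * M.occ π c.1 c.2 ^ (q - 1) ≤ M.occ π s a ^ (q - 1) :=
    (Real.mul_rpow_sub_one_le_rpow_sub_one (hx.trans_le hxr) hc (M.value_unitLoss_le_one hπ c s)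
      (M.reach_mul_value_le hπ c s) hq0 hq1).trans
      (Real.rpow_le_rpow_of_nonpos hx hxr (by linarith))
  have h3 : |M.unitAdv π c s a| ≤ M.qvalue π (unitLoss c) s a + M.value π (unitLoss c) s := by
    have h4 := M.qvalue_unitLoss_nonneg hπ c s a
    have h5 := M.value_unitLoss_nonneg hπ c s
    rw [unitAdv, abs_le]
    constructor <;> linarith
  have := mul_le_mul_of_nonneg_right h3 (Real.rpow_nonneg hc.le (q - 1))
  linarith

/-- The term of `b` itself drops out, so the advantage is small when the other actions have small
probability. -/
lemma unitAdv_greedy (M : LayeredMDP S A) {π : S → A → ℝ} (hπ : IsPolicy π) (c : S × A)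
    (s : S) (b : A) : M.unitAdv π c s b =
      ∑ a, if a = b then 0 else
        π s a * (M.qvalue π (unitLoss c) s b - M.qvalue π (unitLoss c) s a) := by
  have : M.unitAdv π c s b =
      ∑ a, π s a * (M.qvalue π (unitLoss c) s b - M.qvalue π (unitLoss c) s a) := by
    simp only [mul_sub, Finset.sum_sub_distrib, ← Finset.sum_mul, (hπ s).2, one_mul, unitAdv,
      ← value_eq_sum]
  rw [this]
  refine Finset.sum_congr rfl fun a _ => ?_
  split_ifs with h
  · rw [h]; ring
  · rfl

/-- With y the mass of the state, x(s,a) = y π(a). The difference of Q-values for `a` contributes at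
most π(a) (x(s,b)^(q-1) + x(s,a)^(q-1)). Using x(s,b) ≤ y and π(a), π(a)^q ≤ π(a)^(q/2), each part
becomes x(s,a)^(q/2). The weight has exponent 1 - q/2 because it is squared later. -/
lemma rpow_mul_unitAdv_greedy_le (M : LayeredMDP S A) {π : S → A → ℝ} (hπ : IsPolicy π)
    {c : S × A} (hc : 0 < M.occ π c.1 c.2) {s : S} {b : A} (hx : 0 < M.occ π s b) {q : ℝ}
    (hq0 : 0 < q) (hq1 : q ≤ 1) :
    M.occ π s b ^ (1 - q / 2) * |M.unitAdv π c s b * M.occ π c.1 c.2 ^ (q - 1)| ≤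
      ∑ a, if a = b then 0 else 2 * M.occ π s a ^ (q / 2) := by
  set y := M.reach π (M.layer s) s with hy
  have hyb := M.occ_le_reach hπ s b
  have hy0 : 0 < y := hx.trans_le hyb
  have hcq : 0 ≤ M.occ π c.1 c.2 ^ (q - 1) := Real.rpow_nonneg hc.le _
  rw [unitAdv_greedy M hπ, Finset.sum_mul]
  refine (mul_le_mul_of_nonneg_left (Finset.abs_sum_le_sum_abs _ _)
    (Real.rpow_nonneg hx.le _)).trans ?_
  rw [Finset.mul_sum]
  refine Finset.sum_le_sum fun a _ => ?_
  split_ifs with hab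
  · simp
  have hπ0 : 0 ≤ π s a := (hπ s).1 a
  have hπ1 := policy_le_one hπ s a
  rcases hπ0.eq_or_lt with h0 | hpos
  · rw [← h0]
    simpa using Real.rpow_nonneg (M.occ_nonneg hπ s a) (q / 2)
  have hxa : M.occ π s a = y * π s a := rfl
  have hxa0 : 0 < M.occ π s a := mul_pos hy0 hpos
  have hb := M.qvalue_unitLoss_mul_rpow_le hπ hc hx hq0 hq1
  have ha := M.qvalue_unitLoss_mul_rpow_le hπ hc hxa0 hq0 hq1
  have hb0 := mul_nonneg (M.qvalue_unitLoss_nonneg hπ c s b) hcq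
  have ha0 := mul_nonneg (M.qvalue_unitLoss_nonneg hπ c s a) hcq
  have habs : |π s a * (M.qvalue π (unitLoss c) s b - M.qvalue π (unitLoss c) s a) *
      M.occ π c.1 c.2 ^ (q - 1)| ≤
      π s a * (M.occ π s b ^ (q - 1) + M.occ π s a ^ (q - 1)) := by
    rw [mul_assoc, abs_mul, abs_of_pos hpos]
    refine mul_le_mul_of_nonneg_left ?_ hpos.le
    rw [sub_mul, abs_le]
    constructor <;> linarith
  have hhalf : π s a ≤ π s a ^ (q / 2) := by
    simpa using Real.rpow_le_rpow_of_exponent_ge hpos hπ1 (by linarith : q / 2 ≤ 1)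
  have hhalf' : π s a ^ q ≤ π s a ^ (q / 2) :=
    Real.rpow_le_rpow_of_exponent_ge hpos hπ1 (by linarith : q / 2 ≤ q)
  have hprod : M.occ π s a ^ (q / 2) = y ^ (q / 2) * π s a ^ (q / 2) := by
    rw [hxa, Real.mul_rpow hy0.le hπ0]
  calc M.occ π s b ^ (1 - q / 2) * |_|
      ≤ M.occ π s b ^ (1 - q / 2) * (π s a * (M.occ π s b ^ (q - 1) + M.occ π s a ^ (q - 1))) :=
        mul_le_mul_of_nonneg_left habs (Real.rpow_nonneg hx.le _)
    _ = π s a * M.occ π s b ^ (q / 2) +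
          M.occ π s b ^ (1 - q / 2) * (π s a * M.occ π s a ^ (q - 1)) := by
        rw [show q / 2 = (1 - q / 2) + (q - 1) by ring, Real.rpow_add hx]
        ring_nf
    _ ≤ π s a ^ (q / 2) * y ^ (q / 2) + y ^ (1 - q / 2) * (π s a * M.occ π s a ^ (q - 1)) := by
        have h1 : M.occ π s b ^ (q / 2) ≤ y ^ (q / 2) :=
          Real.rpow_le_rpow hx.le hyb (by linarith)
        have h2 : M.occ π s b ^ (1 - q / 2) ≤ y ^ (1 - q / 2) :=
          Real.rpow_le_rpow hx.le hyb (by linarith)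
        gcongr
    _ = π s a ^ (q / 2) * y ^ (q / 2) + π s a ^ q * y ^ (q / 2) := by
        rw [hxa, Real.mul_rpow hy0.le hπ0, show y ^ (q / 2) = y ^ (1 - q / 2) * y ^ (q - 1) by
          rw [← Real.rpow_add hy0]; ring_nf, Real.rpow_sub_one hpos.ne']
        field_simp
    _ ≤ π s a ^ (q / 2) * y ^ (q / 2) + π s a ^ (q / 2) * y ^ (q / 2) := by gcongr
    _ = 2 * M.occ π s a ^ (q / 2) := by rw [hprod]; ring

/-- In each state the action of p is handled by the greedy bound and Cauchy–Schwarz over the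
actions, at cost 4A; every other action by x^(2-q) (2 x^(q-1))² = 4 x^q. Together this is at most
8A. -/
lemma sum_rpow_mul_unitAdv_sq_le (M : LayeredMDP S A) {π : S → A → ℝ} (hπ : IsPolicy π)
    (p : S → A) {c : S × A} (hc : 0 < M.occ π c.1 c.2) {q : ℝ} (hq0 : 0 < q) (hq1 : q ≤ 1) :
    ∑ s, ∑ a, M.occ π s a ^ (2 - q) * (M.unitAdv π c s a * M.occ π c.1 c.2 ^ (q - 1)) ^ 2 ≤
      8 * Fintype.card A * offSum p (fun s a => M.occ π s a ^ q) := by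
  have hxnn := M.occ_nonneg hπ
  have hcq : 0 ≤ M.occ π c.1 c.2 ^ (q - 1) := Real.rpow_nonneg hc.le _
  have hA : (1 : ℝ) ≤ Fintype.card A := by
    exact_mod_cast Fintype.card_pos_iff.2 ⟨c.2⟩
  rw [offSum, Finset.mul_sum]
  refine Finset.sum_le_sum fun s _ => ?_
  set F := ∑ a, if a = p s then 0 else M.occ π s a ^ q with hF
  have hF0 : 0 ≤ F := Finset.sum_nonneg fun a _ => by
    split_ifs
    exacts [le_rfl, Real.rpow_nonneg (hxnn s a) _]
  have hdiag : M.occ π s (p s) ^ (2 - q) *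
      (M.unitAdv π c s (p s) * M.occ π c.1 c.2 ^ (q - 1)) ^ 2 ≤ 4 * Fintype.card A * F := by
    rcases (hxnn s (p s)).eq_or_lt with h0 | hpos
    · rw [← h0, Real.zero_rpow (by linarith), zero_mul]
      positivity
    · have h1 := M.rpow_mul_unitAdv_greedy_le hπ hc hpos hq0 hq1
      have h2 : (∑ a, if a = p s then 0 else 2 * M.occ π s a ^ (q / 2)) ^ 2 ≤
          Fintype.card A * (4 * F) := by
        refine sq_sum_le_card_mul_sum_sq.trans (le_of_eq ?_)
        rw [Finset.card_univ]
        congr 1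
        rw [hF, Finset.mul_sum]
        refine Finset.sum_congr rfl fun a _ => ?_
        split_ifs
        · ring
        · rw [mul_pow, ← Real.rpow_mul_natCast (hxnn s a)]
          norm_num
      have h3 : M.occ π s (p s) ^ (2 - q) = (M.occ π s (p s) ^ (1 - q / 2)) ^ 2 := by
        rw [← Real.rpow_natCast, ← Real.rpow_mul hpos.le]
        congr 1
        push_cast
        ring
      rw [h3, ← sq_abs (M.unitAdv π c s (p s) * _), ← mul_pow]
      calc _ ≤ (∑ a, if a = p s then 0 else 2 * M.occ π s a ^ (q / 2)) ^ 2 :=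
            pow_le_pow_left₀ (mul_nonneg (Real.rpow_nonneg hpos.le _) (abs_nonneg _)) h1 2
        _ ≤ _ := h2.trans (by linarith)
  have hoff : ∀ a, M.occ π s a ^ (2 - q) *
      (M.unitAdv π c s a * M.occ π c.1 c.2 ^ (q - 1)) ^ 2 ≤ 4 * M.occ π s a ^ q := by
    intro a
    rcases (hxnn s a).eq_or_lt with h0 | hpos
    · rw [← h0, Real.zero_rpow (by linarith), zero_mul]
      positivity
    · have h1 := M.abs_unitAdv_mul_rpow_le hπ hc hpos hq0 hq1
      have h2 : (M.unitAdv π c s a * M.occ π c.1 c.2 ^ (q - 1)) ^ 2 ≤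
          (2 * M.occ π s a ^ (q - 1)) ^ 2 := by
        rw [← sq_abs, abs_mul, abs_of_nonneg hcq]
        exact pow_le_pow_left₀ (mul_nonneg (abs_nonneg _) hcq) h1 2
      have h3 : M.occ π s a ^ (2 - q) * (M.occ π s a ^ (q - 1)) ^ 2 = M.occ π s a ^ q := by
        rw [← Real.rpow_natCast, ← Real.rpow_mul hpos.le, ← Real.rpow_add hpos]
        congr 1
        push_cast
        ring
      calc _ ≤ M.occ π s a ^ (2 - q) * (2 * M.occ π s a ^ (q - 1)) ^ 2 :=
            mul_le_mul_of_nonneg_left h2 (Real.rpow_nonneg hpos.le _)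
        _ = 4 * (M.occ π s a ^ (2 - q) * (M.occ π s a ^ (q - 1)) ^ 2) := by ring
        _ = _ := by rw [h3]
  rw [← Finset.add_sum_erase _ (fun a => M.occ π s a ^ (2 - q) *
    (M.unitAdv π c s a * M.occ π c.1 c.2 ^ (q - 1)) ^ 2) (Finset.mem_univ (p s))]
  have h4 : ∑ a ∈ Finset.univ.erase (p s), M.occ π s a ^ (2 - q) *
      (M.unitAdv π c s a * M.occ π c.1 c.2 ^ (q - 1)) ^ 2 ≤ 4 * F := by
    rw [hF, ← Finset.add_sum_erase _ (fun a => if a = p s then 0 else M.occ π s a ^ q)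
      (Finset.mem_univ (p s)), if_pos rfl, zero_add, Finset.mul_sum]
    refine Finset.sum_le_sum fun a ha => ?_
    rw [if_neg (Finset.ne_of_mem_erase ha)]
    exact hoff a
  nlinarith

/-- The shifted loss `ℓ + P v - v` for the value function `v` of `π`, as a combination of
advantages of unit losses. -/
lemma add_expNext_sub_value (M : LayeredMDP S A) (π ℓ : S → A → ℝ) (s : S) (a : A) :
    ℓ s a + (M.expNext (M.value π ℓ) s a - M.value π ℓ s) =
      ∑ c : S × A, ℓ c.1 c.2 * M.unitAdv π c s a := by
  have : ℓ s a + (M.expNext (M.value π ℓ) s a - M.value π ℓ s) =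
      M.qvalue π ℓ s a - M.value π ℓ s := by
    rw [qvalue]; ring
  rw [this, qvalue_eq_sum_unitLoss M π ℓ, value_eq_sum_unitLoss M π ℓ, ← Finset.sum_sub_distrib]
  exact Finset.sum_congr rfl fun c _ => by rw [unitAdv]; ring

end LayeredMDP

/-! ### Stability of the Tsallis regularizer -/

/-- The constant of the local stability estimate for the `q`-Tsallis regularizer. -/
noncomputable def tsallisStab (q : ℝ) : ℝ :=
  (1 - q) * (2 * (q / (1 - q)) + 3 * (q / (1 - q)) ^ 2) / q ^ 2

lemma tsallisStab_pos {q : ℝ} (hq0 : 0 < q) (hq1 : q < 1) : 0 < tsallisStab q := by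
  have h1 : 0 < 1 - q := by linarith
  unfold tsallisStab
  positivity

lemma Real.rpow_le_tangent {r w q : ℝ} (hr : 0 ≤ r) (hw : 0 < w) (hq0 : 0 ≤ q) (hq1 : q ≤ 1) :
    r ^ q ≤ w ^ q + q * w ^ (q - 1) * (r - w) := by
  have h := rpow_one_add_le_one_add_mul_self (s := r / w - 1)
    (by have : 0 ≤ r / w := by positivity
        linarith) hq0 hq1
  rw [add_sub_cancel, Real.div_rpow hr hw.le, div_le_iff₀ (Real.rpow_pos_of_pos hw _)] at h
  refine h.trans (le_of_eq ?_)
  rw [Real.rpow_sub_one hw.ne']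
  field_simp

/-- Use log(1 + y) ≥ y/(1 + y) ≥ y - 2y² and then e^v ≤ 1 + v + v², which applies since the bounds
1/4 give |v| ≤ 1. -/
lemma one_add_rpow_neg_le {y p : ℝ} (hp : 0 < p) (hy : |y| ≤ 1 / 4) (hpy : p * |y| ≤ 1 / 4) :
    (1 + y) ^ (-p) ≤ 1 - p * y + (2 * p + 3 * p ^ 2) * y ^ 2 := by
  obtain ⟨hy1, hy2⟩ := abs_le.1 hy
  have hpos : 0 < 1 + y := by linarith
  have hlog : y - 2 * y ^ 2 ≤ Real.log (1 + y) := by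
    refine le_trans ?_ (Real.one_sub_inv_le_log_of_pos hpos)
    rw [show 1 - (1 + y)⁻¹ = y / (1 + y) by field_simp; ring, le_div_iff₀ hpos]
    nlinarith [sq_nonneg y, mul_nonneg (sq_nonneg y) (by linarith : 0 ≤ y + 1 / 4)]
  set v := -(p * y) + 2 * p * y ^ 2 with hv
  have hle : Real.log (1 + y) * -p ≤ v := by
    rw [hv]
    nlinarith
  have hy3 : y ^ 2 = |y| ^ 2 := (sq_abs y).symm
  have h0 := abs_nonneg y
  have hvabs : |v| ≤ 3 / 2 * (p * |y|) := by
    calc |v| ≤ |-(p * y)| + |2 * p * y ^ 2| := abs_add_le _ _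
      _ = p * |y| + 2 * (p * |y|) * |y| := by
        rw [abs_neg, abs_mul, abs_of_pos hp,
          abs_of_nonneg (show 0 ≤ 2 * p * y ^ 2 by positivity), hy3]
        ring
      _ ≤ 3 / 2 * (p * |y|) := by
        have := mul_nonneg hp.le h0
        nlinarith
  have hexp := (abs_le.1 (Real.abs_exp_sub_one_sub_id_le (x := v) (by linarith))).2
  have hv2 : v ^ 2 ≤ 3 * p ^ 2 * y ^ 2 := by
    have := pow_le_pow_left₀ (abs_nonneg v) hvabs 2
    rw [sq_abs] at this
    rw [hy3]
    nlinarith [mul_nonneg (sq_nonneg p) (sq_nonneg |y|)]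
  rw [Real.rpow_def_of_pos hpos]
  calc Real.exp (Real.log (1 + y) * -p) ≤ Real.exp v := Real.exp_le_exp.2 hle
    _ ≤ 1 + v + v ^ 2 := by linarith
    _ ≤ _ := by rw [hv] at hv2 ⊢; nlinarith

lemma tsallis_stability_unit {q r lam : ℝ} (hq0 : 0 < q) (hq1 : q < 1) (hr : 0 ≤ r)
    (hlam : |lam| ≤ q * (1 - q) / 4) :
    (1 - r) * lam - (q * (r - 1) - r ^ q + 1) ≤ tsallisStab q * lam ^ 2 := by
  have h1q : 0 < 1 - q := by linarith
  set y := lam / q with hy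
  set p := q / (1 - q) with hp
  have hp0 : 0 < p := by positivity
  have hlamy : lam = q * y := by rw [hy]; field_simp
  have hyabs : |y| ≤ (1 - q) / 4 := by
    rw [hy, abs_div, abs_of_pos hq0, div_le_iff₀ hq0]
    linarith
  have hy4 : |y| ≤ 1 / 4 := by linarith
  have hpy : p * |y| ≤ 1 / 4 := by
    calc p * |y| ≤ p * ((1 - q) / 4) := by gcongr
      _ = q / 4 := by rw [hp]; field_simp
      _ ≤ 1 / 4 := by linarith
  have hpos : 0 < 1 + y := by linarith [(abs_le.1 hy4).1]
  have hB := one_add_rpow_neg_le hp0 hy4 hpy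
  -- The left side is concave in `r`, and `w` is its critical point: w^(q-1) = 1 + lam/q. The
  -- tangent of r^q at `w` therefore gives the maximum over `r`.
  set w := (1 + y) ^ (-(1 / (1 - q))) with hw
  have hw0 : 0 < w := Real.rpow_pos_of_pos hpos _
  have hwq : w ^ q = (1 + y) ^ (-p) := by
    rw [hw, ← Real.rpow_mul hpos.le, hp]
    congr 1
    field_simp
  have hwq1 : w ^ (q - 1) = 1 + y := by
    rw [hw, ← Real.rpow_mul hpos.le]
    have : -(1 / (1 - q)) * (q - 1) = 1 := by field_simp; ring
    rw [this, Real.rpow_one]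
  have hwmul : (1 + y) * w = w ^ q := by
    rw [← hwq1, Real.rpow_sub_one hw0.ne']
    field_simp
  have ht := Real.rpow_le_tangent hr hw0 hq0.le hq1.le
  rw [hwq1] at ht
  have hK : tsallisStab q * lam ^ 2 = (1 - q) * ((2 * p + 3 * p ^ 2) * y ^ 2) := by
    rw [tsallisStab, ← hp, hlamy]
    field_simp
  have hpq : (1 - q) * (p * y) = q * y := by rw [hp]; field_simp
  have hB' := mul_le_mul_of_nonneg_left hB h1q.le
  rw [← hwq] at hB'
  rw [hK, hlamy]
  have e : r ^ q ≤ (1 - q) * w ^ q + q * (1 + y) * r := by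
    have : q * (1 + y) * (r - w) = q * (1 + y) * r - q * w ^ q := by rw [← hwmul]; ring
    linarith
  nlinarith

/-- Homogeneity reduces to x = 1: put r = z/x and measure `l` in units of c x^(q-1). -/
lemma tsallis_stability {q x z c l : ℝ} (hq0 : 0 < q) (hq1 : q < 1) (hx : 0 < x) (hz : 0 ≤ z)
    (hc : 0 < c) (hl : |l| ≤ q * (1 - q) / 4 * (c * x ^ (q - 1))) :
    (x - z) * l - c * (q * x ^ (q - 1) * (z - x) - z ^ q + x ^ q) ≤
      tsallisStab q / c * (x ^ (2 - q) * l ^ 2) := by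
  have hX : 0 < x ^ (q - 1) := Real.rpow_pos_of_pos hx _
  have hcX : 0 < c * x ^ (q - 1) := mul_pos hc hX
  have h := tsallis_stability_unit (r := z / x) (lam := l / (c * x ^ (q - 1))) hq0 hq1
    (by positivity) (by rw [abs_div, abs_of_pos hcX, div_le_iff₀ hcX]; exact hl)
  have hxq : x ^ q = x ^ (q - 1) * x := by
    rw [Real.rpow_sub_one hx.ne']
    field_simp
  have h2q : x ^ (2 - q) * x ^ (q - 1) = x := by
    rw [← Real.rpow_add hx]
    norm_num
  have hzq : z ^ q = (z / x) ^ q * (x ^ (q - 1) * x) := by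
    rw [Real.div_rpow hz hx.le, hxq]
    field_simp
  have h' := mul_le_mul_of_nonneg_left h (mul_pos hcX hx).le
  have e1 : c * x ^ (q - 1) * x * ((1 - z / x) * (l / (c * x ^ (q - 1))) -
      (q * (z / x - 1) - (z / x) ^ q + 1)) =
      (x - z) * l - c * (q * x ^ (q - 1) * (z - x) - z ^ q + x ^ q) := by
    rw [hzq, hxq]
    field_simp
  have e2 : c * x ^ (q - 1) * x * (tsallisStab q * (l / (c * x ^ (q - 1))) ^ 2) =
      tsallisStab q / c * (x ^ (2 - q) * l ^ 2) := by
    have : x ^ (2 - q) = x / x ^ (q - 1) := by rw [eq_div_iff hX.ne', h2q]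
    rw [this]
    field_simp
  rw [e1, e2] at h'
  exact h'

namespace LayeredMDP

variable {S A : Type*} [Fintype S] [DecidableEq S] [Fintype A] [DecidableEq A]

/-! ### Follow the regularized leader over occupancy measures -/

/-- The objective `⟨y, L⟩ - c ∑ y(s,a)^q`. -/
noncomputable def tsallisObj (q c : ℝ) (L y : S → A → ℝ) : ℝ := pairing y L - c * powSum q y

lemma pairing_add_right (x f g : S → A → ℝ) :
    pairing x (fun s a => f s a + g s a) = pairing x f + pairing x g := by
  simp only [pairing, mul_add, Finset.sum_add_distrib]

lemma pairing_sub_left (x z f : S → A → ℝ) :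
    pairing (fun s a => x s a - z s a) f = pairing x f - pairing z f := by
  simp only [pairing, sub_mul, Finset.sum_sub_distrib]

lemma sum_rpow_segment_le (M : LayeredMDP S A) [Nonempty A] {q c : ℝ} {L x z : S → A → ℝ}
    (hx : x ∈ M.occSet) (hmin : IsMinOn (tsallisObj q c L) M.occSet x)
    (hz : z ∈ M.occSet) {ε : ℝ} (h0 : 0 ≤ ε) (h1 : ε ≤ 1) :
    c * ∑ s, ∑ a, ((x s a + ε * (z s a - x s a)) ^ q - x s a ^ q) ≤
      ε * (pairing z L - pairing x L) := by
  have h := hmin ((M.isFlow_of_mem hx).segment (M.isFlow_of_mem hz) h0 h1).mem_occSet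
  have e : pairing (fun s a => x s a + ε * (z s a - x s a)) L =
      pairing x L + ε * (pairing z L - pairing x L) := by
    simp only [pairing, ← Finset.sum_sub_distrib, Finset.mul_sum, ← Finset.sum_add_distrib]
    exact Finset.sum_congr rfl fun _ _ => Finset.sum_congr rfl fun _ _ => by ring
  have h' : pairing x L - c * powSum q x ≤ pairing x L + ε * (pairing z L - pairing x L) -
      c * powSum q (fun s a => x s a + ε * (z s a - x s a)) := e ▸ h
  simp only [Finset.sum_sub_distrib]
  simp only [powSum] at h'
  linarith

/-- The minimizer is positive wherever some occupancy measure is. -/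
lemma pos_of_isMinOn (M : LayeredMDP S A) [Nonempty A] {q c : ℝ} {L x z : S → A → ℝ}
    (hq0 : 0 < q) (hq1 : q < 1) (hc : 0 < c)
    (hx : x ∈ M.occSet) (hmin : IsMinOn (tsallisObj q c L) M.occSet x)
    (hz : z ∈ M.occSet) {s₀ : S} {a₀ : A} (hpos : 0 < z s₀ a₀) : 0 < x s₀ a₀ := by
  have hxf := M.isFlow_of_mem hx
  have hzf := M.isFlow_of_mem hz
  refine (hxf.nonneg s₀ a₀).lt_of_ne fun hzero => ?_
  set D := pairing z L - pairing x L
  set E := ∑ s, ∑ a, (z s a ^ q - x s a ^ q) with hE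
  set Z := z s₀ a₀ ^ q with hZ
  have hZ0 : 0 < Z := Real.rpow_pos_of_pos hpos _
  -- Moving by ε towards `z` gains ε^q Z at the empty coordinate. By concavity all other coordinates
  -- change by at least a linear amount in ε.
  have key : ∀ ε : ℝ, 0 < ε → ε ≤ 1 → c * (ε * E + (ε ^ q * Z - ε * Z)) ≤ ε * D := by
    intro ε h0 h1
    refine le_trans ?_ (M.sum_rpow_segment_le hx hmin hz h0.le h1)
    refine mul_le_mul_of_nonneg_left ?_ hc.le
    have e : ε * E + (ε ^ q * Z - ε * Z) = ∑ s, ∑ a, (ε * (z s a ^ q - x s a ^ q) +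
        if (s, a) = (s₀, a₀) then ε ^ q * Z - ε * Z else 0) := by
      simp only [Finset.sum_add_distrib, hE, Finset.mul_sum]
      congr 1
      rw [← Fintype.sum_prod_type'
        (fun s a => if (s, a) = (s₀, a₀) then ε ^ q * Z - ε * Z else 0)]
      simp
    rw [e]
    refine Finset.sum_le_sum fun s _ => Finset.sum_le_sum fun a _ => ?_
    split_ifs with h
    · obtain ⟨rfl, rfl⟩ := Prod.mk.inj h
      rw [← hzero, Real.zero_rpow hq0.ne', zero_add, sub_zero, sub_zero, sub_zero,
        Real.mul_rpow h0.le hpos.le]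
      linarith
    · have hcc := (Real.concaveOn_rpow hq0.le hq1.le).2 (hxf.nonneg s a) (hzf.nonneg s a)
        (by linarith : 0 ≤ 1 - ε) h0.le (by ring)
      simp only [smul_eq_mul] at hcc
      have e2 : (1 - ε) * x s a + ε * z s a = x s a + ε * (z s a - x s a) := by ring
      rw [e2] at hcc
      linarith
  -- ε will be the point with ε^q = N ε, and `N` is large enough for this gain to beat every linear
  -- term.
  set N := max 1 ((D / c - E + Z) / Z + 1) with hN
  have hN1 : 1 ≤ N := le_max_left _ _
  have hN0 : 0 < N := by linarith
  set ε := N ^ (-(1 / (1 - q))) with hε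
  have h1q : 0 < 1 - q := by linarith
  have hε0 : 0 < ε := Real.rpow_pos_of_pos hN0 _
  have hε1 : ε ≤ 1 := Real.rpow_le_one_of_one_le_of_nonpos hN1
    (by have : 0 < 1 / (1 - q) := by positivity
        linarith)
  have hεq : ε ^ q = ε * N := by
    have : N = ε ^ (q - 1) := by
      rw [hε, ← Real.rpow_mul hN0.le]
      have : -(1 / (1 - q)) * (q - 1) = 1 := by field_simp; ring
      rw [this, Real.rpow_one]
    rw [this, Real.rpow_sub_one hε0.ne']
    field_simp
  have h := key ε hε0 hε1
  rw [hεq] at h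
  have h2 : c * (E + (N * Z - Z)) ≤ D := by
    have : ε * (c * (E + (N * Z - Z))) ≤ ε * D := by linarith
    exact le_of_mul_le_mul_left this hε0
  have h3 : E + (N * Z - Z) ≤ D / c := by
    rw [le_div_iff₀ hc]
    linarith
  have h4 : (D / c - E + Z) / Z + 1 ≤ N := le_max_right _ _
  have h5 : D / c - E + Z + Z ≤ N * Z := by
    have := mul_le_mul_of_nonneg_right h4 hZ0.le
    rwa [add_mul, div_mul_cancel₀ _ hZ0.ne', one_mul] at this
  linarith

lemma eq_zero_of_isMinOn (M : LayeredMDP S A) [Nonempty A] {q c : ℝ} {L x z : S → A → ℝ}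
    (hq0 : 0 < q) (hq1 : q < 1) (hc : 0 < c)
    (hx : x ∈ M.occSet) (hmin : IsMinOn (tsallisObj q c L) M.occSet x)
    (hz : z ∈ M.occSet) {s : S} {a : A} (h : x s a = 0) : z s a = 0 := by
  by_contra hne
  have := M.pos_of_isMinOn hq0 hq1 hc hx hmin hz
    (((M.isFlow_of_mem hz).nonneg s a).lt_of_ne' hne)
  linarith

/-- First-order optimality of the minimizer. -/
lemma first_order_of_isMinOn (M : LayeredMDP S A) [Nonempty A] {q c : ℝ} {L x z : S → A → ℝ}
    (hq0 : 0 < q) (hq1 : q < 1) (hc : 0 < c)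
    (hx : x ∈ M.occSet) (hmin : IsMinOn (tsallisObj q c L) M.occSet x) (hz : z ∈ M.occSet) :
    c * ∑ s, ∑ a, q * x s a ^ (q - 1) * (z s a - x s a) ≤ pairing z L - pairing x L := by
  have hxf := M.isFlow_of_mem hx
  have hzf := M.isFlow_of_mem hz
  have hz0 : ∀ s a, x s a = 0 → z s a = 0 := fun s a =>
    M.eq_zero_of_isMinOn hq0 hq1 hc hx hmin hz
  -- The tangent inequality is taken at the point of the segment, not at `x`, and then ε tends to 0.
  -- Coordinates where `x` vanishes stay zero, since `z` vanishes there too, so the negative power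
  -- at 0 never matters.
  have hlim : Filter.Tendsto
      (fun ε : ℝ => c * ∑ s, ∑ a,
        q * (x s a + ε * (z s a - x s a)) ^ (q - 1) * (z s a - x s a))
      (nhdsWithin 0 (Set.Ioi 0))
      (nhds (c * ∑ s, ∑ a, q * x s a ^ (q - 1) * (z s a - x s a))) := by
    refine Filter.Tendsto.const_mul _ (tendsto_finsetSum _ fun s _ =>
      tendsto_finsetSum _ fun a _ => ?_)
    rcases (hxf.nonneg s a).eq_or_lt with h | h
    · simp [← h, hz0 s a h.symm]
    · refine Filter.Tendsto.mul_const _ (Filter.Tendsto.const_mul _ ?_)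
      have hcont : ContinuousAt (fun ε : ℝ => (x s a + ε * (z s a - x s a)) ^ (q - 1)) 0 :=
        ContinuousAt.rpow_const (by fun_prop) (Or.inl (by simpa using h.ne'))
      have := hcont.tendsto
      rw [zero_mul, add_zero] at this
      exact this.mono_left nhdsWithin_le_nhds
  refine le_of_tendsto hlim ?_
  filter_upwards [Ioo_mem_nhdsGT (show (0 : ℝ) < 1 by norm_num)] with ε hε
  obtain ⟨h0, h1⟩ := hε
  have h := M.sum_rpow_segment_le hx hmin hz h0.le h1.le
  have e : ε * (c * ∑ s, ∑ a, q * (x s a + ε * (z s a - x s a)) ^ (q - 1) * (z s a - x s a)) =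
      c * ∑ s, ∑ a, q * (x s a + ε * (z s a - x s a)) ^ (q - 1) * (ε * (z s a - x s a)) := by
    simp only [Finset.mul_sum]
    exact Finset.sum_congr rfl fun _ _ => Finset.sum_congr rfl fun _ _ => by ring
  refine le_of_mul_le_mul_left (le_trans (e.le.trans
    (mul_le_mul_of_nonneg_left (Finset.sum_le_sum fun s _ => Finset.sum_le_sum fun a _ => ?_)
      hc.le)) h) h0
  rcases (hxf.nonneg s a).eq_or_lt with h | h
  · simp [← h, hz0 s a h.symm]
  · have hy : 0 < x s a + ε * (z s a - x s a) := by
      nlinarith [hzf.nonneg s a]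
    have := Real.rpow_le_tangent (hxf.nonneg s a) hy hq0.le hq1.le
    linarith

/-- One round of FTRL, with the loss shifted by a state potential `v`. -/
lemma ftrl_step (M : LayeredMDP S A) [Nonempty A] {q c : ℝ} {L x z l : S → A → ℝ}
    (hq0 : 0 < q) (hq1 : q < 1) (hc : 0 < c)
    (hx : x ∈ M.occSet) (hmin : IsMinOn (tsallisObj q c L) M.occSet x) (hz : z ∈ M.occSet)
    (v : S → ℝ)
    (hl : ∀ s a, 0 < x s a → |l s a + (M.expNext v s a - v s)| ≤
      q * (1 - q) / 4 * (c * x s a ^ (q - 1))) :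
    tsallisObj q c L x + pairing x l -
        tsallisStab q / c * ∑ s, ∑ a, x s a ^ (2 - q) * (l s a + (M.expNext v s a - v s)) ^ 2 ≤
      tsallisObj q c L z + pairing z l := by
  have hxf := M.isFlow_of_mem hx
  have hzf := M.isFlow_of_mem hz
  have h1 := M.first_order_of_isMinOn hq0 hq1 hc hx hmin hz
  have h2 : pairing x l - pairing z l =
      ∑ s, ∑ a, (x s a - z s a) * (l s a + (M.expNext v s a - v s)) := by
    have e1 := pairing_sub_left x z (fun s a => l s a + (M.expNext v s a - v s))
    rw [pairing_add_right x, pairing_add_right z, hxf.pairing_shift, hzf.pairing_shift] at e1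
    rw [pairing] at e1
    linarith
  have h3 : ∑ s, ∑ a, (x s a - z s a) * (l s a + (M.expNext v s a - v s)) -
      c * (∑ s, ∑ a, q * x s a ^ (q - 1) * (z s a - x s a) - powSum q z + powSum q x) ≤
      tsallisStab q / c * ∑ s, ∑ a, x s a ^ (2 - q) * (l s a + (M.expNext v s a - v s)) ^ 2 := by
    simp only [powSum, ← Finset.sum_sub_distrib, ← Finset.sum_add_distrib, Finset.mul_sum]
    refine Finset.sum_le_sum fun s _ => Finset.sum_le_sum fun a _ => ?_
    rcases (hxf.nonneg s a).eq_or_lt with h | h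
    · have hz0 := M.eq_zero_of_isMinOn hq0 hq1 hc hx hmin hz h.symm
      have h2q : 2 - q ≠ 0 := by linarith
      simp [← h, hz0, hq0.ne', Real.zero_rpow h2q]
    · exact tsallis_stability hq0 hq1 h (hzf.nonneg s a) hc (hl s a h)
  simp only [tsallisObj]
  linarith

/-- The regret bound of FTRL with increasing regularization `c t`. -/
lemma ftrl_regret (M : LayeredMDP S A) [Nonempty A] {q : ℝ} {T : ℕ} {c : ℕ → ℝ}
    {x l : ℕ → S → A → ℝ} {v : ℕ → S → ℝ} {u : S → A → ℝ}
    (hq0 : 0 < q) (hq1 : q < 1) (hc0 : c 0 = 0) (hc : ∀ t ∈ Finset.Icc 1 T, 0 < c t)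
    (hx : ∀ t ∈ Finset.Icc 1 T, x t ∈ M.occSet)
    (hmin : ∀ t ∈ Finset.Icc 1 T, IsMinOn
      (tsallisObj q (c t) fun s a => ∑ i ∈ Finset.Ico 1 t, l i s a) M.occSet (x t))
    (hl : ∀ t ∈ Finset.Icc 1 T, ∀ s a, 0 < x t s a →
      |l t s a + (M.expNext (v t) s a - v t s)| ≤
        q * (1 - q) / 4 * (c t * x t s a ^ (q - 1)))
    (hu : u ∈ M.occSet) :
    ∑ t ∈ Finset.Icc 1 T, (pairing (x t) (l t) - pairing u (l t)) ≤
      ∑ t ∈ Finset.Icc 1 T, (tsallisStab q / c t *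
          ∑ s, ∑ a, x t s a ^ (2 - q) * (l t s a + (M.expNext (v t) s a - v t s)) ^ 2 +
        (c t - c (t - 1)) * (powSum q (x t) - powSum q u)) := by
  -- Induction over the rounds with the comparator kept arbitrary: the step applies the hypothesis
  -- to the next iterate x(n+1) and moves on to `z` by one-step stability. The start needs `c 0 =
  -- 0`.
  have key : ∀ n ≤ T, ∀ z ∈ M.occSet,
      ∑ t ∈ Finset.Icc 1 n, (pairing (x t) (l t) - tsallisStab q / c t *
          ∑ s, ∑ a, x t s a ^ (2 - q) * (l t s a + (M.expNext (v t) s a - v t s)) ^ 2 -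
        (c t - c (t - 1)) * powSum q (x t)) ≤
      ∑ t ∈ Finset.Icc 1 n, pairing z (l t) - c n * powSum q z := by
    intro n
    induction n with
    | zero => intro _ z _; simp [hc0]
    | succ n ih =>
      intro hn z hz
      have hmem : n + 1 ∈ Finset.Icc 1 T := Finset.mem_Icc.2 ⟨by omega, hn⟩
      have h1 := M.ftrl_step hq0 hq1 (hc _ hmem) (hx _ hmem) (hmin _ hmem) hz (v (n + 1))
        (hl _ hmem)
      have h2 := ih (by omega) (x (n + 1)) (hx _ hmem)
      have e : ∀ y : S → A → ℝ, pairing y (fun s a => ∑ i ∈ Finset.Ico 1 (n + 1), l i s a) =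
          ∑ t ∈ Finset.Icc 1 n, pairing y (l t) := by
        intro y
        have hI : Finset.Ico 1 (n + 1) = Finset.Icc 1 n := by
          ext; simp
        simp only [pairing, hI, Finset.mul_sum]
        exact (Finset.sum_congr rfl fun s _ => Finset.sum_comm).trans Finset.sum_comm
      rw [Finset.sum_Icc_succ_top (by omega), Finset.sum_Icc_succ_top (by omega)]
      simp only [tsallisObj, e] at h1
      rw [Nat.add_sub_cancel]
      linarith
  have h := key T le_rfl u hu
  have hcT : ∑ t ∈ Finset.Icc 1 T, (c t - c (t - 1)) = c T := by
    clear * - hc0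
    induction T with
    | zero => simp [hc0]
    | succ n ih =>
      rw [Finset.sum_Icc_succ_top (by omega), ih, Nat.add_sub_cancel]
      ring
  rw [← hcT, Finset.sum_mul] at h
  simp only [mul_sub, Finset.sum_add_distrib, Finset.sum_sub_distrib] at h ⊢
  linarith

end LayeredMDP

/-! ### Disintegration of weighted joint laws -/

section Disintegration

variable {Ω Ω' X : Type*} [MeasurableSpace Ω] [MeasurableSpace Ω'] [MeasurableSpace X]
  {μ : Measure Ω} {g : Ω → Ω'} {Y : Ω → X} {κ : Kernel Ω' X} [IsMarkovKernel κ]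
  {w : Ω → ℝ} {d : Ω' → ℝ}

/-- The hypothesis says that under the density `w` the law of (g, Y) is the law of `g` with density
`d`, followed by κ; so `d` acts as the conditional mean of `w` and `Y` is independent of the weight
given `g`. This form replaces conditional expectations. -/
lemma lintegral_of_disintegration [IsFiniteMeasure μ] (hg : Measurable g) (hY : Measurable Y)
    (hw : Measurable w) (hd : Measurable d)
    (h : (μ.withDensity fun ω => ENNReal.ofReal (w ω)).map (fun ω => (g ω, Y ω)) =
      ((μ.map g).withDensity fun ω => ENNReal.ofReal (d ω)) ⊗ₘ κ)
    {F : Ω' × X → ENNReal} (hF : Measurable F) :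
    ∫⁻ ω, ENNReal.ofReal (w ω) * F (g ω, Y ω) ∂μ =
      ∫⁻ ω, ENNReal.ofReal (d (g ω)) * ∫⁻ l, F (g ω, l) ∂κ (g ω) ∂μ := by
  have hFi : Measurable fun a => ∫⁻ b, F (a, b) ∂κ a := hF.lintegral_kernel_prod_right'
  have h1 : ∫⁻ z, F z ∂(μ.withDensity fun ω => ENNReal.ofReal (w ω)).map (fun ω => (g ω, Y ω)) =
      ∫⁻ ω, ENNReal.ofReal (w ω) * F (g ω, Y ω) ∂μ := by
    rw [lintegral_map hF (hg.prodMk hY),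
      lintegral_withDensity_eq_lintegral_mul _ hw.ennreal_ofReal
        (g := fun ω => F (g ω, Y ω)) (hF.comp (hg.prodMk hY))]
    rfl
  rw [← h1, h, Measure.lintegral_compProd hF,
    lintegral_withDensity_eq_lintegral_mul _ hd.ennreal_ofReal hFi,
    lintegral_map (hd.ennreal_ofReal.mul hFi) hg]
  rfl

lemma integral_of_disintegration [IsFiniteMeasure μ] (hg : Measurable g) (hY : Measurable Y)
    (hw : Measurable w) (hw0 : ∀ ω, 0 ≤ w ω) (hd : Measurable d) (hd0 : ∀ ω, 0 ≤ d ω)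
    (h : (μ.withDensity fun ω => ENNReal.ofReal (w ω)).map (fun ω => (g ω, Y ω)) =
      ((μ.map g).withDensity fun ω => ENNReal.ofReal (d ω)) ⊗ₘ κ)
    {F : Ω' × X → ℝ} (hF : Measurable F)
    (hfin : ∫⁻ ω, ENNReal.ofReal (d (g ω)) * ∫⁻ l, ‖F (g ω, l)‖ₑ ∂κ (g ω) ∂μ ≠ ⊤) :
    Integrable (fun ω => w ω * F (g ω, Y ω)) μ ∧
      Integrable (fun ω => d (g ω) * ∫ l, F (g ω, l) ∂κ (g ω)) μ ∧
      ∫ ω, w ω * F (g ω, Y ω) ∂μ = ∫ ω, d (g ω) * ∫ l, F (g ω, l) ∂κ (g ω) ∂μ := by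
  have hgY := hg.prodMk hY
  have hlt1 : ∀ᵐ ω ∂μ, ENNReal.ofReal (w ω) < ⊤ := by simp
  have hlt2 : ∀ᵐ ω ∂(μ.map g), ENNReal.ofReal (d ω) < ⊤ := by simp
  have hInt : Integrable F (((μ.map g).withDensity fun ω => ENNReal.ofReal (d ω)) ⊗ₘ κ) := by
    refine ⟨hF.aestronglyMeasurable, ?_⟩
    rw [hasFiniteIntegral_iff_enorm, ← h, lintegral_map hF.enorm hgY,
      lintegral_withDensity_eq_lintegral_mul _ hw.ennreal_ofReal
        (g := fun ω => ‖F (g ω, Y ω)‖ₑ) (hF.enorm.comp hgY)]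
    refine lt_of_eq_of_lt ?_ (lt_top_iff_ne_top.2 hfin)
    exact lintegral_of_disintegration hg hY hw hd h hF.enorm
  have e1 : ∀ ω, (ENNReal.ofReal (w ω)).toReal = w ω := fun ω => ENNReal.toReal_ofReal (hw0 ω)
  have e2 : ∀ ω, (ENNReal.ofReal (d ω)).toReal = d ω := fun ω => ENNReal.toReal_ofReal (hd0 ω)
  have hInt1 := h ▸ hInt
  rw [integrable_map_measure hF.aestronglyMeasurable hgY.aemeasurable,
    integrable_withDensity_iff_integrable_smul' hw.ennreal_ofReal hlt1] at hInt1
  simp only [e1, smul_eq_mul, Function.comp] at hInt1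
  have hInt2 := ((Measure.integrable_compProd_iff hF.aestronglyMeasurable).1 hInt).2
  have hsm : StronglyMeasurable fun a => ∫ b, F (a, b) ∂κ a :=
    hF.stronglyMeasurable.integral_kernel_prod_right'
  have hInt3 : Integrable (fun a => ∫ b, F (a, b) ∂κ a)
      ((μ.map g).withDensity fun ω => ENNReal.ofReal (d ω)) :=
    hInt2.mono hsm.aestronglyMeasurable (Filter.Eventually.of_forall fun a =>
      (norm_integral_le_integral_norm _).trans (le_abs_self _))
  rw [integrable_withDensity_iff_integrable_smul' hd.ennreal_ofReal hlt2,
    integrable_map_measure (by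
      simp only [e2, smul_eq_mul]
      exact (hd.mul hsm.measurable).aestronglyMeasurable) hg.aemeasurable] at hInt3
  simp only [e2, smul_eq_mul, Function.comp_def] at hInt3
  refine ⟨hInt1, hInt3, ?_⟩
  have i1 : ∫ z, F z ∂(μ.withDensity fun ω => ENNReal.ofReal (w ω)).map (fun ω => (g ω, Y ω)) =
      ∫ ω, w ω * F (g ω, Y ω) ∂μ := by
    rw [integral_map hgY.aemeasurable hF.aestronglyMeasurable,
      integral_withDensity_eq_integral_toReal_smul hw.ennreal_ofReal hlt1]
    simp only [e1, smul_eq_mul]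
  rw [← i1, h, Measure.integral_compProd hInt,
    integral_withDensity_eq_integral_toReal_smul hd.ennreal_ofReal hlt2,
    integral_map hg.aemeasurable (by
      simp only [e2, smul_eq_mul]
      exact (hd.mul hsm.measurable).aestronglyMeasurable)]
  simp only [e2, smul_eq_mul]

end Disintegration

/-! ### The joint law of trajectory and loss in one episode. -/

namespace LayeredMDP

variable {S A : Type*} [Fintype S] [DecidableEq S] [Fintype A] [DecidableEq A]

/-- One episode: given `g`, the trajectory `τ` of the policy `pol` and the loss `Y` with law `κ`
are independent. -/
structure IsRound (M : LayeredMDP S A) (α σ : ℝ) {Ω Ω' : Type*} [MeasurableSpace Ω]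
    [MeasurableSpace Ω'] (μ : Measure Ω) (g : Ω → Ω') (κ : Kernel Ω' (S → A → ℝ))
    (pol : Ω' → S → A → ℝ) (traj : Ω → M.Traj) (Y : Ω → S → A → ℝ) : Prop where
  g_meas : Measurable g
  policy : ∀ ω, IsPolicy (pol ω)
  policy_meas : ∀ s a, Measurable fun ω => pol ω s a
  moment : ∀ ω s a, ∫⁻ l, ENNReal.ofReal (|l s a| ^ α) ∂(κ ω) ≤ ENNReal.ofReal (σ ^ α)
  loss_meas : Measurable Y
  traj_meas : ∀ τ, MeasurableSet {ω | traj ω = τ}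
  law : ∀ E, MeasurableSet E → ∀ τ B, MeasurableSet B →
    μ (g ⁻¹' E ∩ {ω | traj ω = τ} ∩ {ω | Y ω ∈ B}) =
      ∫⁻ ω in g ⁻¹' E, ENNReal.ofReal (M.trajProb (pol (g ω)) τ) * κ (g ω) B ∂μ

lemma measurable_trajProb (M : LayeredMDP S A) {Ω' : Type*} [MeasurableSpace Ω']
    {pol : Ω' → S → A → ℝ} (h : ∀ s a, Measurable fun ω => pol ω s a) (τ : M.Traj) :
    Measurable fun ω => M.trajProb (pol ω) τ :=
  Finset.measurable_fun_prod _ fun i _ => (h (τ i).1 (τ i).2).const_mul _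

lemma measurable_reach (M : LayeredMDP S A) {Ω' : Type*} [MeasurableSpace Ω']
    {pol : Ω' → S → A → ℝ} (h : ∀ s a, Measurable fun ω => pol ω s a) (n : ℕ) (s : S) :
    Measurable fun ω => M.reach (pol ω) n s := by
  induction n generalizing s with
  | zero => simp only [reach]; exact measurable_const
  | succ n ih =>
    simp only [reach]
    exact Finset.measurable_fun_sum _ fun s' _ => Finset.measurable_fun_sum _ fun a _ =>
      ((ih s').mul (h s' a)).mul_const _

lemma measurable_occ (M : LayeredMDP S A) {Ω' : Type*} [MeasurableSpace Ω']
    {pol : Ω' → S → A → ℝ} (h : ∀ s a, Measurable fun ω => pol ω s a) (s : S) (a : A) :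
    Measurable fun ω => M.occ (pol ω) s a :=
  (M.measurable_reach h _ _).mul (h s a)

lemma measurable_valueAux (M : LayeredMDP S A) {Ω' : Type*} [MeasurableSpace Ω']
    {pol : Ω' → S → A → ℝ} (h : ∀ s a, Measurable fun ω => pol ω s a) (ℓ : S → A → ℝ) (n : ℕ)
    (s : S) : Measurable fun ω => M.valueAux (pol ω) ℓ n s := by
  induction n generalizing s with
  | zero => simp only [valueAux]; exact measurable_const
  | succ n ih =>
    simp only [valueAux]
    exact Finset.measurable_fun_sum _ fun a _ => (h s a).mul
      ((Finset.measurable_fun_sum _ fun s' _ => (ih s').const_mul _).const_add _)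

lemma measurable_unitAdv (M : LayeredMDP S A) {Ω' : Type*} [MeasurableSpace Ω']
    {pol : Ω' → S → A → ℝ} (h : ∀ s a, Measurable fun ω => pol ω s a) (c : S × A) (s : S) (a : A) :
    Measurable fun ω => M.unitAdv (pol ω) c s a := by
  have hv : ∀ s, Measurable fun ω => M.value (pol ω) (unitLoss c) s := fun s =>
    M.measurable_valueAux h _ _ _
  exact ((Finset.measurable_fun_sum _ fun s' _ => (hv s').const_mul _).const_add _).sub (hv s)

lemma sum_trajProb (M : LayeredMDP S A) {π : S → A → ℝ} (hπ : IsPolicy π) :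
    ∑ τ : M.Traj, M.trajProb π τ = 1 := by
  have hH : 0 < M.H := (Nat.zero_le _).trans_lt (M.layer_lt M.s₁)
  have h := M.sum_pathProb_mul hπ le_rfl ⟨0, hH⟩ (fun _ => 1)
  simp only [mul_one, ← Finset.mul_sum, (hπ _).2] at h
  simp only [trajProb_eq]
  rw [h]
  simp [reach]

namespace IsRound

variable {M : LayeredMDP S A} {α σ : ℝ} {Ω Ω' : Type*} [MeasurableSpace Ω] [MeasurableSpace Ω']
  {μ : Measure Ω} [IsProbabilityMeasure μ] {g : Ω → Ω'} {κ : Kernel Ω' (S → A → ℝ)}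
  [IsMarkovKernel κ] {pol : Ω' → S → A → ℝ} {traj : Ω → M.Traj} {Y : Ω → S → A → ℝ}

lemma measurable_weight (h : M.IsRound α σ μ g κ pol traj Y) (W : M.Traj → ℝ) :
    Measurable fun ω => W (traj ω) := by
  have : Measurable[_, ⊤] traj := by
    refine @measurable_to_countable' _ _ ⊤ _ _ _ fun τ => ?_
    exact h.traj_meas τ
  exact (@measurable_from_top _ _ _ W).comp this

/-- Both sides are finite measures, so rectangles suffice. There the weight is a finite sum over
trajectories, and each summand is the defining law of the episode. -/
lemma disintegration (h : M.IsRound α σ μ g κ pol traj Y) {W : M.Traj → ℝ} (hW : ∀ τ, 0 ≤ W τ) :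
    (μ.withDensity fun ω => ENNReal.ofReal (W (traj ω))).map (fun ω => (g ω, Y ω)) =
      ((μ.map g).withDensity fun ω =>
        ENNReal.ofReal (∑ τ, W τ * M.trajProb (pol ω) τ)) ⊗ₘ κ := by
  classical
  have hWm := h.measurable_weight W
  have hgY := h.g_meas.prodMk h.loss_meas
  have hT : ∀ τ, Measurable fun ω => M.trajProb (pol ω) τ := M.measurable_trajProb h.policy_meas
  have hD : Measurable fun ω => ∑ τ, W τ * M.trajProb (pol ω) τ :=
    Finset.measurable_fun_sum _ fun τ _ => (hT τ).const_mul _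
  have hpt : ∀ ω, ENNReal.ofReal (W (traj ω)) =
      ∑ τ, {ω | traj ω = τ}.indicator (fun _ => ENNReal.ofReal (W τ)) ω := by
    intro ω
    simp [Set.indicator_apply]
  have hfin : IsFiniteMeasure (μ.withDensity fun ω => ENNReal.ofReal (W (traj ω))) := by
    refine isFiniteMeasure_withDensity ?_
    simp_rw [hpt]
    rw [lintegral_finsetSum _ fun τ _ => measurable_const.indicator (h.traj_meas τ)]
    refine (ENNReal.sum_lt_top.2 fun τ _ => ?_).ne
    rw [lintegral_indicator_const (h.traj_meas τ)]
    exact ENNReal.mul_lt_top (by simp) (measure_lt_top _ _)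
  have := Measure.isFiniteMeasure_map (μ.withDensity fun ω => ENNReal.ofReal (W (traj ω)))
    (fun ω => (g ω, Y ω))
  refine Measure.ext_prod fun {E B} hE hB => ?_
  have hκ : Measurable fun ω => κ ω B := κ.measurable_coe hB
  have hpre : (fun ω => (g ω, Y ω)) ⁻¹' E ×ˢ B = g ⁻¹' E ∩ {ω | Y ω ∈ B} := rfl
  rw [Measure.map_apply hgY (hE.prod hB), hpre,
    withDensity_apply _ ((h.g_meas hE).inter (h.loss_meas hB) :
      MeasurableSet (g ⁻¹' E ∩ {ω | Y ω ∈ B})),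
    Measure.compProd_apply_prod hE hB, restrict_withDensity hE,
    lintegral_withDensity_eq_lintegral_mul _ hD.ennreal_ofReal hκ,
    setLIntegral_map hE (hD.ennreal_ofReal.mul hκ) h.g_meas]
  have hR : ∀ ω, ((fun ω => ENNReal.ofReal (∑ τ, W τ * M.trajProb (pol ω) τ)) * fun ω => κ ω B)
      (g ω) = ∑ τ, ENNReal.ofReal (W τ) *
        (ENNReal.ofReal (M.trajProb (pol (g ω)) τ) * κ (g ω) B) := by
    intro ω
    rw [Pi.mul_apply, ENNReal.ofReal_sum_of_nonneg fun τ _ => mul_nonneg (hW τ)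
      (show 0 ≤ M.trajProb (pol (g ω)) τ from M.pathProb_nonneg (h.policy _) τ), Finset.sum_mul]
    exact Finset.sum_congr rfl fun τ _ => by rw [ENNReal.ofReal_mul (hW τ), mul_assoc]
  have hm : ∀ τ, Measurable fun ω =>
      ENNReal.ofReal (M.trajProb (pol (g ω)) τ) * κ (g ω) B := fun τ =>
    ((hT τ).comp h.g_meas).ennreal_ofReal.mul (hκ.comp h.g_meas)
  simp_rw [hR, hpt]
  rw [lintegral_finsetSum _ fun τ _ => measurable_const.indicator (h.traj_meas τ),
    lintegral_finsetSum _ fun τ _ => (hm τ).const_mul _]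
  refine Finset.sum_congr rfl fun τ _ => ?_
  rw [lintegral_const_mul _ (hm τ),
    ← h.law E hE τ B hB, lintegral_indicator_const (h.traj_meas τ),
    Measure.restrict_apply (h.traj_meas τ)]
  congr 2
  ext ω
  simp only [Set.mem_inter_iff, Set.mem_ofPred_eq]
  tauto

/-- The law of the loss. -/
lemma integral_loss (h : M.IsRound α σ μ g κ pol traj Y) {F : Ω' × (S → A → ℝ) → ℝ}
    (hF : Measurable F) (hfin : ∫⁻ ω, ∫⁻ l, ‖F (g ω, l)‖ₑ ∂κ (g ω) ∂μ ≠ ⊤) :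
    Integrable (fun ω => F (g ω, Y ω)) μ ∧
      Integrable (fun ω => ∫ l, F (g ω, l) ∂κ (g ω)) μ ∧
      ∫ ω, F (g ω, Y ω) ∂μ = ∫ ω, ∫ l, F (g ω, l) ∂κ (g ω) ∂μ := by
  have hd := h.disintegration (W := fun _ => 1) (fun _ => zero_le_one)
  have e : ∀ ω, ∑ τ : M.Traj, 1 * M.trajProb (pol ω) τ = 1 := fun ω => by
    simp only [one_mul, M.sum_trajProb (h.policy ω)]
  simp only [e] at hd
  have := integral_of_disintegration (w := fun _ => 1) (d := fun _ => 1) h.g_meas h.loss_meas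
    measurable_const (fun _ => zero_le_one) measurable_const (fun _ => zero_le_one) hd hF
    (by simpa using hfin)
  simpa using this

/-- The indicator that the trajectory visits `c`. -/
noncomputable def visit (M : LayeredMDP S A) (c : S × A) (τ : M.Traj) : ℝ :=
  if ∃ h, τ h = c then 1 else 0

lemma visit_nonneg (c : S × A) (τ : M.Traj) : 0 ≤ visit M c τ := by
  unfold visit
  split_ifs <;> norm_num

lemma disintegration_visit (h : M.IsRound α σ μ g κ pol traj Y) (c : S × A) :
    (μ.withDensity fun ω => ENNReal.ofReal (visit M c (traj ω))).map (fun ω => (g ω, Y ω)) =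
      ((μ.map g).withDensity fun ω => ENNReal.ofReal (M.occ (pol ω) c.1 c.2)) ⊗ₘ κ := by
  rw [h.disintegration (visit_nonneg c)]
  congr 2
  funext ω
  rw [← M.sum_trajProb_visit (h.policy ω)]
  congr 1
  exact Finset.sum_congr rfl fun τ _ => mul_comm _ _

lemma lintegral_visit (h : M.IsRound α σ μ g κ pol traj Y) (c : S × A)
    {F : Ω' × (S → A → ℝ) → ENNReal} (hF : Measurable F) :
    ∫⁻ ω, ENNReal.ofReal (visit M c (traj ω)) * F (g ω, Y ω) ∂μ =
      ∫⁻ ω, ENNReal.ofReal (M.occ (pol (g ω)) c.1 c.2) * ∫⁻ l, F (g ω, l) ∂κ (g ω) ∂μ :=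
  lintegral_of_disintegration h.g_meas h.loss_meas (h.measurable_weight _)
    (M.measurable_occ h.policy_meas _ _) (h.disintegration_visit c) hF

lemma integral_visit (h : M.IsRound α σ μ g κ pol traj Y) (c : S × A)
    {F : Ω' × (S → A → ℝ) → ℝ} (hF : Measurable F)
    (hfin : ∫⁻ ω, ENNReal.ofReal (M.occ (pol (g ω)) c.1 c.2) *
      ∫⁻ l, ‖F (g ω, l)‖ₑ ∂κ (g ω) ∂μ ≠ ⊤) :
    Integrable (fun ω => visit M c (traj ω) * F (g ω, Y ω)) μ ∧
      Integrable (fun ω => M.occ (pol (g ω)) c.1 c.2 * ∫ l, F (g ω, l) ∂κ (g ω)) μ ∧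
      ∫ ω, visit M c (traj ω) * F (g ω, Y ω) ∂μ =
        ∫ ω, M.occ (pol (g ω)) c.1 c.2 * ∫ l, F (g ω, l) ∂κ (g ω) ∂μ :=
  integral_of_disintegration h.g_meas h.loss_meas (h.measurable_weight _)
    (fun _ => visit_nonneg c _) (M.measurable_occ h.policy_meas _ _)
    (fun ω => M.occ_nonneg (h.policy ω) _ _) (h.disintegration_visit c) hF hfin

end IsRound

end LayeredMDP

/-! ### Truncated moments -/

/-- Truncation of `y` at level `θ`: the value `y` is replaced by `0` if `|y| > θ`. -/
noncomputable def skipTrunc (θ y : ℝ) : ℝ := if |y| ≤ θ then y else 0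

lemma abs_skipTrunc_le (θ y : ℝ) : |skipTrunc θ y| ≤ |y| := by
  unfold skipTrunc
  split_ifs <;> simp

lemma abs_skipTrunc_le_level {θ : ℝ} (hθ : 0 ≤ θ) (y : ℝ) : |skipTrunc θ y| ≤ θ := by
  unfold skipTrunc
  split_ifs with h
  · exact h
  · simpa using hθ

/-- Split y² as |y|^(2-α) |y|^α and use |y| ≤ θ in the first factor. -/
lemma skipTrunc_sq_le {θ y α : ℝ} (hθ : 0 ≤ θ) (hα2 : α ≤ 2) :
    skipTrunc θ y ^ 2 ≤ θ ^ (2 - α) * |y| ^ α := by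
  unfold skipTrunc
  split_ifs with h
  · rcases (abs_nonneg y).eq_or_lt with h0 | h0
    · rw [abs_eq_zero.1 h0.symm]
      have := mul_nonneg (Real.rpow_nonneg hθ (2 - α)) (Real.rpow_nonneg (abs_nonneg (0 : ℝ)) α)
      simpa using this
    · have e : y ^ 2 = |y| ^ (2 - α) * |y| ^ α := by
        rw [← Real.rpow_add h0, sub_add_cancel, Real.rpow_two, sq_abs]
      rw [e]
      exact mul_le_mul_of_nonneg_right (Real.rpow_le_rpow h0.le h (by linarith))
        (Real.rpow_nonneg h0.le _)
  · have := mul_nonneg (Real.rpow_nonneg hθ (2 - α)) (Real.rpow_nonneg (abs_nonneg y) α)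
    simpa using this

/-- Only values with |y| > θ remain, and for them |y|^(1-α) ≤ θ^(1-α). -/
lemma abs_sub_skipTrunc_le {θ y α : ℝ} (hθ : 0 < θ) (hα : 1 ≤ α) :
    |y - skipTrunc θ y| ≤ θ ^ (1 - α) * |y| ^ α := by
  unfold skipTrunc
  split_ifs with h
  · rw [sub_self, abs_zero]
    exact mul_nonneg (Real.rpow_nonneg hθ.le _) (Real.rpow_nonneg (abs_nonneg _) _)
  · rw [sub_zero]
    push Not at h
    have h0 : 0 < |y| := hθ.trans h
    have e : |y| = |y| ^ (1 - α) * |y| ^ α := by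
      rw [← Real.rpow_add h0, sub_add_cancel, Real.rpow_one]
    have h1 : |y| ^ (1 - α) ≤ θ ^ (1 - α) :=
      Real.rpow_le_rpow_of_nonpos hθ h.le (by linarith)
    calc |y| = |y| ^ (1 - α) * |y| ^ α := e
      _ ≤ _ := mul_le_mul_of_nonneg_right h1 (Real.rpow_nonneg h0.le _)

lemma Measurable.skipTrunc {Z : Type*} [MeasurableSpace Z] {θ y : Z → ℝ} (hθ : Measurable θ)
    (hy : Measurable y) : Measurable fun z => skipTrunc (θ z) (y z) :=
  Measurable.ite (measurableSet_le hy.abs hθ) hy measurable_const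

section Moments

variable {X : Type*} [MeasurableSpace X] {ν : Measure X} [IsProbabilityMeasure ν] {f : X → ℝ}
  {α σ : ℝ}

lemma lintegral_enorm_le_of_moment (hα : 1 ≤ α)
    (hm : ∫⁻ l, ENNReal.ofReal (|f l| ^ α) ∂ν ≤ ENNReal.ofReal (σ ^ α)) :
    ∫⁻ l, ‖f l‖ₑ ∂ν ≤ 1 + ENNReal.ofReal (σ ^ α) := by
  have hpt : ∀ l, ‖f l‖ₑ ≤ 1 + ENNReal.ofReal (|f l| ^ α) := by
    intro l
    rw [← ofReal_norm, Real.norm_eq_abs, ← ENNReal.ofReal_one,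
      ← ENNReal.ofReal_add zero_le_one (Real.rpow_nonneg (abs_nonneg _) _)]
    refine ENNReal.ofReal_le_ofReal ?_
    rcases le_total |f l| 1 with h | h
    · linarith [Real.rpow_nonneg (abs_nonneg (f l)) α]
    · have := Real.rpow_le_rpow_of_exponent_le h hα
      rw [Real.rpow_one] at this
      linarith
  calc ∫⁻ l, ‖f l‖ₑ ∂ν ≤ ∫⁻ l, (1 + ENNReal.ofReal (|f l| ^ α)) ∂ν := lintegral_mono hpt
    _ = 1 + ∫⁻ l, ENNReal.ofReal (|f l| ^ α) ∂ν := by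
      rw [lintegral_add_left measurable_const]
      simp
    _ ≤ _ := by gcongr

lemma integrable_of_moment (hα : 1 ≤ α) (hf : Measurable f)
    (hm : ∫⁻ l, ENNReal.ofReal (|f l| ^ α) ∂ν ≤ ENNReal.ofReal (σ ^ α)) : Integrable f ν :=
  ⟨hf.aestronglyMeasurable, by
    rw [hasFiniteIntegral_iff_enorm]
    exact (lintegral_enorm_le_of_moment hα hm).trans_lt (by simp)⟩

lemma integrable_skipTrunc (hα : 1 ≤ α) (hf : Measurable f) (θ : ℝ)
    (hm : ∫⁻ l, ENNReal.ofReal (|f l| ^ α) ∂ν ≤ ENNReal.ofReal (σ ^ α)) :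
    Integrable (fun l => skipTrunc θ (f l)) ν :=
  (integrable_of_moment hα hf hm).mono (measurable_const.skipTrunc hf).aestronglyMeasurable
    (Filter.Eventually.of_forall fun _ => abs_skipTrunc_le _ _)

lemma lintegral_skipTrunc_sq_le {θ : ℝ} (hθ : 0 ≤ θ) (hα2 : α ≤ 2)
    (hm : ∫⁻ l, ENNReal.ofReal (|f l| ^ α) ∂ν ≤ ENNReal.ofReal (σ ^ α)) :
    ∫⁻ l, ENNReal.ofReal (skipTrunc θ (f l) ^ 2) ∂ν ≤ ENNReal.ofReal (θ ^ (2 - α) * σ ^ α) := by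
  have h0 := Real.rpow_nonneg hθ (2 - α)
  calc ∫⁻ l, ENNReal.ofReal (skipTrunc θ (f l) ^ 2) ∂ν
      ≤ ∫⁻ l, ENNReal.ofReal (θ ^ (2 - α)) * ENNReal.ofReal (|f l| ^ α) ∂ν := by
        refine lintegral_mono fun l => ?_
        rw [← ENNReal.ofReal_mul h0]
        exact ENNReal.ofReal_le_ofReal (skipTrunc_sq_le hθ hα2)
    _ = ENNReal.ofReal (θ ^ (2 - α)) * ∫⁻ l, ENNReal.ofReal (|f l| ^ α) ∂ν :=
        lintegral_const_mul' _ _ (by simp)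
    _ ≤ _ := by
        rw [ENNReal.ofReal_mul h0]
        gcongr

lemma abs_integral_sub_skipTrunc_le {θ : ℝ} (hθ : 0 < θ) (hα : 1 ≤ α) (hσ : 0 ≤ σ)
    (hm : ∫⁻ l, ENNReal.ofReal (|f l| ^ α) ∂ν ≤ ENNReal.ofReal (σ ^ α)) :
    |∫ l, (f l - skipTrunc θ (f l)) ∂ν| ≤ θ ^ (1 - α) * σ ^ α := by
  have h0 := Real.rpow_nonneg hθ.le (1 - α)
  refine (norm_integral_le_lintegral_norm (μ := ν)
    (fun l => f l - skipTrunc θ (f l))).trans ?_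
  refine ENNReal.toReal_le_of_le_ofReal (mul_nonneg h0 (Real.rpow_nonneg hσ _)) ?_
  calc ∫⁻ l, ENNReal.ofReal ‖f l - skipTrunc θ (f l)‖ ∂ν
      ≤ ∫⁻ l, ENNReal.ofReal (θ ^ (1 - α)) * ENNReal.ofReal (|f l| ^ α) ∂ν := by
        refine lintegral_mono fun l => ?_
        rw [← ENNReal.ofReal_mul h0]
        exact ENNReal.ofReal_le_ofReal (abs_sub_skipTrunc_le hθ hα)
    _ = ENNReal.ofReal (θ ^ (1 - α)) * ∫⁻ l, ENNReal.ofReal (|f l| ^ α) ∂ν :=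
        lintegral_const_mul' _ _ (by simp)
    _ ≤ _ := by
        rw [ENNReal.ofReal_mul h0]
        gcongr

end Moments

/-! ### Bias and second moment of the skipped loss estimate. -/

namespace LayeredMDP

variable {S A : Type*} [Fintype S] [DecidableEq S] [Fintype A] [DecidableEq A]

lemma skipLoss_eq (α σ C : ℝ) (t : ℕ) (x ℓ : S → A → ℝ) (s : S) (a : A) :
    skipLoss α σ C t x ℓ s a = skipTrunc (skipThreshold α σ C t x s a) (ℓ s a) := rfl

lemma skipThreshold_nonneg {α σ C : ℝ} (hσ : 0 ≤ σ) (hC : 0 ≤ C) (t : ℕ) {x : S → A → ℝ} {s : S}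
    {a : A} (hx : 0 ≤ x s a) : 0 ≤ skipThreshold α σ C t x s a := by
  unfold skipThreshold
  positivity

lemma skipThreshold_pos {α σ C : ℝ} (hσ : 0 < σ) (hC : 0 < C) {t : ℕ} (ht : 1 ≤ t)
    {x : S → A → ℝ} {s : S} {a : A} (hx : 0 < x s a) : 0 < skipThreshold α σ C t x s a := by
  have : (0 : ℝ) < t := by exact_mod_cast ht
  unfold skipThreshold
  positivity

/-- The bonus is exactly the general bound on the mean of the skipped part at this threshold. -/
lemma skipBonus_eq_threshold {α σ C : ℝ} (hα : 0 < α) (hσ : 0 < σ) (hC : 0 < C) {t : ℕ}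
    (ht : 1 ≤ t) {x : S → A → ℝ} {s : S} {a : A} (hx : 0 < x s a) :
    skipThreshold α σ C t x s a ^ (1 - α) * σ ^ α = skipBonus α σ C t x s a := by
  have ht0 : (0 : ℝ) < t := by exact_mod_cast ht
  have e : 1 / α * (1 - α) = 1 / α - 1 := by field_simp
  have eσ : σ ^ (1 - α) * σ ^ α = σ := by
    rw [← Real.rpow_add hσ, sub_add_cancel, Real.rpow_one]
  rw [skipThreshold, skipBonus, Real.mul_rpow (by positivity) (by positivity),
    Real.mul_rpow (by positivity) (by positivity), Real.mul_rpow hC.le hσ.le,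
    ← Real.rpow_mul ht0.le, ← Real.rpow_mul hx.le, e]
  nth_rewrite 3 [← eσ]
  ring

-- One factor x is kept apart so that, with the visit probability x, it cancels the square of the
-- importance weight.
lemma skipThreshold_rpow_two_sub {α σ C : ℝ} (hα : 0 < α) (hσ : 0 < σ) (hC : 0 < C) {t : ℕ}
    (ht : 1 ≤ t) {x : S → A → ℝ} {s : S} {a : A} (hx : 0 < x s a) :
    skipThreshold α σ C t x s a ^ (2 - α) * σ ^ α =
      C ^ (2 - α) * σ ^ 2 * (t : ℝ) ^ (2 / α - 1) * (x s a * x s a ^ (2 / α - 2)) := by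
  have ht0 : (0 : ℝ) < t := by exact_mod_cast ht
  have e : 1 / α * (2 - α) = 2 / α - 1 := by field_simp
  have eσ : σ ^ (2 - α) * σ ^ α = σ ^ 2 := by
    rw [← Real.rpow_add hσ, sub_add_cancel, Real.rpow_two]
  have ex : x s a * x s a ^ (2 / α - 2) = x s a ^ (2 / α - 1) := by
    nth_rewrite 1 [← Real.rpow_one (x s a)]
    rw [← Real.rpow_add hx]
    ring_nf
  rw [skipThreshold, Real.mul_rpow (by positivity) (by positivity),
    Real.mul_rpow (by positivity) (by positivity), Real.mul_rpow hC.le hσ.le,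
    ← Real.rpow_mul ht0.le, ← Real.rpow_mul hx.le, e, ex, ← eσ]
  ring

namespace IsRound

variable {M : LayeredMDP S A} {α σ : ℝ} {Ω Ω' : Type*} [MeasurableSpace Ω] [MeasurableSpace Ω']
  {μ : Measure Ω} [IsProbabilityMeasure μ] {g : Ω → Ω'} {κ : Kernel Ω' (S → A → ℝ)}
  [IsMarkovKernel κ] {pol : Ω' → S → A → ℝ} {traj : Ω → M.Traj} {Y : Ω → S → A → ℝ}

lemma measurable_skipLoss (h : M.IsRound α σ μ g κ pol traj Y) (C : ℝ) (t : ℕ) (s : S) (a : A) :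
    Measurable fun z : Ω' × (S → A → ℝ) => skipLoss α σ C t (M.occ (pol z.1)) z.2 s a := by
  have h1 : Measurable fun z : Ω' × (S → A → ℝ) => M.occ (pol z.1) s a :=
    (M.measurable_occ h.policy_meas s a).comp measurable_fst
  have h2 : Measurable fun z : Ω' × (S → A → ℝ) => z.2 s a := by fun_prop
  exact Measurable.skipTrunc ((h1.pow_const _).const_mul _) h2

lemma lossEstimate_eq (C : ℝ) (t : ℕ) (x : S → A → ℝ) (τ : M.Traj) (ℓ : S → A → ℝ) (c : S × A) :
    M.lossEstimate α σ C t x τ ℓ c.1 c.2 =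
      visit M c τ * (skipLoss α σ C t x ℓ c.1 c.2 / x c.1 c.2) := by
  rw [lossEstimate, mul_comm]
  rfl

/-- The second moment of the loss estimate, with weights known before the episode. -/
lemma integral_weight_mul_sq_le (h : M.IsRound α σ μ g κ pol traj Y) (hα : 0 < α) (hα2 : α ≤ 2)
    (hσ : 0 < σ) {C : ℝ} (hC : 0 < C) {t : ℕ} (ht : 1 ≤ t) (c : S × A) {W B : Ω' → ℝ}
    (hW : Measurable W) (hW0 : ∀ ω, 0 ≤ W ω) (hB0 : ∀ ω, 0 ≤ B ω)
    (hB : Integrable (fun ω => B (g ω)) μ)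
    (hWB : ∀ ω, 0 < M.occ (pol ω) c.1 c.2 →
      W ω * M.occ (pol ω) c.1 c.2 ^ (2 / α - 2) ≤ B ω) :
    Integrable (fun ω => W (g ω) *
        M.lossEstimate α σ C t (M.occ (pol (g ω))) (traj ω) (Y ω) c.1 c.2 ^ 2) μ ∧
      ∫ ω, W (g ω) *
        M.lossEstimate α σ C t (M.occ (pol (g ω))) (traj ω) (Y ω) c.1 c.2 ^ 2 ∂μ ≤
      C ^ (2 - α) * σ ^ 2 * (t : ℝ) ^ (2 / α - 1) * ∫ ω, B (g ω) ∂μ := by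
  set D := C ^ (2 - α) * σ ^ 2 * (t : ℝ) ^ (2 / α - 1) with hD
  have ht0 : (0 : ℝ) < t := by exact_mod_cast ht
  have hD0 : 0 ≤ D := by positivity
  have hx := M.measurable_occ h.policy_meas c.1 c.2
  set F : Ω' × (S → A → ℝ) → ℝ := fun z => W z.1 *
    (skipLoss α σ C t (M.occ (pol z.1)) z.2 c.1 c.2 / M.occ (pol z.1) c.1 c.2) ^ 2 with hF
  have hFm : Measurable F := (hW.comp measurable_fst).mul
    (((h.measurable_skipLoss C t c.1 c.2).div (hx.comp measurable_fst)).pow_const 2)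
  have hF0 : ∀ z, 0 ≤ F z := fun z => mul_nonneg (hW0 _) (sq_nonneg _)
  have heq : ∀ ω, W (g ω) *
      M.lossEstimate α σ C t (M.occ (pol (g ω))) (traj ω) (Y ω) c.1 c.2 ^ 2 =
      visit M c (traj ω) * F (g ω, Y ω) := by
    intro ω
    rw [lossEstimate_eq, hF, mul_pow]
    have : visit M c (traj ω) ^ 2 = visit M c (traj ω) := by
      unfold visit
      split_ifs <;> norm_num
    rw [this]
    ring
  have hnn : ∀ ω, 0 ≤ visit M c (traj ω) * F (g ω, Y ω) := fun ω =>
    mul_nonneg (visit_nonneg _ _) (hF0 _)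
  have hmeas : Measurable fun ω => visit M c (traj ω) * F (g ω, Y ω) :=
    (h.measurable_weight _).mul (hFm.comp (h.g_meas.prodMk h.loss_meas))
  have hle : ∫⁻ ω, ENNReal.ofReal (visit M c (traj ω) * F (g ω, Y ω)) ∂μ ≤
      ENNReal.ofReal (D * ∫ ω, B (g ω) ∂μ) := by
    have e1 : ∀ ω, ENNReal.ofReal (visit M c (traj ω) * F (g ω, Y ω)) =
        ENNReal.ofReal (visit M c (traj ω)) * ENNReal.ofReal (F (g ω, Y ω)) := fun ω =>
      ENNReal.ofReal_mul (visit_nonneg _ _)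
    simp_rw [e1]
    rw [h.lintegral_visit c hFm.ennreal_ofReal, ← integral_const_mul,
      ofReal_integral_eq_lintegral_ofReal (hB.const_mul D)
        (Filter.Eventually.of_forall fun ω => mul_nonneg hD0 (hB0 _))]
    refine lintegral_mono fun ω => ?_
    rcases (M.occ_nonneg (h.policy (g ω)) c.1 c.2).eq_or_lt with h0 | hpos
    · rw [← h0]
      simp
    · set x := M.occ (pol (g ω)) c.1 c.2 with hxdef
      have e2 : ∀ l, ENNReal.ofReal (F (g ω, l)) = ENNReal.ofReal (W (g ω) / x ^ 2) *
          ENNReal.ofReal (skipTrunc (skipThreshold α σ C t (M.occ (pol (g ω))) c.1 c.2)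
            (l c.1 c.2) ^ 2) := by
        intro l
        rw [← ENNReal.ofReal_mul (div_nonneg (hW0 _) (sq_nonneg _))]
        congr 1
        simp only [hF, skipLoss_eq, ← hxdef]
        ring
      simp_rw [e2]
      rw [lintegral_const_mul' _ _ (by simp), ← mul_assoc, ← ENNReal.ofReal_mul hpos.le]
      have hm2 := lintegral_skipTrunc_sq_le (f := fun l : S → A → ℝ => l c.1 c.2)
        (skipThreshold_nonneg (α := α) hσ.le hC.le t (M.occ_nonneg (h.policy (g ω)) c.1 c.2))
        hα2 (h.moment (g ω) c.1 c.2)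
      refine (mul_le_mul' le_rfl hm2).trans ?_
      rw [← ENNReal.ofReal_mul (mul_nonneg hpos.le (div_nonneg (hW0 _) (sq_nonneg _)))]
      refine ENNReal.ofReal_le_ofReal ?_
      rw [skipThreshold_rpow_two_sub (x := M.occ (pol (g ω))) (s := c.1) (a := c.2) hα hσ hC ht hpos,
        ← hD, ← hxdef]
      -- Visit probability x, squared importance weight 1/x², and second moment of the skipped loss.
      have e3 : x * (W (g ω) / x ^ 2) * (D * (x * x ^ (2 / α - 2))) =
          D * (W (g ω) * x ^ (2 / α - 2)) := by
        field_simp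
      rw [e3]
      exact mul_le_mul_of_nonneg_left (hWB _ hpos) hD0
  simp_rw [heq]
  have hB00 : 0 ≤ D * ∫ ω, B (g ω) ∂μ := mul_nonneg hD0 (integral_nonneg fun ω => hB0 _)
  refine ⟨⟨hmeas.aestronglyMeasurable, ?_⟩, ?_⟩
  · rw [hasFiniteIntegral_iff_ofReal (Filter.Eventually.of_forall hnn)]
    exact hle.trans_lt (by simp)
  · rw [integral_eq_lintegral_of_nonneg_ae (Filter.Eventually.of_forall hnn)
      hmeas.aestronglyMeasurable]
    exact ENNReal.toReal_le_of_le_ofReal hB00 hle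

/-- The conditional expectation of the skipped part of the loss. -/
noncomputable def skipBias (M : LayeredMDP S A) (α σ C : ℝ) (t : ℕ) (κ : Kernel Ω' (S → A → ℝ))
    (pol : Ω' → S → A → ℝ) (ω : Ω') (c : S × A) : ℝ :=
  ∫ l, (l c.1 c.2 - skipLoss α σ C t (M.occ (pol ω)) l c.1 c.2) ∂κ ω

lemma abs_skipBias_le (h : M.IsRound α σ μ g κ pol traj Y) (hα : 1 < α) (hσ : 0 < σ) {C : ℝ}
    (hC : 0 < C) {t : ℕ} (ht : 1 ≤ t) (c : S × A) (ω : Ω') (hpos : 0 < M.occ (pol ω) c.1 c.2) :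
    |skipBias M α σ C t κ pol ω c| ≤ skipBonus α σ C t (M.occ (pol ω)) c.1 c.2 := by
  rw [← skipBonus_eq_threshold (by linarith) hσ hC ht hpos]
  exact abs_integral_sub_skipTrunc_le (f := fun l : S → A → ℝ => l c.1 c.2)
    (skipThreshold_pos hσ hC ht hpos) hα.le hσ.le (h.moment ω c.1 c.2)

lemma integrable_loss (h : M.IsRound α σ μ g κ pol traj Y) (hα : 1 < α) (c : S × A)
    {f : Ω' → ℝ} (hf : Measurable f) (hf1 : ∀ ω, |f ω| ≤ 1) :
    Integrable (fun ω => f (g ω) * Y ω c.1 c.2) μ ∧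
      Integrable (fun ω => f (g ω) * ∫ l, l c.1 c.2 ∂κ (g ω)) μ ∧
      ∫ ω, f (g ω) * Y ω c.1 c.2 ∂μ = ∫ ω, f (g ω) * ∫ l, l c.1 c.2 ∂κ (g ω) ∂μ := by
  have hF : Measurable fun z : Ω' × (S → A → ℝ) => f z.1 * z.2 c.1 c.2 :=
    (hf.comp measurable_fst).mul (by fun_prop)
  have := h.integral_loss hF (by
    refine ne_top_of_le_ne_top (b := 1 + ENNReal.ofReal (σ ^ α)) (by simp) ?_
    calc ∫⁻ ω, ∫⁻ l, ‖f (g ω) * l c.1 c.2‖ₑ ∂κ (g ω) ∂μ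
        ≤ ∫⁻ _ω, (1 + ENNReal.ofReal (σ ^ α)) ∂μ := by
          refine lintegral_mono fun ω => le_trans (lintegral_mono fun l => ?_)
            (lintegral_enorm_le_of_moment hα.le (h.moment (g ω) c.1 c.2))
          rw [enorm_mul]
          refine mul_le_of_le_one_left zero_le ?_
          rw [← ofReal_norm, ← ENNReal.ofReal_one]
          exact ENNReal.ofReal_le_ofReal (hf1 _)
      _ = _ := by simp)
  simpa only [integral_const_mul] using this

/-- The loss estimates are unbiased up to the skipped part. -/
lemma integral_sub_mul_bias (h : M.IsRound α σ μ g κ pol traj Y) (hα : 1 < α) (C : ℝ) (t : ℕ)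
    (c : S × A) {u : ℝ} (hu0 : 0 ≤ u) (hu1 : u ≤ 1)
    (hu : ∀ ω, M.occ (pol ω) c.1 c.2 = 0 → u = 0) :
    Integrable (fun ω => (M.occ (pol (g ω)) c.1 c.2 - u) * (Y ω c.1 c.2 -
        M.lossEstimate α σ C t (M.occ (pol (g ω))) (traj ω) (Y ω) c.1 c.2)) μ ∧
      Integrable (fun ω => (M.occ (pol (g ω)) c.1 c.2 - u) *
        skipBias M α σ C t κ pol (g ω) c) μ ∧
      ∫ ω, (M.occ (pol (g ω)) c.1 c.2 - u) * (Y ω c.1 c.2 -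
        M.lossEstimate α σ C t (M.occ (pol (g ω))) (traj ω) (Y ω) c.1 c.2) ∂μ =
      ∫ ω, (M.occ (pol (g ω)) c.1 c.2 - u) * skipBias M α σ C t κ pol (g ω) c ∂μ := by
  have hx := M.measurable_occ h.policy_meas c.1 c.2
  have hxu : ∀ ω, |M.occ (pol ω) c.1 c.2 - u| ≤ 1 := fun ω => by
    have h1 := M.occ_nonneg (h.policy ω) c.1 c.2
    have h2 := M.occ_le_one (h.policy ω) c.1 c.2
    rw [abs_le]
    constructor <;> linarith
  obtain ⟨i1, i2, i3⟩ := h.integrable_loss hα c (hx.sub_const u) hxu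
  -- `F` carries the importance weight; the visit probability cancels its denominator in the mean.
  set F : Ω' × (S → A → ℝ) → ℝ := fun z => (M.occ (pol z.1) c.1 c.2 - u) /
    M.occ (pol z.1) c.1 c.2 * skipLoss α σ C t (M.occ (pol z.1)) z.2 c.1 c.2 with hF
  have hFm : Measurable F := (((hx.sub_const u).div hx).comp measurable_fst).mul
    (h.measurable_skipLoss C t c.1 c.2)
  obtain ⟨j1, j2, j3⟩ := h.integral_visit c hFm (by
    refine ne_top_of_le_ne_top (b := 1 + ENNReal.ofReal (σ ^ α)) (by simp) ?_
    calc ∫⁻ ω, ENNReal.ofReal (M.occ (pol (g ω)) c.1 c.2) * ∫⁻ l, ‖F (g ω, l)‖ₑ ∂κ (g ω) ∂μ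
        ≤ ∫⁻ _ω, (1 + ENNReal.ofReal (σ ^ α)) ∂μ := by
          refine lintegral_mono fun ω => ?_
          refine le_trans ?_ (lintegral_enorm_le_of_moment hα.le (h.moment (g ω) c.1 c.2))
          rw [← lintegral_const_mul' _ _ (by simp)]
          refine lintegral_mono fun l => ?_
          rw [← ofReal_norm, ← ofReal_norm,
            ← ENNReal.ofReal_mul (M.occ_nonneg (h.policy _) _ _)]
          refine ENNReal.ofReal_le_ofReal ?_
          simp only [Real.norm_eq_abs, hF, abs_mul, abs_div,
            abs_of_nonneg (M.occ_nonneg (h.policy (g ω)) c.1 c.2)]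
          rcases (M.occ_nonneg (h.policy (g ω)) c.1 c.2).eq_or_lt with h0 | hpos
          · rw [← h0]
            simp
          · rw [← mul_assoc, mul_div_cancel₀ _ hpos.ne']
            calc _ ≤ 1 * |l c.1 c.2| := mul_le_mul (hxu _) (abs_skipTrunc_le _ _)
                  (abs_nonneg _) zero_le_one
              _ = _ := one_mul _
      _ = _ := by simp)
  have k1 : ∀ ω, (M.occ (pol (g ω)) c.1 c.2 - u) * (Y ω c.1 c.2 -
        M.lossEstimate α σ C t (M.occ (pol (g ω))) (traj ω) (Y ω) c.1 c.2) =
      (M.occ (pol (g ω)) c.1 c.2 - u) * Y ω c.1 c.2 - visit M c (traj ω) * F (g ω, Y ω) := by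
    intro ω
    rw [lossEstimate_eq, hF]
    ring
  have k2 : ∀ ω, (M.occ (pol (g ω)) c.1 c.2 - u) * skipBias M α σ C t κ pol (g ω) c =
      (M.occ (pol (g ω)) c.1 c.2 - u) * ∫ l, l c.1 c.2 ∂κ (g ω) -
      M.occ (pol (g ω)) c.1 c.2 * ∫ l, F (g ω, l) ∂κ (g ω) := by
    intro ω
    simp only [skipBias, skipLoss_eq]
    rw [integral_sub (integrable_of_moment hα.le (by fun_prop) (h.moment (g ω) c.1 c.2))
      (integrable_skipTrunc hα.le (by fun_prop) _ (h.moment (g ω) c.1 c.2)), mul_sub]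
    congr 1
    simp only [hF, integral_const_mul, skipLoss_eq]
    -- A pair that the learner never visits would not be estimated at all; `hu` makes the comparator
    -- avoid it as well.
    rcases (M.occ_nonneg (h.policy (g ω)) c.1 c.2).eq_or_lt with h0 | hpos
    · rw [← h0, hu _ h0.symm]
      simp
    · rw [← mul_assoc, mul_div_cancel₀ _ hpos.ne']
  simp_rw [k1, k2]
  exact ⟨i1.sub j1, i2.sub j2, by rw [integral_sub i1 j1, integral_sub i2 j2, i3, j3]⟩

end IsRound

end LayeredMDP

/-- The space `Ω` with the `σ`-algebra `m`. -/
def Past {Ω : Type*} (_m : MeasurableSpace Ω) : Type _ := Ω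

/-- The identity map, as a map to the past. -/
def toPast {Ω : Type*} (m : MeasurableSpace Ω) : Ω → Past m := id

instance {Ω : Type*} (m : MeasurableSpace Ω) : MeasurableSpace (Past m) := m

namespace LayeredMDP

variable {S A : Type*} [Fintype S] [DecidableEq S] [Fintype A] [DecidableEq A]

lemma skipBonus_nonneg {α σ C : ℝ} (hσ : 0 ≤ σ) (hC : 0 ≤ C) (t : ℕ) {x : S → A → ℝ} {s : S}
    {a : A} (hx : 0 ≤ x s a) : 0 ≤ skipBonus α σ C t x s a := by
  unfold skipBonus
  positivity

namespace IsRound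

variable {M : LayeredMDP S A} {α σ : ℝ} {Ω Ω' : Type*} [MeasurableSpace Ω] [MeasurableSpace Ω']
  {μ : Measure Ω} [IsProbabilityMeasure μ] {g : Ω → Ω'} {κ : Kernel Ω' (S → A → ℝ)}
  [IsMarkovKernel κ] {pol : Ω' → S → A → ℝ} {traj : Ω → M.Traj} {Y : Ω → S → A → ℝ}

/-- The bonus compensates the bias of skipping, up to a centred error. -/
lemma exists_centred_error (h : M.IsRound α σ μ g κ pol traj Y) (hα : 1 < α) (hσ : 0 < σ) {C : ℝ}
    (hC : 0 < C) {t : ℕ} (ht : 1 ≤ t) {u : S → A → ℝ} (hu0 : ∀ s a, 0 ≤ u s a)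
    (hu1 : ∀ s a, u s a ≤ 1) (hu : ∀ ω s a, M.occ (pol ω) s a = 0 → u s a = 0) :
    ∃ N : Ω → ℝ, Integrable N μ ∧ ∫ ω, N ω ∂μ = 0 ∧ ∀ ω,
      ∑ s, ∑ a, (M.occ (pol (g ω)) s a - u s a) * (Y ω s a -
          M.lossEstimate α σ C t (M.occ (pol (g ω))) (traj ω) (Y ω) s a +
          skipBonus α σ C t (M.occ (pol (g ω))) s a) ≤
        N ω + 2 * ∑ s, ∑ a, max (M.occ (pol (g ω)) s a - u s a) 0 *
          skipBonus α σ C t (M.occ (pol (g ω))) s a := by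
  have key : ∀ c : S × A, _ := fun c => h.integral_sub_mul_bias hα C t c (hu0 c.1 c.2)
    (hu1 c.1 c.2) (fun ω => hu ω c.1 c.2)
  -- The centred error is the deviation of the estimation error from its conditional mean, which is
  -- given by the skipping bias.
  refine ⟨fun ω => ∑ c : S × A, ((M.occ (pol (g ω)) c.1 c.2 - u c.1 c.2) * (Y ω c.1 c.2 -
      M.lossEstimate α σ C t (M.occ (pol (g ω))) (traj ω) (Y ω) c.1 c.2) -
      (M.occ (pol (g ω)) c.1 c.2 - u c.1 c.2) * skipBias M α σ C t κ pol (g ω) c),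
    integrable_finsetSum _ fun c _ => (key c).1.sub (key c).2.1, ?_, fun ω => ?_⟩
  · refine (integral_finsetSum _ fun c _ => (key c).1.sub (key c).2.1).trans ?_
    refine Finset.sum_eq_zero fun c _ => ?_
    rw [integral_sub' (key c).1 (key c).2.1, (key c).2.2, sub_self]
  · rw [← Fintype.sum_prod_type' (fun s a => (M.occ (pol (g ω)) s a - u s a) * (Y ω s a -
          M.lossEstimate α σ C t (M.occ (pol (g ω))) (traj ω) (Y ω) s a +
          skipBonus α σ C t (M.occ (pol (g ω))) s a)),
      ← Fintype.sum_prod_type' (fun s a => max (M.occ (pol (g ω)) s a - u s a) 0 *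
          skipBonus α σ C t (M.occ (pol (g ω))) s a), Finset.mul_sum, ← Finset.sum_add_distrib]
    refine Finset.sum_le_sum fun c _ => ?_
    have hx0 := M.occ_nonneg (h.policy (g ω)) c.1 c.2
    have hb := skipBonus_nonneg (α := α) hσ.le hC.le t hx0
    rcases hx0.eq_or_lt with h0 | hpos
    · rw [← h0, hu _ _ _ h0.symm]
      simp
    · have hbias := abs_le.1 (h.abs_skipBias_le hα hσ hC ht c (g ω) hpos)
      set d := M.occ (pol (g ω)) c.1 c.2 - u c.1 c.2
      set b := skipBonus α σ C t (M.occ (pol (g ω))) c.1 c.2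
      set e := skipBias M α σ C t κ pol (g ω) c
      -- Since |e| ≤ b, the sum e + b lies between 0 and 2b: a negative `d` only helps, and a
      -- positive one costs at most 2b.
      have : d * (e + b) ≤ 2 * (max d 0 * b) := by
        calc d * (e + b) ≤ max d 0 * (e + b) :=
              mul_le_mul_of_nonneg_right (le_max_left _ _) (by linarith)
          _ ≤ max d 0 * (2 * b) :=
              mul_le_mul_of_nonneg_left (by linarith) (le_max_right _ _)
          _ = _ := by ring
      linarith

end IsRound

/-! ### From a single episode to the interaction. -/

namespace IsInteraction

variable {M : LayeredMDP S A} {α σ : ℝ} {T : ℕ} {Ω : Type*} {mΩ : MeasurableSpace Ω}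
  {μ : Measure Ω} {ℱ : Filtration ℕ mΩ} {ν : ℕ → Ω → Measure (S → A → ℝ)}
  {π : ℕ → Ω → S → A → ℝ} {traj : ℕ → Ω → M.Traj} {ℓ : ℕ → Ω → S → A → ℝ}

/-- The conditioning variable is the identity into Ω with the σ-algebra of the past, so the laws
chosen by the environment form a kernel from that space. -/
lemma exists_isRound (h : M.IsInteraction α σ T μ ℱ ν π traj ℓ) {t : ℕ}
    (ht : t ∈ Finset.Icc 1 T) :
    ∃ κ : Kernel (Past (ℱ (t - 1))) (S → A → ℝ), IsMarkovKernel κ ∧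
      M.IsRound α σ μ (toPast (ℱ (t - 1))) κ (fun ω : Past (ℱ (t - 1)) => π t ω) (traj t) (ℓ t) := by
  refine ⟨⟨fun ω : Past (ℱ (t - 1)) => ν t ω, Measure.measurable_of_measurable_coe _ (h.law_meas t ht)⟩,
    ⟨fun ω => h.law_prob t ht ω⟩, ?_⟩
  exact
    { g_meas := measurable_id'' (ℱ.le (t - 1))
      policy := h.policy t ht
      policy_meas := h.policy_meas t ht
      moment := h.moment t ht
      loss_meas := h.loss_meas t ht
      traj_meas := fun τ => ℱ.le t _ (h.traj_obs t ht τ)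
      law := h.law t ht }

lemma measurable_policy (h : M.IsInteraction α σ T μ ℱ ν π traj ℓ) {t : ℕ}
    (ht : t ∈ Finset.Icc 1 T) (s : S) (a : A) : Measurable fun ω => π t ω s a :=
  (h.policy_meas t ht s a).mono (ℱ.le (t - 1)) le_rfl

lemma measurable_comp_policy (h : M.IsInteraction α σ T μ ℱ ν π traj ℓ) {t : ℕ}
    (ht : t ∈ Finset.Icc 1 T) {f : (S → A → ℝ) → ℝ} (hf : Measurable f) :
    Measurable fun ω => f (π t ω) :=
  hf.comp (measurable_pi_lambda _ fun s => measurable_pi_lambda _ fun a =>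
    h.measurable_policy ht s a)

lemma integrable_comp_policy [IsProbabilityMeasure μ]
    (h : M.IsInteraction α σ T μ ℱ ν π traj ℓ) {t : ℕ} (ht : t ∈ Finset.Icc 1 T)
    {f : (S → A → ℝ) → ℝ} (hf : Measurable f) {b : ℝ} (hb : ∀ ρ, IsPolicy ρ → |f ρ| ≤ b) :
    Integrable (fun ω => f (π t ω)) μ :=
  Integrable.of_bound (h.measurable_comp_policy ht hf).aestronglyMeasurable b
    (Filter.Eventually.of_forall fun ω => hb _ (h.policy t ht ω))

lemma integral_weight_mul_sq_le [IsProbabilityMeasure μ]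
    (h : M.IsInteraction α σ T μ ℱ ν π traj ℓ) {t : ℕ} (ht : t ∈ Finset.Icc 1 T) (hα : 0 < α)
    (hα2 : α ≤ 2) (hσ : 0 < σ) {C : ℝ} (hC : 0 < C) (c : S × A) {W B : (S → A → ℝ) → ℝ} {b : ℝ}
    (hW : Measurable W) (hW0 : ∀ ρ, IsPolicy ρ → 0 ≤ W ρ) (hB : Measurable B)
    (hB0 : ∀ ρ, IsPolicy ρ → 0 ≤ B ρ) (hBb : ∀ ρ, IsPolicy ρ → |B ρ| ≤ b)
    (hWB : ∀ ρ, IsPolicy ρ → 0 < M.occ ρ c.1 c.2 →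
      W ρ * M.occ ρ c.1 c.2 ^ (2 / α - 2) ≤ B ρ) :
    Integrable (fun ω => W (π t ω) *
        M.lossEstimate α σ C t (M.occ (π t ω)) (traj t ω) (ℓ t ω) c.1 c.2 ^ 2) μ ∧
      ∫ ω, W (π t ω) *
        M.lossEstimate α σ C t (M.occ (π t ω)) (traj t ω) (ℓ t ω) c.1 c.2 ^ 2 ∂μ ≤
      C ^ (2 - α) * σ ^ 2 * (t : ℝ) ^ (2 / α - 1) * ∫ ω, B (π t ω) ∂μ := by
  obtain ⟨κ, hκ, hR⟩ := h.exists_isRound ht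
  exact hR.integral_weight_mul_sq_le hα hα2 hσ hC (Finset.mem_Icc.1 ht).1 c
    (W := fun ω : Past (ℱ (t - 1)) => W (π t ω))
    (B := fun ω : Past (ℱ (t - 1)) => B (π t ω))
    (hW.comp (measurable_pi_lambda _ fun s => measurable_pi_lambda _ fun a => hR.policy_meas s a))
    (fun ω => hW0 _ (hR.policy ω)) (fun ω => hB0 _ (hR.policy ω))
    (h.integrable_comp_policy ht hB hBb) (fun ω => hWB _ (hR.policy ω))

lemma exists_centred_error [IsProbabilityMeasure μ]
    (h : M.IsInteraction α σ T μ ℱ ν π traj ℓ) {t : ℕ} (ht : t ∈ Finset.Icc 1 T) (hα : 1 < α)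
    (hσ : 0 < σ) {C : ℝ} (hC : 0 < C) {u : S → A → ℝ} (hu0 : ∀ s a, 0 ≤ u s a)
    (hu1 : ∀ s a, u s a ≤ 1) (hu : ∀ ω s a, M.occ (π t ω) s a = 0 → u s a = 0) :
    ∃ N : Ω → ℝ, Integrable N μ ∧ ∫ ω, N ω ∂μ = 0 ∧ ∀ ω,
      ∑ s, ∑ a, (M.occ (π t ω) s a - u s a) * (ℓ t ω s a -
          M.lossEstimate α σ C t (M.occ (π t ω)) (traj t ω) (ℓ t ω) s a +
          skipBonus α σ C t (M.occ (π t ω)) s a) ≤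
        N ω + 2 * ∑ s, ∑ a, max (M.occ (π t ω) s a - u s a) 0 *
          skipBonus α σ C t (M.occ (π t ω)) s a := by
  obtain ⟨κ, hκ, hR⟩ := h.exists_isRound ht
  exact hR.exists_centred_error hα hσ hC (Finset.mem_Icc.1 ht).1 hu0 hu1 hu

lemma integrable_occ_mul_loss [IsProbabilityMeasure μ]
    (h : M.IsInteraction α σ T μ ℱ ν π traj ℓ) {t : ℕ} (ht : t ∈ Finset.Icc 1 T) (hα : 1 < α)
    (p : S → A) (s : S) (a : A) :
    Integrable (fun ω => (M.occ (π t ω) s a - M.occ (detPolicy p) s a) * ℓ t ω s a) μ := by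
  obtain ⟨κ, hκ, hR⟩ := h.exists_isRound ht
  refine (hR.integrable_loss hα (s, a) (f := fun ω : Past (ℱ (t - 1)) => M.occ (π t ω) s a -
    M.occ (detPolicy p) s a) ((M.measurable_occ hR.policy_meas s a).sub_const _) fun ω => ?_).1
  have h1 := M.occ_nonneg (hR.policy ω) s a
  have h2 := M.occ_le_one (hR.policy ω) s a
  have h3 := M.occ_nonneg (isPolicy_detPolicy p) s a
  have h4 := M.occ_le_one (isPolicy_detPolicy p) s a
  rw [abs_le]
  constructor <;> linarith

end IsInteraction

/-- The occupancy measures computed by the algorithm are those of the policies it plays. -/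
lemma IsHTFTRLOM.occ_eq {M : LayeredMDP S A} {α σ C β : ℝ} {T : ℕ} {Ω : Type*}
    {x π : ℕ → Ω → S → A → ℝ} {traj : ℕ → Ω → M.Traj} {ℓ : ℕ → Ω → S → A → ℝ}
    (h : M.IsHTFTRLOM α σ C β T x π traj ℓ) {t : ℕ} (ht : t ∈ Finset.Icc 1 T) (ω : Ω) :
    M.occ (π t ω) = x t ω := by
  have hf := M.isFlow_of_mem (h.mem t ht ω)
  refine hf.occ_eq fun s a => ?_
  by_cases h0 : ∑ b, x t ω s b = 0
  · rw [h0, zero_mul]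
    exact (Finset.sum_eq_zero_iff_of_nonneg fun b _ => hf.nonneg s b).1 h0 a (Finset.mem_univ a)
  · rw [h.policy_eq t ht ω s h0 a, mul_div_cancel₀ _ h0]

end LayeredMDP

/-! ### Pathwise and expected regret of the algorithm. -/

lemma rpow_sub_rpow_pred_le {q : ℝ} (hq0 : 0 < q) (hq1 : q ≤ 1) {t : ℕ} (ht : 1 ≤ t) :
    (t : ℝ) ^ q - ((t - 1 : ℕ) : ℝ) ^ q ≤ (t : ℝ) ^ (q - 1) := by
  have ht0 : (0 : ℝ) < t := by exact_mod_cast ht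
  rcases Nat.eq_zero_or_pos (t - 1) with h | h
  · have : t = 1 := by omega
    subst this
    simp [hq0.ne']
  · have h0 : (0 : ℝ) < ((t - 1 : ℕ) : ℝ) := by exact_mod_cast h
    have hc : ((t - 1 : ℕ) : ℝ) = t - 1 := by push_cast [ht]; ring
    have h1 : (t : ℝ) ^ q = t * (t : ℝ) ^ (q - 1) := by
      rw [Real.rpow_sub_one ht0.ne']
      field_simp
    have h2 : ((t - 1 : ℕ) : ℝ) ^ q = ((t - 1 : ℕ) : ℝ) * ((t - 1 : ℕ) : ℝ) ^ (q - 1) := by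
      rw [Real.rpow_sub_one h0.ne']
      field_simp
    have h3 : (t : ℝ) ^ (q - 1) ≤ ((t - 1 : ℕ) : ℝ) ^ (q - 1) :=
      Real.rpow_le_rpow_of_nonpos h0 (by rw [hc]; linarith) (by linarith)
    have h4 := mul_le_mul_of_nonneg_left h3 h0.le
    rw [h1, h2]
    rw [hc] at h4 ⊢
    linarith

namespace LayeredMDP

variable {S A : Type*} [Fintype S] [DecidableEq S] [Fintype A] [DecidableEq A]

lemma measurable_powSum_occ (M : LayeredMDP S A) (q : ℝ) :
    Measurable fun ρ : S → A → ℝ => powSum q (M.occ ρ) :=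
  Finset.measurable_fun_sum _ fun s _ => Finset.measurable_fun_sum _ fun a _ =>
    (M.measurable_occ (pol := fun ρ => ρ) (fun s a => by fun_prop) s a).pow_const _

lemma abs_lossEstimate_le (M : LayeredMDP S A) {α σ C : ℝ} (hσ : 0 ≤ σ) (hC : 0 ≤ C) (t : ℕ)
    {x : S → A → ℝ} (τ : M.Traj) (ℓ : S → A → ℝ) {s : S} {a : A} (hx : 0 < x s a) :
    |M.lossEstimate α σ C t x τ ℓ s a| ≤ C * σ * (t : ℝ) ^ (1 / α) * x s a ^ (1 / α - 1) := by
  have h1 : |skipLoss α σ C t x ℓ s a| ≤ skipThreshold α σ C t x s a :=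
    abs_skipTrunc_le_level (skipThreshold_nonneg hσ hC t hx.le) _
  have h2 : skipThreshold α σ C t x s a / x s a =
      C * σ * (t : ℝ) ^ (1 / α) * x s a ^ (1 / α - 1) := by
    rw [skipThreshold, Real.rpow_sub_one hx.ne']
    ring
  rw [← h2, lossEstimate, abs_mul, abs_div, abs_of_pos hx]
  calc _ ≤ |skipLoss α σ C t x ℓ s a| / x s a * 1 := by
        refine mul_le_mul_of_nonneg_left ?_ (by positivity)
        split_ifs <;> simp
    _ ≤ _ := by
        rw [mul_one]
        gcongr

lemma lossEstimate_eq_zero (M : LayeredMDP S A) (α σ C : ℝ) (t : ℕ)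
    {x : S → A → ℝ} (τ : M.Traj) (ℓ : S → A → ℝ) {s : S} {a : A} (hx : x s a = 0) :
    M.lossEstimate α σ C t x τ ℓ s a = 0 := by
  simp [lossEstimate, hx]

lemma sum_rpow_mul_skipBonus_sq_le {α σ C : ℝ} (hα : 1 ≤ α) (t : ℕ) {x : S → A → ℝ}
    (hx : ∀ s a, 0 ≤ x s a) :
    ∑ s, ∑ a, x s a ^ (2 - 1 / α) * skipBonus α σ C t x s a ^ 2 ≤
      (C ^ (1 - α) * σ * (t : ℝ) ^ (1 / α - 1)) ^ 2 * powSum (1 / α) x := by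
  have hα0 : 0 < α := by linarith
  have hq1 : 1 / α ≤ 1 := by rw [div_le_one hα0]; exact hα
  rw [powSum, Finset.mul_sum]
  refine Finset.sum_le_sum fun s _ => ?_
  rw [Finset.mul_sum]
  refine Finset.sum_le_sum fun a _ => ?_
  rcases (hx s a).eq_or_lt with h0 | hpos
  · rw [← h0, Real.zero_rpow (by linarith), zero_mul]
    positivity
  · have h3 : x s a ^ (2 - 1 / α) * (x s a ^ (1 / α - 1)) ^ 2 = x s a ^ (1 / α) := by
      rw [← Real.rpow_mul_natCast hpos.le, ← Real.rpow_add hpos]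
      congr 1
      push_cast
      ring
    rw [← h3, skipBonus]
    apply le_of_eq
    ring

lemma tsallisObj_eq {α σ β : ℝ} (t : ℕ) (L y : S → A → ℝ) :
    (∑ s, ∑ a, y s a * L s a) + tsallis α σ β t y =
      tsallisObj (1 / α) (σ * (t : ℝ) ^ (1 / α) / β) L y := by
  rw [tsallis, learningRate, one_div_div, tsallisObj, pairing, powSum]
  ring

/-- The pathwise regret inequality of the algorithm. -/
lemma IsHTFTRLOM.pathwise {M : LayeredMDP S A} [Nonempty A] {α σ C β R : ℝ} {T : ℕ} {Ω : Type*}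
    {x π : ℕ → Ω → S → A → ℝ} {traj : ℕ → Ω → M.Traj} {ℓ : ℕ → Ω → S → A → ℝ}
    (h : M.IsHTFTRLOM α σ C β T x π traj ℓ) (hα : 1 < α) (hσ : 0 < σ)
    (hC : 0 < C) (hβ : 0 < β)
    (htune : β * (R * C + C ^ (1 - α)) ≤ 1 / α * (1 - 1 / α) / 4) (ω : Ω) {u : S → A → ℝ}
    (hu : u ∈ M.occSet) (v : ℕ → S → ℝ)
    (hv : ∀ t ∈ Finset.Icc 1 T, ∀ s a, 0 < x t ω s a →
      |M.lossEstimate α σ C t (x t ω) (traj t ω) (ℓ t ω) s a +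
        (M.expNext (v t) s a - v t s)| ≤
        R * C * σ * (t : ℝ) ^ (1 / α) * x t ω s a ^ (1 / α - 1)) :
    ∑ t ∈ Finset.Icc 1 T, ∑ s, ∑ a, (x t ω s a - u s a) *
        (M.lossEstimate α σ C t (x t ω) (traj t ω) (ℓ t ω) s a -
          skipBonus α σ C t (x t ω) s a) ≤
      ∑ t ∈ Finset.Icc 1 T, (tsallisStab (1 / α) / (σ * (t : ℝ) ^ (1 / α) / β) *
          (2 * ∑ s, ∑ a, x t ω s a ^ (2 - 1 / α) *
            (M.lossEstimate α σ C t (x t ω) (traj t ω) (ℓ t ω) s a +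
              (M.expNext (v t) s a - v t s)) ^ 2 +
            2 * ((C ^ (1 - α) * σ * (t : ℝ) ^ (1 / α - 1)) ^ 2 * powSum (1 / α) (x t ω))) +
        (σ * (t : ℝ) ^ (1 / α) / β - σ * ((t - 1 : ℕ) : ℝ) ^ (1 / α) / β) *
          (powSum (1 / α) (x t ω) - powSum (1 / α) u)) := by
  have hα0 : 0 < α := by linarith
  have hq0 : 0 < 1 / α := by positivity
  have hq1 : 1 / α < 1 := by rw [div_lt_one hα0]; exact hα
  have ht0 : ∀ t ∈ Finset.Icc 1 T, (1 : ℝ) ≤ t := fun t ht => by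
    exact_mod_cast (Finset.mem_Icc.1 ht).1
  have key := M.ftrl_regret (q := 1 / α) (T := T) (c := fun t => σ * (t : ℝ) ^ (1 / α) / β)
    (x := fun t => x t ω) (l := fun t s a =>
      M.lossEstimate α σ C t (x t ω) (traj t ω) (ℓ t ω) s a - skipBonus α σ C t (x t ω) s a)
    (v := v) hq0 hq1 (by simp [hα0.ne'])
    (fun t ht => by have := ht0 t ht; positivity) (fun t ht => h.mem t ht ω)
    (fun t ht => by
      have := h.isMin t ht ω
      simp only [tsallisObj_eq] at this
      exact this) (fun t ht s a hpos => ?_) hu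
  · simp only [pairing, ← Finset.sum_sub_distrib, ← sub_mul] at key
    refine key.trans (Finset.sum_le_sum fun t ht => ?_)
    have htp := ht0 t ht
    have hK := tsallisStab_pos hq0 hq1
    have hxt := (M.isFlow_of_mem (h.mem t ht ω)).nonneg
    refine add_le_add (mul_le_mul_of_nonneg_left ?_ (by positivity)) le_rfl
    have hb := sum_rpow_mul_skipBonus_sq_le (σ := σ) (C := C) hα.le t hxt
    have : ∑ s, ∑ a, x t ω s a ^ (2 - 1 / α) *
        (M.lossEstimate α σ C t (x t ω) (traj t ω) (ℓ t ω) s a - skipBonus α σ C t (x t ω) s a +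
          (M.expNext (v t) s a - v t s)) ^ 2 ≤
        2 * ∑ s, ∑ a, x t ω s a ^ (2 - 1 / α) *
            (M.lossEstimate α σ C t (x t ω) (traj t ω) (ℓ t ω) s a +
              (M.expNext (v t) s a - v t s)) ^ 2 +
          2 * ∑ s, ∑ a, x t ω s a ^ (2 - 1 / α) * skipBonus α σ C t (x t ω) s a ^ 2 := by
      simp only [Finset.mul_sum, ← Finset.sum_add_distrib]
      refine Finset.sum_le_sum fun s _ => Finset.sum_le_sum fun a _ => ?_
      have hX : 0 ≤ x t ω s a ^ (2 - 1 / α) := Real.rpow_nonneg (hxt s a) _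
      set e := M.lossEstimate α σ C t (x t ω) (traj t ω) (ℓ t ω) s a +
        (M.expNext (v t) s a - v t s) with he
      set b := skipBonus α σ C t (x t ω) s a
      have e1 : M.lossEstimate α σ C t (x t ω) (traj t ω) (ℓ t ω) s a - b +
          (M.expNext (v t) s a - v t s) = e - b := by rw [he]; ring
      rw [e1]
      have : (e - b) ^ 2 ≤ 2 * e ^ 2 + 2 * b ^ 2 := by nlinarith [sq_nonneg (e + b)]
      have := mul_le_mul_of_nonneg_left this hX
      linarith
    linarith
  · have htp := ht0 t ht
    have htp0 : (0 : ℝ) < t := by linarith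
    have hX : 0 < x t ω s a ^ (1 / α - 1) := Real.rpow_pos_of_pos hpos _
    have hb : |skipBonus α σ C t (x t ω) s a| ≤
        C ^ (1 - α) * σ * (t : ℝ) ^ (1 / α) * x t ω s a ^ (1 / α - 1) := by
      rw [abs_of_nonneg (skipBonus_nonneg hσ.le hC.le t hpos.le), skipBonus]
      have : (t : ℝ) ^ (1 / α - 1) ≤ (t : ℝ) ^ (1 / α) :=
        Real.rpow_le_rpow_of_exponent_le htp (by linarith)
      gcongr
    have hv' := hv t ht s a hpos
    have e1 : M.lossEstimate α σ C t (x t ω) (traj t ω) (ℓ t ω) s a -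
        skipBonus α σ C t (x t ω) s a + (M.expNext (v t) s a - v t s) =
        (M.lossEstimate α σ C t (x t ω) (traj t ω) (ℓ t ω) s a +
          (M.expNext (v t) s a - v t s)) - skipBonus α σ C t (x t ω) s a := by ring
    rw [e1]
    refine (abs_sub _ _).trans ((add_le_add hv' hb).trans ?_)
    -- R C comes from the shifted loss estimate and C^(1-α) from the bonus; the tuning keeps their
    -- sum inside the stability range.
    have hRC : R * C + C ^ (1 - α) ≤ 1 / α * (1 - 1 / α) / 4 / β := by
      rw [le_div_iff₀ hβ]
      linarith
    have h0 : 0 ≤ σ * (t : ℝ) ^ (1 / α) * x t ω s a ^ (1 / α - 1) := by positivity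
    calc _ = (R * C + C ^ (1 - α)) * (σ * (t : ℝ) ^ (1 / α) * x t ω s a ^ (1 / α - 1)) := by ring
      _ ≤ 1 / α * (1 - 1 / α) / 4 / β *
          (σ * (t : ℝ) ^ (1 / α) * x t ω s a ^ (1 / α - 1)) :=
          mul_le_mul_of_nonneg_right hRC h0
      _ = _ := by ring

/-- The expected regret of the algorithm, in terms of a potential `V` that dominates the
regularization, the bonuses and the second moments of the shifted loss estimates. -/
lemma regret_le_sum (M : LayeredMDP S A) [Nonempty A] {α σ C β R : ℝ} {T : ℕ}
    {Ω : Type*} {mΩ : MeasurableSpace Ω} {μ : Measure Ω} [IsProbabilityMeasure μ]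
    {ℱ : Filtration ℕ mΩ} {ν : ℕ → Ω → Measure (S → A → ℝ)}
    {x π : ℕ → Ω → S → A → ℝ} {traj : ℕ → Ω → M.Traj} {ℓ : ℕ → Ω → S → A → ℝ}
    (hI : M.IsInteraction α σ T μ ℱ ν π traj ℓ) (hA : M.IsHTFTRLOM α σ C β T x π traj ℓ)
    (hα : 1 < α) (hα2 : α ≤ 2) (hσ : 0 < σ) (hC : 0 < C) (hβ : 0 < β)
    (htune : β * (R * C + C ^ (1 - α)) ≤ 1 / α * (1 - 1 / α) / 4) (p : S → A)
    {W B : S × A → (S → A → ℝ) → ℝ} {V : (S → A → ℝ) → ℝ} {k₀ k₁ b : ℝ}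
    (hW : ∀ c, Measurable (W c)) (hW0 : ∀ c ρ, IsPolicy ρ → 0 ≤ W c ρ)
    (hB : ∀ c, Measurable (B c)) (hB0 : ∀ c ρ, IsPolicy ρ → 0 ≤ B c ρ)
    (hBb : ∀ c ρ, IsPolicy ρ → |B c ρ| ≤ b)
    (hV : Measurable V) (hVb : ∀ ρ, IsPolicy ρ → |V ρ| ≤ b)
    (hWB : ∀ c ρ, IsPolicy ρ → 0 < M.occ ρ c.1 c.2 →
      W c ρ * M.occ ρ c.1 c.2 ^ (2 / α - 2) ≤ B c ρ)
    (hBV : ∀ ρ, IsPolicy ρ → ∑ c, B c ρ ≤ k₁ * V ρ)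
    (hbonus : ∀ ρ, IsPolicy ρ → ∑ s, ∑ a, max (M.occ ρ s a - M.occ (detPolicy p) s a) 0 *
      M.occ ρ s a ^ (1 / α - 1) ≤ k₀ * V ρ)
    (hreg : ∀ ρ, IsPolicy ρ →
      powSum (1 / α) (M.occ ρ) - powSum (1 / α) (M.occ (detPolicy p)) ≤ k₀ * V ρ)
    (hshift : ∀ t ∈ Finset.Icc 1 T, ∀ ω, ∃ v : S → ℝ,
      (∀ s a, 0 < M.occ (π t ω) s a →
        |M.lossEstimate α σ C t (M.occ (π t ω)) (traj t ω) (ℓ t ω) s a +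
          (M.expNext v s a - v s)| ≤
          R * C * σ * (t : ℝ) ^ (1 / α) * M.occ (π t ω) s a ^ (1 / α - 1)) ∧
      ∑ s, ∑ a, M.occ (π t ω) s a ^ (2 - 1 / α) *
        (M.lossEstimate α σ C t (M.occ (π t ω)) (traj t ω) (ℓ t ω) s a +
          (M.expNext v s a - v s)) ^ 2 ≤
        ∑ c : S × A, W c (π t ω) *
          M.lossEstimate α σ C t (M.occ (π t ω)) (traj t ω) (ℓ t ω) c.1 c.2 ^ 2) :
    M.regret T μ π ℓ p ≤ ∑ t ∈ Finset.Icc 1 T,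
      ((2 * C ^ (1 - α) * k₀ + k₀ / β + 2 * tsallisStab (1 / α) * (β * C ^ (2 - α)) * k₁) *
          (σ * (t : ℝ) ^ (1 / α - 1)) * ∫ ω, V (π t ω) ∂μ +
        2 * tsallisStab (1 / α) * (β * (C ^ (1 - α)) ^ 2) * (σ * (t : ℝ) ^ (1 / α - 2)) *
          ∫ ω, powSum (1 / α) (M.occ (π t ω)) ∂μ) := by
  have hα0 : 0 < α := by linarith
  have hq0 : 0 < 1 / α := by positivity
  have hq1 : 1 / α < 1 := by rw [div_lt_one hα0]; exact hα
  have hK := tsallisStab_pos hq0 hq1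
  set K := tsallisStab (1 / α) with hKdef
  have hdet := isPolicy_detPolicy p
  set u := M.occ (detPolicy p) with hudef
  have hu : u ∈ M.occSet := ⟨_, hdet, rfl⟩
  have ht1 : ∀ t ∈ Finset.Icc 1 T, (1 : ℝ) ≤ t := fun t ht => by
    exact_mod_cast (Finset.mem_Icc.1 ht).1
  have hx : ∀ t ∈ Finset.Icc 1 T, ∀ ω, x t ω = M.occ (π t ω) := fun t ht ω =>
    (hA.occ_eq ht ω).symm
  -- The infinite slope of x^q at 0 makes the iterate positive wherever some occupancy measure is,
  -- so it covers the support of the comparator.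
  have hu0 : ∀ t ∈ Finset.Icc 1 T, ∀ ω s a, M.occ (π t ω) s a = 0 → u s a = 0 := by
    intro t ht ω s a h0
    have hmin := hA.isMin t ht ω
    simp only [tsallisObj_eq] at hmin
    refine M.eq_zero_of_isMinOn hq0 hq1 ?_ (hA.mem t ht ω) hmin hu (by rw [hx t ht ω, h0])
    have := ht1 t ht
    positivity
  choose! N hN1 hN2 hN3 using fun t ht => hI.exists_centred_error ht hα hσ hC
    (M.occ_nonneg hdet) (M.occ_le_one hdet) (hu0 t ht)
  choose! v hv1 hv2 using hshift
  set Q : ℕ → Ω → ℝ := fun t ω => ∑ c : S × A, W c (π t ω) *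
    M.lossEstimate α σ C t (M.occ (π t ω)) (traj t ω) (ℓ t ω) c.1 c.2 ^ 2 with hQ
  set D : ℕ → ℝ := fun t => C ^ (2 - α) * σ ^ 2 * (t : ℝ) ^ (2 / α - 1) with hD
  set E : ℕ → ℝ := fun t => C ^ (1 - α) * σ * (t : ℝ) ^ (1 / α - 1) with hE
  set cc : ℕ → ℝ := fun t => σ * (t : ℝ) ^ (1 / α) / β with hcc
  have hcpos : ∀ t ∈ Finset.Icc 1 T, 0 < cc t := fun t ht => by
    have := ht1 t ht
    simp only [hcc]
    positivity
  set G : ℕ → Ω → ℝ := fun t ω => N t ω + (2 * E t * k₀ + k₀ / β * (σ * (t : ℝ) ^ (1 / α - 1))) *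
    V (π t ω) + 2 * K / cc t * Q t ω + 2 * K / cc t * E t ^ 2 * powSum (1 / α) (M.occ (π t ω))
    with hG
  -- the pathwise bound
  have hpath : ∀ ω, ∑ t ∈ Finset.Icc 1 T,
      (M.value (π t ω) (ℓ t ω) M.s₁ - M.value (detPolicy p) (ℓ t ω) M.s₁) ≤
      ∑ t ∈ Finset.Icc 1 T, G t ω := by
    intro ω
    have h1 := hA.pathwise hα hσ hC hβ htune ω hu (fun t => v t ω)
      (fun t ht s a hpos => by
        rw [hx t ht ω] at hpos ⊢
        exact hv1 t ht ω s a hpos)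
    have h2 : ∀ t ∈ Finset.Icc 1 T,
        M.value (π t ω) (ℓ t ω) M.s₁ - M.value (detPolicy p) (ℓ t ω) M.s₁ ≤
        ∑ s, ∑ a, (x t ω s a - u s a) *
          (M.lossEstimate α σ C t (x t ω) (traj t ω) (ℓ t ω) s a -
            skipBonus α σ C t (x t ω) s a) +
        (N t ω + 2 * E t * k₀ * V (π t ω)) := by
      intro t ht
      have hρ := hI.policy t ht ω
      have h3 := hN3 t ht ω
      have h4 : 2 * ∑ s, ∑ a, max (M.occ (π t ω) s a - u s a) 0 *
          skipBonus α σ C t (M.occ (π t ω)) s a ≤ 2 * E t * k₀ * V (π t ω) := by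
        have hE0 : 0 ≤ E t := by
          have := ht1 t ht
          simp only [hE]
          positivity
        have e : ∑ s, ∑ a, max (M.occ (π t ω) s a - u s a) 0 *
            skipBonus α σ C t (M.occ (π t ω)) s a = E t *
            ∑ s, ∑ a, max (M.occ (π t ω) s a - u s a) 0 * M.occ (π t ω) s a ^ (1 / α - 1) := by
          simp only [Finset.mul_sum, skipBonus, hE]
          exact Finset.sum_congr rfl fun _ _ => Finset.sum_congr rfl fun _ _ => by ring
        rw [e]
        have := mul_le_mul_of_nonneg_left (hbonus _ hρ) hE0
        linarith
      rw [← M.pairing_occ hρ, ← M.pairing_occ hdet, ← pairing_sub_left, hx t ht ω]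
      have e : pairing (fun s a => M.occ (π t ω) s a - M.occ (detPolicy p) s a) (ℓ t ω) =
          ∑ s, ∑ a, (M.occ (π t ω) s a - u s a) *
            (M.lossEstimate α σ C t (M.occ (π t ω)) (traj t ω) (ℓ t ω) s a -
              skipBonus α σ C t (M.occ (π t ω)) s a) +
          ∑ s, ∑ a, (M.occ (π t ω) s a - u s a) * (ℓ t ω s a -
            M.lossEstimate α σ C t (M.occ (π t ω)) (traj t ω) (ℓ t ω) s a +
            skipBonus α σ C t (M.occ (π t ω)) s a) := by
        simp only [pairing, ← Finset.sum_add_distrib, hudef]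
        exact Finset.sum_congr rfl fun _ _ => Finset.sum_congr rfl fun _ _ => by ring
      rw [e]
      linarith
    refine (Finset.sum_le_sum h2).trans ?_
    rw [Finset.sum_add_distrib]
    refine (add_le_add h1 le_rfl).trans ?_
    rw [← Finset.sum_add_distrib]
    refine Finset.sum_le_sum fun t ht => ?_
    have hρ := hI.policy t ht ω
    have hc := hcpos t ht
    rw [hx t ht ω]
    have h5 : σ * (t : ℝ) ^ (1 / α) / β - σ * ((t - 1 : ℕ) : ℝ) ^ (1 / α) / β ≤
        σ / β * (t : ℝ) ^ (1 / α - 1) := by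
      have := rpow_sub_rpow_pred_le hq0 hq1.le (Finset.mem_Icc.1 ht).1
      have := mul_le_mul_of_nonneg_left this (by positivity : 0 ≤ σ / β)
      calc _ = σ / β * ((t : ℝ) ^ (1 / α) - ((t - 1 : ℕ) : ℝ) ^ (1 / α)) := by ring
        _ ≤ _ := this
    have h5' : 0 ≤ σ * (t : ℝ) ^ (1 / α) / β - σ * ((t - 1 : ℕ) : ℝ) ^ (1 / α) / β := by
      have h6 : ((t - 1 : ℕ) : ℝ) ^ (1 / α) ≤ (t : ℝ) ^ (1 / α) :=
        Real.rpow_le_rpow (by positivity) (by exact_mod_cast Nat.sub_le t 1) hq0.le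
      have : σ * ((t - 1 : ℕ) : ℝ) ^ (1 / α) / β ≤ σ * (t : ℝ) ^ (1 / α) / β := by gcongr
      linarith
    have hkV : 0 ≤ k₀ * V (π t ω) := (Finset.sum_nonneg fun s _ => Finset.sum_nonneg fun a _ =>
      mul_nonneg (le_max_right _ _) (Real.rpow_nonneg (M.occ_nonneg hρ s a) _)).trans
        (hbonus _ hρ)
    have h7 : (σ * (t : ℝ) ^ (1 / α) / β - σ * ((t - 1 : ℕ) : ℝ) ^ (1 / α) / β) *
        (powSum (1 / α) (M.occ (π t ω)) - powSum (1 / α) u) ≤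
        k₀ / β * (σ * (t : ℝ) ^ (1 / α - 1)) * V (π t ω) := by
      calc _ ≤ (σ * (t : ℝ) ^ (1 / α) / β - σ * ((t - 1 : ℕ) : ℝ) ^ (1 / α) / β) *
            (k₀ * V (π t ω)) := mul_le_mul_of_nonneg_left (hreg _ hρ) h5'
        _ ≤ σ / β * (t : ℝ) ^ (1 / α - 1) * (k₀ * V (π t ω)) :=
            mul_le_mul_of_nonneg_right h5 hkV
        _ = _ := by ring
    have h8 : K / cc t * (2 * ∑ s, ∑ a, M.occ (π t ω) s a ^ (2 - 1 / α) *
            (M.lossEstimate α σ C t (M.occ (π t ω)) (traj t ω) (ℓ t ω) s a +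
              (M.expNext (v t ω) s a - v t ω s)) ^ 2 +
            2 * (E t ^ 2 * powSum (1 / α) (M.occ (π t ω)))) ≤
        2 * K / cc t * Q t ω + 2 * K / cc t * E t ^ 2 * powSum (1 / α) (M.occ (π t ω)) := by
      calc _ ≤ K / cc t * (2 * Q t ω + 2 * (E t ^ 2 * powSum (1 / α) (M.occ (π t ω)))) := by
            refine mul_le_mul_of_nonneg_left ?_ (by positivity)
            have := hv2 t ht ω
            linarith
        _ = _ := by ring
    have h9 := add_le_add (add_le_add h8 h7) (le_refl (N t ω + 2 * E t * k₀ * V (π t ω)))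
    exact (le_of_eq (by simp only [hcc, hE, hKdef])).trans (h9.trans (le_of_eq (by
      simp only [hG]
      ring)))
  -- integrability
  have hVi : ∀ t ∈ Finset.Icc 1 T, Integrable (fun ω => V (π t ω)) μ := fun t ht =>
    hI.integrable_comp_policy ht hV hVb
  have hPi : ∀ t ∈ Finset.Icc 1 T, Integrable (fun ω => powSum (1 / α) (M.occ (π t ω))) μ :=
    fun t ht => hI.integrable_comp_policy ht (M.measurable_powSum_occ _) fun ρ hρ => by
      rw [abs_of_nonneg (powSum_nonneg (M.occ_nonneg hρ))]
      exact M.powSum_occ_le_card hρ hq0.le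
  have hQc := fun t (ht : t ∈ Finset.Icc 1 T) (c : S × A) =>
    hI.integral_weight_mul_sq_le ht hα0 hα2 hσ hC c (hW c) (hW0 c) (hB c) (hB0 c) (hBb c) (hWB c)
  have hQi : ∀ t ∈ Finset.Icc 1 T, Integrable (Q t) μ := fun t ht =>
    integrable_finsetSum _ fun c _ => (hQc t ht c).1
  have hQle : ∀ t ∈ Finset.Icc 1 T, ∫ ω, Q t ω ∂μ ≤ D t * (k₁ * ∫ ω, V (π t ω) ∂μ) := by
    intro t ht
    have hD0 : 0 ≤ D t := by
      have := ht1 t ht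
      simp only [hD]
      positivity
    calc ∫ ω, Q t ω ∂μ = ∑ c : S × A, ∫ ω, W c (π t ω) *
          M.lossEstimate α σ C t (M.occ (π t ω)) (traj t ω) (ℓ t ω) c.1 c.2 ^ 2 ∂μ :=
          integral_finsetSum _ fun c _ => (hQc t ht c).1
      _ ≤ ∑ c : S × A, D t * ∫ ω, B c (π t ω) ∂μ := Finset.sum_le_sum fun c _ => (hQc t ht c).2
      _ = D t * ∫ ω, ∑ c : S × A, B c (π t ω) ∂μ := by
          rw [← Finset.mul_sum, integral_finsetSum _ fun c _ =>
            hI.integrable_comp_policy ht (hB c) (hBb c)]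
      _ ≤ D t * ∫ ω, k₁ * V (π t ω) ∂μ := by
          refine mul_le_mul_of_nonneg_left (integral_mono (integrable_finsetSum _ fun c _ =>
            hI.integrable_comp_policy ht (hB c) (hBb c)) ((hVi t ht).const_mul _) fun ω => ?_) hD0
          exact hBV _ (hI.policy t ht ω)
      _ = _ := by rw [integral_const_mul]
  have hGi : ∀ t ∈ Finset.Icc 1 T, Integrable (G t) μ := fun t ht =>
    (((hN1 t ht).add ((hVi t ht).const_mul _)).add ((hQi t ht).const_mul _)).add
      ((hPi t ht).const_mul _)
  have hZi : Integrable (fun ω => ∑ t ∈ Finset.Icc 1 T,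
      (M.value (π t ω) (ℓ t ω) M.s₁ - M.value (detPolicy p) (ℓ t ω) M.s₁)) μ := by
    refine integrable_finsetSum _ fun t ht => ?_
    have e : ∀ ω, M.value (π t ω) (ℓ t ω) M.s₁ - M.value (detPolicy p) (ℓ t ω) M.s₁ =
        ∑ s, ∑ a, (M.occ (π t ω) s a - M.occ (detPolicy p) s a) * ℓ t ω s a := fun ω => by
      rw [← M.pairing_occ (hI.policy t ht ω), ← M.pairing_occ hdet, ← pairing_sub_left, pairing]
    simp only [e]
    exact integrable_finsetSum _ fun s _ => integrable_finsetSum _ fun a _ =>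
      hI.integrable_occ_mul_loss ht hα p s a
  calc M.regret T μ π ℓ p ≤ ∫ ω, ∑ t ∈ Finset.Icc 1 T, G t ω ∂μ :=
        integral_mono hZi (integrable_finsetSum _ hGi) hpath
    _ = ∑ t ∈ Finset.Icc 1 T, ∫ ω, G t ω ∂μ := integral_finsetSum _ hGi
    _ ≤ _ := by
        refine Finset.sum_le_sum fun t ht => ?_
        have hc := hcpos t ht
        have htp : (0 : ℝ) < t := by linarith [ht1 t ht]
        have e1 : ∫ ω, G t ω ∂μ = 0 + (2 * E t * k₀ + k₀ / β * (σ * (t : ℝ) ^ (1 / α - 1))) *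
            ∫ ω, V (π t ω) ∂μ + 2 * K / cc t * ∫ ω, Q t ω ∂μ +
            2 * K / cc t * E t ^ 2 * ∫ ω, powSum (1 / α) (M.occ (π t ω)) ∂μ := by
          set a₁ := 2 * E t * k₀ + k₀ / β * (σ * (t : ℝ) ^ (1 / α - 1))
          have i1 : Integrable (fun ω => N t ω + a₁ * V (π t ω)) μ :=
            (hN1 t ht).add ((hVi t ht).const_mul _)
          have i2 : Integrable (fun ω => N t ω + a₁ * V (π t ω) + 2 * K / cc t * Q t ω) μ :=
            i1.add ((hQi t ht).const_mul _)
          rw [show G t = fun ω => N t ω + a₁ * V (π t ω) + 2 * K / cc t * Q t ω +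
            2 * K / cc t * E t ^ 2 * powSum (1 / α) (M.occ (π t ω)) from rfl,
            integral_add i2 ((hPi t ht).const_mul _), integral_add i1 ((hQi t ht).const_mul _),
            integral_add (hN1 t ht) ((hVi t ht).const_mul _), hN2 t ht, integral_const_mul,
            integral_const_mul, integral_const_mul]
        -- The regularization grows like t^(1/α) and the second moment like t^(2/α-1), which leaves
        -- the same rate t^(1/α-1) as the penalty and the bonus.
        have e2 : 2 * K / cc t * D t = 2 * K * (β * C ^ (2 - α)) * (σ * (t : ℝ) ^ (1 / α - 1)) := by
          have : (t : ℝ) ^ (2 / α - 1) = (t : ℝ) ^ (1 / α) * (t : ℝ) ^ (1 / α - 1) := by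
            rw [← Real.rpow_add htp]
            ring_nf
          simp only [hcc, hD, this]
          have : (t : ℝ) ^ (1 / α) ≠ 0 := (Real.rpow_pos_of_pos htp _).ne'
          field_simp
        -- The squared bonus divided by the regularization has the faster rate t^(1/α-2), at most
        -- 1/t, so it is kept as a separate term.
        have e3 : 2 * K / cc t * E t ^ 2 =
            2 * K * (β * (C ^ (1 - α)) ^ 2) * (σ * (t : ℝ) ^ (1 / α - 2)) := by
          have h1 : ((t : ℝ) ^ (1 / α - 1)) ^ 2 = (t : ℝ) ^ (1 / α) * (t : ℝ) ^ (1 / α - 2) := by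
            rw [← Real.rpow_mul_natCast htp.le, ← Real.rpow_add htp]
            congr 1
            push_cast
            ring
          simp only [hcc, hE, mul_pow, h1]
          have : (t : ℝ) ^ (1 / α) ≠ 0 := (Real.rpow_pos_of_pos htp _).ne'
          field_simp
        have h9 := mul_le_mul_of_nonneg_left (hQle t ht) (by positivity : 0 ≤ 2 * K / cc t)
        rw [← mul_assoc, e2] at h9
        rw [e1, e3]
        simp only [hE]
        linarith

end LayeredMDP

/-! ### Sums over the episodes and resolution of the self-bounding inequality. -/

lemma sum_rpow_sub_one_le {q : ℝ} (hq0 : 0 < q) (hq1 : q ≤ 1) (T : ℕ) :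
    ∑ t ∈ Finset.Icc 1 T, (t : ℝ) ^ (q - 1) ≤ (T : ℝ) ^ q / q := by
  induction T with
  | zero => simp [Real.zero_rpow hq0.ne']
  | succ n ih =>
    rw [Finset.sum_Icc_succ_top (by omega)]
    have hn : (0 : ℝ) < (n + 1 : ℕ) := by positivity
    -- Bernoulli's inequality for the ratio n/(n+1); this is the tangent of the concave power at n +
    -- 1.
    have h1 : (n : ℝ) ^ q + q * ((n + 1 : ℕ) : ℝ) ^ (q - 1) ≤ ((n + 1 : ℕ) : ℝ) ^ q := by
      have hb := rpow_one_add_le_one_add_mul_self (s := -(1 / ((n + 1 : ℕ) : ℝ))) (by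
        rw [neg_le_neg_iff, div_le_one hn]; push_cast; linarith [(n.cast_nonneg : (0 : ℝ) ≤ n)])
        hq0.le hq1
      have e : (n : ℝ) = ((n + 1 : ℕ) : ℝ) * (1 + -(1 / ((n + 1 : ℕ) : ℝ))) := by
        field_simp
        push_cast
        ring
      have h0 : 0 ≤ 1 + -(1 / ((n + 1 : ℕ) : ℝ)) := by
        by_contra h
        push Not at h
        have : (n : ℝ) < 0 := by rw [e]; exact mul_neg_of_pos_of_neg hn h
        linarith [(n.cast_nonneg : (0 : ℝ) ≤ n)]
      have h2 : (n : ℝ) ^ q = ((n + 1 : ℕ) : ℝ) ^ q * (1 + -(1 / ((n + 1 : ℕ) : ℝ))) ^ q := by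
        conv_lhs => rw [e]
        rw [Real.mul_rpow hn.le h0]
      have h3 := mul_le_mul_of_nonneg_left hb (Real.rpow_nonneg hn.le q)
      rw [← h2] at h3
      have h4 : ((n + 1 : ℕ) : ℝ) ^ q * (1 + q * -(1 / ((n + 1 : ℕ) : ℝ))) =
          ((n + 1 : ℕ) : ℝ) ^ q - q * ((n + 1 : ℕ) : ℝ) ^ (q - 1) := by
        rw [Real.rpow_sub_one hn.ne']
        ring
      linarith
    rw [le_div_iff₀ hq0] at ih ⊢
    linarith

/-- The harmonic sum is at most 1 + log T, and 1 ≤ 2 log 2 ≤ 2 log T absorbs the constant; this is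
where T ≥ 2 is used. -/
lemma sum_inv_le_three_mul_log {T : ℕ} (hT : 2 ≤ T) :
    ∑ t ∈ Finset.Icc 1 T, (t : ℝ)⁻¹ ≤ 3 * Real.log T := by
  have h := harmonic_le_one_add_log T
  rw [harmonic_eq_sum_Icc] at h
  push_cast at h
  have h2 : Real.log 2 ≤ Real.log T := Real.log_le_log (by norm_num) (by exact_mod_cast hT)
  linarith [Real.log_two_gt_d9]

/-- Weighted Young inequality for the conjugate exponents `α` and `α / (α - 1)`. -/
lemma mul_rpow_le_add_of_conj {α σ t x δ : ℝ} (hα : 1 < α) (hσ : 0 < σ) (ht : 0 < t)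
    (hx : 0 ≤ x) (hδ : 0 < δ) :
    σ * t ^ (1 / α - 1) * x ^ (1 / α) ≤
      δ * x + δ ^ (-(1 / (α - 1))) * σ ^ (α / (α - 1)) * t⁻¹ := by
  have hα0 : 0 < α := by linarith
  have ha : 0 < α - 1 := by linarith
  have hq0 : 0 < 1 / α := by positivity
  have hq1 : 0 ≤ 1 - 1 / α := by
    rw [sub_nonneg, div_le_one hα0]; exact hα.le
  have hδt := Real.rpow_pos_of_pos hδ (-(1 / (α - 1)))
  have hσt := Real.rpow_pos_of_pos hσ (α / (α - 1))
  have h := Real.geom_mean_le_arith_mean2_weighted (p₁ := δ * x)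
    (p₂ := δ ^ (-(1 / (α - 1))) * σ ^ (α / (α - 1)) * t⁻¹) hq0.le hq1 (by positivity)
    (by positivity) (by ring)
  have e1 : (δ ^ (-(1 / (α - 1))) * σ ^ (α / (α - 1)) * t⁻¹) ^ (1 - 1 / α) =
      δ ^ (-(1 / α)) * σ * t ^ (1 / α - 1) := by
    rw [Real.mul_rpow (by positivity) (by positivity), Real.mul_rpow hδt.le hσt.le,
      ← Real.rpow_mul hδ.le, ← Real.rpow_mul hσ.le, Real.inv_rpow ht.le, ← Real.rpow_neg ht.le]
    have h1 : -(1 / (α - 1)) * (1 - 1 / α) = -(1 / α) := by field_simp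
    have h2 : α / (α - 1) * (1 - 1 / α) = 1 := by field_simp
    rw [h1, h2, Real.rpow_one, neg_sub]
  rw [e1, Real.mul_rpow hδ.le hx] at h
  have e2 : δ ^ (1 / α) * x ^ (1 / α) * (δ ^ (-(1 / α)) * σ * t ^ (1 / α - 1)) =
      σ * t ^ (1 / α - 1) * x ^ (1 / α) := by
    rw [Real.rpow_neg hδ.le]
    have := (Real.rpow_pos_of_pos hδ (1 / α)).ne'
    field_simp
  rw [e2] at h
  have h3 : 0 ≤ δ * x := by positivity
  have h4 : 0 ≤ δ ^ (-(1 / (α - 1))) * σ ^ (α / (α - 1)) * t⁻¹ := by positivity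
  refine h.trans (add_le_add ?_ ?_)
  · exact mul_le_of_le_one_left h3 (by linarith)
  · exact mul_le_of_le_one_left h4 (by linarith)

/-- Resolution of a self-bounding inequality. -/
lemma le_of_forall_self_bounding {α r Q c w l : ℝ} (hα : 1 < α) (hQ : 1 ≤ Q) (hc : 0 ≤ c)
    (hw : 0 ≤ w) (hl : 0 ≤ l)
    (h : ∀ lam : ℝ, 0 < lam → r ≤ Q * (lam * (r + c) + lam ^ (-(1 / (α - 1))) * w + l)) :
    r ≤ 2 * (2 * Q) ^ (α / (α - 1)) * (w + c ^ (1 / α) * w ^ ((α - 1) / α) + l) := by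
  have hα0 : 0 < α := by linarith
  have ha : 0 < α - 1 := by linarith
  have hs0 : 0 < 1 / (α - 1) := by positivity
  have hQ2 : 0 < 2 * Q := by linarith
  have hq : (α - 1) / α = 1 - 1 / α := by field_simp
  set P := (2 * Q) ^ (α / (α - 1)) with hP
  have hPe : P = 2 * Q * (2 * Q) ^ (1 / (α - 1)) := by
    rw [hP, ← Real.rpow_one_add' hQ2.le (by positivity)]
    congr 1
    field_simp
    ring
  have hP1 : 2 * Q ≤ P := by
    rw [hPe]
    exact le_mul_of_one_le_right hQ2.le (Real.one_le_rpow (by linarith) hs0.le)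
  have hcw : 0 ≤ c ^ (1 / α) * w ^ ((α - 1) / α) := by positivity
  have hP0 : 0 < P := by linarith
  rcases le_or_gt r 0 with hr | hr
  · exact hr.trans (by positivity)
  -- absorbing `r`
  have habs : ∀ m : ℝ, 0 < m → m ≤ 1 →
      r ≤ m * c + P * (m ^ (-(1 / (α - 1))) * w) + 2 * Q * l := by
    intro m hm hm1
    have h1 := h (m / (2 * Q)) (by positivity)
    have h2 : (m / (2 * Q)) ^ (-(1 / (α - 1))) =
        m ^ (-(1 / (α - 1))) * (2 * Q) ^ (1 / (α - 1)) := by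
      rw [Real.div_rpow hm.le hQ2.le, Real.rpow_neg hQ2.le, div_inv_eq_mul]
    rw [h2] at h1
    have h3 : Q * (m / (2 * Q) * (r + c) +
        m ^ (-(1 / (α - 1))) * (2 * Q) ^ (1 / (α - 1)) * w + l) =
        m * r / 2 + m * c / 2 + P * (m ^ (-(1 / (α - 1))) * w) / 2 + Q * l := by
      rw [hPe]
      field_simp
    rw [h3] at h1
    have : m * r ≤ r := mul_le_of_le_one_left hr.le hm1
    linarith
  rcases hw.eq_or_lt with hw0 | hw0
  -- If w = 0 nothing penalizes small `m`; let it tend to 0.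
  · have h1 : r ≤ 2 * Q * l := by
      refine le_of_forall_pos_le_add fun ε hε => ?_
      have hm : 0 < min 1 (ε / (c + 1)) := by positivity
      have h2 := habs _ hm (min_le_left _ _)
      rw [← hw0, mul_zero, mul_zero, add_zero] at h2
      have h3 : min 1 (ε / (c + 1)) * c ≤ ε / (c + 1) * (c + 1) :=
        mul_le_mul (min_le_right _ _) (by linarith) hc (by positivity)
      rw [div_mul_cancel₀ _ (by linarith)] at h3
      linarith
    have h2 : 2 * Q * l ≤ P * l := mul_le_mul_of_nonneg_right hP1 hl
    nlinarith [mul_nonneg hP0.le hw, mul_nonneg hP0.le hcw, mul_nonneg hP0.le hl]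
  have h2 : 2 * Q * l ≤ P * l := mul_le_mul_of_nonneg_right hP1 hl
  have hPw : 0 ≤ P * w := by positivity
  have hPcw : 0 ≤ P * (c ^ (1 / α) * w ^ ((α - 1) / α)) := by positivity
  have hPl : 0 ≤ P * l := by positivity
  have hPcw1 : c ^ (1 / α) * w ^ ((α - 1) / α) ≤ P * (c ^ (1 / α) * w ^ ((α - 1) / α)) :=
    le_mul_of_one_le_left hcw (by linarith)
  rcases le_or_gt c w with hcw' | hcw'
  -- For c ≤ w no balancing is needed, since c is already below the mixed term.
  · have h1 := habs 1 one_pos le_rfl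
    rw [Real.one_rpow] at h1
    have h3 : c ≤ c ^ (1 / α) * w ^ ((α - 1) / α) := by
      calc c = c ^ (1 / α) * c ^ ((α - 1) / α) := by
            rw [← Real.rpow_add_of_nonneg hc (by positivity) (by positivity), hq]
            simp
        _ ≤ _ := by gcongr
    linarith
  · have hc0 : 0 < c := hw0.trans hcw'
    have hwc : w / c ≤ 1 := by rw [div_le_one hc0]; exact hcw'.le
    -- This `m` balances the two terms: each becomes c^(1/α) w^((α-1)/α). It is at most 1 because w
    -- < c.
    have h1 := habs ((w / c) ^ ((α - 1) / α)) (by positivity)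
      (Real.rpow_le_one (by positivity) hwc (by positivity))
    have e1 : (w / c) ^ ((α - 1) / α) * c = c ^ (1 / α) * w ^ ((α - 1) / α) := by
      rw [Real.div_rpow hw hc, hq, Real.rpow_sub hc0, Real.rpow_one]
      have := (Real.rpow_pos_of_pos hc0 (1 / α)).ne'
      field_simp
    have e2 : ((w / c) ^ ((α - 1) / α)) ^ (-(1 / (α - 1))) * w =
        c ^ (1 / α) * w ^ ((α - 1) / α) := by
      rw [← Real.rpow_mul (by positivity)]
      have : (α - 1) / α * -(1 / (α - 1)) = -(1 / α) := by field_simp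
      rw [this, Real.div_rpow hw hc, hq, Real.rpow_neg hw, Real.rpow_neg hc, Real.rpow_sub hw0,
        Real.rpow_one]
      have := (Real.rpow_pos_of_pos hc0 (1 / α)).ne'
      have := (Real.rpow_pos_of_pos hw0 (1 / α)).ne'
      field_simp
    rw [e1, e2] at h1
    linarith

/-! ### The tuning constants. -/

namespace LayeredMDP

variable {S A : Type*} [Fintype S] [DecidableEq S] [Fintype A] [DecidableEq A]

lemma one_le_tuningR (α : ℝ) (H S A : ℕ) : 1 ≤ tuningR α H S A := by
  have h1 : 0 ≤ (H : ℝ) * S * A := by positivity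
  have h2 : 0 ≤ (H : ℝ) * S * (A : ℝ) ^ (2 - 1 / α) := by positivity
  rw [tuningR]
  linarith

lemma tuningR_le {α : ℝ} (hα : 1 < α) {H S A : ℕ} (hH : 1 ≤ H) (hS : 1 ≤ S) (hA : 1 ≤ A) :
    tuningR α H S A ≤ 3 * ((H : ℝ) * S * (A : ℝ) ^ (2 - 1 / α)) := by
  have hα0 : 0 < α := by linarith
  have hq1 : 1 / α ≤ 1 := by rw [div_le_one hα0]; exact hα.le
  have hH' : (1 : ℝ) ≤ H := by exact_mod_cast hH
  have hS' : (1 : ℝ) ≤ S := by exact_mod_cast hS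
  have hA' : (1 : ℝ) ≤ A := by exact_mod_cast hA
  have h1 : (A : ℝ) ≤ (A : ℝ) ^ (2 - 1 / α) := Real.self_le_rpow_of_one_le hA' (by linarith)
  have hHS : (1 : ℝ) ≤ H * S := one_le_mul_of_one_le_of_one_le hH' hS'
  have h2 : (H : ℝ) * S * A ≤ H * S * (A : ℝ) ^ (2 - 1 / α) := by gcongr
  have h3 : (1 : ℝ) ≤ H * S * A := one_le_mul_of_one_le_of_one_le hHS hA'
  rw [tuningR]
  linarith

/-- A shifted estimate is a sum of SA terms, each at most twice the size of an unshifted one; this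
makes R large enough for the stability condition. -/
lemma two_mul_le_tuningR {α : ℝ} (hα : 1 < α) {H S A : ℕ} (hH : 1 ≤ H) (hA : 1 ≤ A) :
    2 * ((S : ℝ) * A) ≤ tuningR α H S A := by
  have hα0 : 0 < α := by linarith
  have hq1 : 1 / α ≤ 1 := by rw [div_le_one hα0]; exact hα.le
  have hH' : (1 : ℝ) ≤ H := by exact_mod_cast hH
  have hA' : (1 : ℝ) ≤ A := by exact_mod_cast hA
  have h1 : (A : ℝ) ≤ (A : ℝ) ^ (2 - 1 / α) := Real.self_le_rpow_of_one_le hA' (by linarith)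
  have h2 : (H : ℝ) * S * A ≤ H * S * (A : ℝ) ^ (2 - 1 / α) := by gcongr
  have h3 : 1 * ((S : ℝ) * A) ≤ H * (S * A) := by gcongr
  rw [tuningR]
  linarith

lemma tuningC_pos {α : ℝ} (hα : 1 < α) (H S A : ℕ) : 0 < tuningC α H S A := by
  have := one_le_tuningR α H S A
  have : 0 < α - 1 := by linarith
  unfold tuningC
  positivity

lemma tuningBeta_pos {α : ℝ} (hα : 1 < α) (H S A : ℕ) : 0 < tuningBeta α H S A := by
  have := one_le_tuningR α H S A
  have : 0 < α - 1 := by linarith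
  unfold tuningBeta
  positivity

lemma tuningC_rpow {α : ℝ} (hα : 1 < α) (H S A : ℕ) :
    tuningC α H S A ^ (1 - α) =
      (α - 1) ^ (1 / α - 1) * tuningR α H S A ^ (1 - 1 / α) := by
  have hR := one_le_tuningR α H S A
  have ha : 0 < α - 1 := by linarith
  have hα0 : 0 < α := by linarith
  rw [tuningC, ← Real.rpow_mul (by positivity), Real.div_rpow (by linarith) ha.le]
  have e : -(1 / α) * (1 - α) = 1 - 1 / α := by
    field_simp
    ring
  rw [e, div_eq_mul_inv, ← Real.rpow_neg ha.le, neg_sub, mul_comm]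

lemma tuningR_mul_tuningC {α : ℝ} (hα : 1 < α) (H S A : ℕ) :
    tuningR α H S A * tuningC α H S A =
      (α - 1) ^ (1 / α) * tuningR α H S A ^ (1 - 1 / α) := by
  have hR := one_le_tuningR α H S A
  have ha : 0 < α - 1 := by linarith
  have hR0 : 0 < tuningR α H S A := by linarith
  rw [tuningC, Real.div_rpow hR0.le ha.le, Real.rpow_neg ha.le, Real.rpow_neg hR0.le,
    Real.rpow_sub hR0, Real.rpow_one]
  have := (Real.rpow_pos_of_pos hR0 (1 / α)).ne'
  have := (Real.rpow_pos_of_pos ha (1 / α)).ne'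
  field_simp

/-- R C and C^(1-α) are (α-1) and 1 times the common factor (α-1)^(1/α-1) R^(1-1/α). Their sum is α
times this factor, which β inverts up to q(1-q)/4 with q = 1/α. -/
lemma tuning_identity {α : ℝ} (hα : 1 < α) (H S A : ℕ) :
    tuningBeta α H S A * (tuningR α H S A * tuningC α H S A + tuningC α H S A ^ (1 - α)) =
      1 / α * (1 - 1 / α) / 4 := by
  have hR := one_le_tuningR α H S A
  have ha : 0 < α - 1 := by linarith
  have hα0 : 0 < α := by linarith
  have hR0 : 0 < tuningR α H S A := by linarith
  rw [tuningC_rpow hα, tuningR_mul_tuningC hα, tuningBeta, Real.rpow_sub ha, Real.rpow_sub ha,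
    Real.rpow_sub hR0, Real.rpow_sub hR0, Real.rpow_one, Real.rpow_one]
  have h1 := (Real.rpow_pos_of_pos hR0 (1 / α)).ne'
  have h2 := (Real.rpow_pos_of_pos ha (1 / α)).ne'
  field_simp
  ring

lemma inv_tuningBeta {α : ℝ} (hα : 1 < α) (H S A : ℕ) :
    1 / tuningBeta α H S A =
      4 * α ^ 3 / (α - 1) * ((α - 1) ^ (1 / α - 1) * tuningR α H S A ^ (1 - 1 / α)) := by
  have hR := one_le_tuningR α H S A
  have ha : 0 < α - 1 := by linarith
  have hα0 : 0 < α := by linarith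
  have hR0 : 0 < tuningR α H S A := by linarith
  rw [tuningBeta, Real.rpow_sub ha, Real.rpow_sub ha,
    Real.rpow_sub hR0, Real.rpow_sub hR0, Real.rpow_one, Real.rpow_one]
  have h1 := (Real.rpow_pos_of_pos hR0 (1 / α)).ne'
  have h2 := (Real.rpow_pos_of_pos ha (1 / α)).ne'
  field_simp

/-- All coefficients of the regret bound are of the order of `R ^ (1 - 1 / α)`. -/
lemma exists_tuning_const {α : ℝ} (hα : 1 < α) : ∃ k : ℝ, 0 < k ∧ ∀ H S A : ℕ,
    tuningC α H S A ^ (1 - α) ≤ k * tuningR α H S A ^ (1 - 1 / α) ∧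
    1 / tuningBeta α H S A ≤ k * tuningR α H S A ^ (1 - 1 / α) ∧
    tuningBeta α H S A * tuningC α H S A ^ (2 - α) ≤ k * tuningR α H S A ^ (1 - 1 / α) ∧
    tuningBeta α H S A * (tuningC α H S A ^ (1 - α)) ^ 2 ≤
      k * tuningR α H S A ^ (1 - 1 / α) := by
  have ha : 0 < α - 1 := by linarith
  have hα0 : 0 < α := by linarith
  have hc := Real.rpow_pos_of_pos ha (1 / α - 1)
  set c := (α - 1) ^ (1 / α - 1) with hcdef
  have hd : 0 < 4 * α ^ 3 / (α - 1) := by positivity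
  refine ⟨c * (1 + 4 * α ^ 3 / (α - 1)), by positivity, fun H S A => ?_⟩
  have hR := one_le_tuningR α H S A
  have hC := tuningC_pos hα H S A
  have hβ := tuningBeta_pos hα H S A
  have hid := tuning_identity hα H S A
  have hCr := tuningC_rpow hα H S A
  have hβi := inv_tuningBeta hα H S A
  set R := tuningR α H S A
  set C := tuningC α H S A
  set β := tuningBeta α H S A
  rw [← hcdef] at hCr hβi
  have hRp : 0 < R ^ (1 - 1 / α) := Real.rpow_pos_of_pos (by linarith) _
  have hCp : 0 < C ^ (1 - α) := Real.rpow_pos_of_pos hC _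
  have hle : 1 / α * (1 - 1 / α) / 4 ≤ 1 := by nlinarith [sq_nonneg (1 / α - 1 / 2)]
  have hCk : C ^ (1 - α) ≤ c * (1 + 4 * α ^ 3 / (α - 1)) * R ^ (1 - 1 / α) := by
    rw [hCr]
    nlinarith [mul_pos (mul_pos hc hd) hRp]
  have h1 : C ≤ R * C := le_mul_of_one_le_left hC.le hR
  -- The tuning identity bounds β C and β C^(1-α) by 1, so both products with β reduce to C^(1-α).
  have h2 : β * C ≤ 1 := by nlinarith [mul_pos hβ hCp]
  have h3 : β * C ^ (1 - α) ≤ 1 := by nlinarith [mul_pos hβ hC]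
  refine ⟨hCk, ?_, ?_, ?_⟩
  · rw [hβi]
    nlinarith [mul_pos hc hRp]
  · have e : C ^ (2 - α) = C * C ^ (1 - α) := by
      rw [show 2 - α = 1 + (1 - α) by ring, Real.rpow_add hC, Real.rpow_one]
    rw [e, ← mul_assoc]
    exact (mul_le_of_le_one_left hCp.le h2).trans hCk
  · rw [sq, ← mul_assoc]
    exact (mul_le_of_le_one_left hCp.le h3).trans hCk

end LayeredMDP

/-! ### The two choices of shift and potential. -/

namespace LayeredMDP

variable {S A : Type*} [Fintype S] [DecidableEq S] [Fintype A] [DecidableEq A]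

lemma one_le_H (M : LayeredMDP S A) : 1 ≤ M.H := (Nat.zero_le _).trans_lt (M.layer_lt M.s₁)

lemma offSum_le_powSum (p : S → A) {q : ℝ} {x : S → A → ℝ} (hx : ∀ s a, 0 ≤ x s a) :
    offSum p (fun s a => x s a ^ q) ≤ powSum q x :=
  Finset.sum_le_sum fun s _ => Finset.sum_le_sum fun a _ => by
    split_ifs
    · exact Real.rpow_nonneg (hx s a) _
    · exact le_rfl

lemma measurable_offSum_occ (M : LayeredMDP S A) (p : S → A) (q : ℝ) :
    Measurable fun ρ : S → A → ℝ => offSum p (fun s a => M.occ ρ s a ^ q) :=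
  Finset.measurable_fun_sum _ fun s _ => Finset.measurable_fun_sum _ fun a _ => by
    split_ifs
    · exact measurable_const
    · exact (M.measurable_occ (pol := fun ρ => ρ) (fun s a => by fun_prop) s a).pow_const _

/-- Shifted by the value function of the current policy, the loss estimates stay small. -/
lemma abs_shifted_lossEstimate_le (M : LayeredMDP S A) {α σ C R : ℝ} (hα : 1 < α) (hσ : 0 < σ)
    (hC : 0 < C) (hR : 2 * ((Fintype.card S : ℝ) * Fintype.card A) ≤ R) {ρ : S → A → ℝ}
    (hρ : IsPolicy ρ) (t : ℕ) (τ : M.Traj) (ℓ : S → A → ℝ) {s : S} {a : A}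
    (hs : 0 < M.occ ρ s a) :
    |M.lossEstimate α σ C t (M.occ ρ) τ ℓ s a +
      (M.expNext (M.value ρ (M.lossEstimate α σ C t (M.occ ρ) τ ℓ)) s a -
        M.value ρ (M.lossEstimate α σ C t (M.occ ρ) τ ℓ) s)| ≤
      R * C * σ * (t : ℝ) ^ (1 / α) * M.occ ρ s a ^ (1 / α - 1) := by
  have hα0 : 0 < α := by linarith
  have hq0 : 0 < 1 / α := by positivity
  have hq1 : 1 / α ≤ 1 := by rw [div_le_one hα0]; exact hα.le
  rw [M.add_expNext_sub_value]
  have hX := Real.rpow_nonneg (M.occ_nonneg hρ s a) (1 / α - 1)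
  have hterm : ∀ c : S × A,
      |M.lossEstimate α σ C t (M.occ ρ) τ ℓ c.1 c.2 * M.unitAdv ρ c s a| ≤
      C * σ * (t : ℝ) ^ (1 / α) * (2 * M.occ ρ s a ^ (1 / α - 1)) := by
    intro c
    rcases (M.occ_nonneg hρ c.1 c.2).eq_or_lt with h0 | hc
    · rw [M.lossEstimate_eq_zero _ _ _ _ _ _ h0.symm, zero_mul, abs_zero]
      positivity
    · rw [abs_mul]
      calc _ ≤ C * σ * (t : ℝ) ^ (1 / α) * M.occ ρ c.1 c.2 ^ (1 / α - 1) *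
            |M.unitAdv ρ c s a| :=
            mul_le_mul_of_nonneg_right (M.abs_lossEstimate_le hσ.le hC.le t _ _ hc)
              (abs_nonneg _)
        _ = C * σ * (t : ℝ) ^ (1 / α) *
            (|M.unitAdv ρ c s a| * M.occ ρ c.1 c.2 ^ (1 / α - 1)) := by ring
        _ ≤ _ := mul_le_mul_of_nonneg_left (M.abs_unitAdv_mul_rpow_le hρ hc hs hq0 hq1)
            (by positivity)
  refine (Finset.abs_sum_le_sum_abs _ _).trans ((Finset.sum_le_sum fun c _ => hterm c).trans ?_)
  rw [Finset.sum_const, Finset.card_univ, nsmul_eq_mul, Fintype.card_prod, Nat.cast_mul]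
  calc _ = 2 * ((Fintype.card S : ℝ) * Fintype.card A) *
        (C * σ * (t : ℝ) ^ (1 / α) * M.occ ρ s a ^ (1 / α - 1)) := by ring
    _ ≤ R * (C * σ * (t : ℝ) ^ (1 / α) * M.occ ρ s a ^ (1 / α - 1)) :=
        mul_le_mul_of_nonneg_right hR (by positivity)
    _ = _ := by ring

/-- The shifted loss is a combination of SA advantages of unit losses; Cauchy–Schwarz separates them
at cost SA, leaving weights that depend only on the policy. -/
lemma sum_shifted_sq_le (M : LayeredMDP S A) {ρ : S → A → ℝ} (hρ : IsPolicy ρ)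
    (l : S → A → ℝ) (r : ℝ) :
    ∑ s, ∑ a, M.occ ρ s a ^ r * (l s a + (M.expNext (M.value ρ l) s a - M.value ρ l s)) ^ 2 ≤
      ∑ c : S × A, ((Fintype.card S : ℝ) * Fintype.card A *
        ∑ s, ∑ a, M.occ ρ s a ^ r * M.unitAdv ρ c s a ^ 2) * l c.1 c.2 ^ 2 := by
  have hcard : (Fintype.card (S × A) : ℝ) = (Fintype.card S : ℝ) * Fintype.card A := by simp
  calc _ = ∑ s, ∑ a, M.occ ρ s a ^ r * (∑ c : S × A, l c.1 c.2 * M.unitAdv ρ c s a) ^ 2 := by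
        simp only [M.add_expNext_sub_value]
    _ ≤ ∑ s, ∑ a, M.occ ρ s a ^ r * ((Fintype.card S : ℝ) * Fintype.card A *
          ∑ c : S × A, (l c.1 c.2 * M.unitAdv ρ c s a) ^ 2) := by
        refine Finset.sum_le_sum fun s _ => Finset.sum_le_sum fun a _ =>
          mul_le_mul_of_nonneg_left ?_ (Real.rpow_nonneg (M.occ_nonneg hρ _ _) _)
        rw [← hcard]
        exact sq_sum_le_card_mul_sum_sq
    _ = ∑ s, ∑ a, ∑ c : S × A, (Fintype.card S : ℝ) * Fintype.card A *
          (M.occ ρ s a ^ r * M.unitAdv ρ c s a ^ 2) * l c.1 c.2 ^ 2 := by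
        refine Finset.sum_congr rfl fun s _ => Finset.sum_congr rfl fun a _ => ?_
        rw [Finset.mul_sum, Finset.mul_sum]
        exact Finset.sum_congr rfl fun c _ => by ring
    _ = ∑ c : S × A, ∑ s, ∑ a, (Fintype.card S : ℝ) * Fintype.card A *
          (M.occ ρ s a ^ r * M.unitAdv ρ c s a ^ 2) * l c.1 c.2 ^ 2 := by
        rw [Finset.sum_comm (s := (Finset.univ : Finset (S × A)))]
        exact Finset.sum_congr rfl fun s _ => Finset.sum_comm
    _ = _ := by simp only [Finset.mul_sum, Finset.sum_mul]

section Interaction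

variable {M : LayeredMDP S A} [Nonempty A] {α σ : ℝ} {T : ℕ}
  {Ω : Type*} {mΩ : MeasurableSpace Ω} {μ : Measure Ω} [IsProbabilityMeasure μ]
  {ℱ : Filtration ℕ mΩ} {ν : ℕ → Ω → Measure (S → A → ℝ)}
  {x π : ℕ → Ω → S → A → ℝ} {traj : ℕ → Ω → M.Traj} {ℓ : ℕ → Ω → S → A → ℝ}

/-- The regret in terms of the Tsallis potential of the learner's occupancy measure. -/
lemma regret_le_sum_powSum {C β R : ℝ}
    (hI : M.IsInteraction α σ T μ ℱ ν π traj ℓ) (hA : M.IsHTFTRLOM α σ C β T x π traj ℓ)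
    (hα : 1 < α) (hα2 : α ≤ 2) (hσ : 0 < σ) (hC : 0 < C) (hβ : 0 < β) (hR : 1 ≤ R)
    (htune : β * (R * C + C ^ (1 - α)) ≤ 1 / α * (1 - 1 / α) / 4) (p : S → A) :
    M.regret T μ π ℓ p ≤ ∑ t ∈ Finset.Icc 1 T,
      ((2 * C ^ (1 - α) * 1 + 1 / β + 2 * tsallisStab (1 / α) * (β * C ^ (2 - α)) * 1) *
          (σ * (t : ℝ) ^ (1 / α - 1)) * ∫ ω, powSum (1 / α) (M.occ (π t ω)) ∂μ +
        2 * tsallisStab (1 / α) * (β * (C ^ (1 - α)) ^ 2) * (σ * (t : ℝ) ^ (1 / α - 2)) *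
          ∫ ω, powSum (1 / α) (M.occ (π t ω)) ∂μ) := by
  have hα0 : 0 < α := by linarith
  have hq0 : 0 < 1 / α := by positivity
  have hq1 : 1 / α ≤ 1 := by rw [div_le_one hα0]; exact hα.le
  have hocc : ∀ s a, Measurable fun ρ : S → A → ℝ => M.occ ρ s a := fun s a =>
    M.measurable_occ (pol := fun ρ => ρ) (fun s a => by fun_prop) s a
  have hA1 : (1 : ℝ) ≤ Fintype.card A := by exact_mod_cast Fintype.card_pos
  have : Nonempty S := ⟨M.s₁⟩
  have hS1 : (1 : ℝ) ≤ Fintype.card S := by exact_mod_cast Fintype.card_pos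
  have hSA : (1 : ℝ) ≤ Fintype.card S * Fintype.card A := one_le_mul_of_one_le_of_one_le hS1 hA1
  -- Without a shift the weight at a pair is x^(2-q), and x^(2-q) x^(2q-2) = x^q with q = 1/α sums
  -- to the potential.
  refine M.regret_le_sum (R := R) (V := fun ρ => powSum (1 / α) (M.occ ρ))
    (W := fun c ρ => M.occ ρ c.1 c.2 ^ (2 - 1 / α)) (B := fun c ρ => M.occ ρ c.1 c.2 ^ (1 / α))
    (b := Fintype.card S * Fintype.card A) hI hA hα hα2 hσ hC hβ htune p
    (fun c => (hocc _ _).pow_const _)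
    (fun c ρ hρ => Real.rpow_nonneg (M.occ_nonneg hρ _ _) _) (fun c => (hocc _ _).pow_const _)
    (fun c ρ hρ => Real.rpow_nonneg (M.occ_nonneg hρ _ _) _) (fun c ρ hρ => ?_)
    (M.measurable_powSum_occ _) (fun ρ hρ => ?_) (fun c ρ hρ hc => ?_) (fun ρ hρ => ?_)
    (fun ρ hρ => ?_) (fun ρ hρ => ?_) (fun t ht ω => ⟨fun _ => 0, fun s a hs => ?_, ?_⟩)
  · rw [abs_of_nonneg (Real.rpow_nonneg (M.occ_nonneg hρ _ _) _)]
    exact (Real.rpow_le_one (M.occ_nonneg hρ _ _) (M.occ_le_one hρ _ _) hq0.le).trans hSA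
  · rw [abs_of_nonneg (powSum_nonneg (M.occ_nonneg hρ))]
    exact M.powSum_occ_le_card hρ hq0.le
  · rw [← Real.rpow_add hc]
    exact le_of_eq (by ring_nf)
  · rw [one_mul, Fintype.sum_prod_type, powSum]
  · rw [one_mul]
    exact M.sum_max_mul_rpow_le_powSum hρ p hq0 hq1
  · have := powSum_nonneg (q := 1 / α) (M.occ_nonneg (isPolicy_detPolicy p))
    linarith
  · have h := M.abs_lossEstimate_le hσ.le hC.le (α := α) t (traj t ω) (ℓ t ω) hs
    have h0 : M.expNext (fun _ => 0) s a = 0 := by simp [expNext]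
    rw [h0, sub_zero, add_zero]
    refine h.trans ?_
    have hX := Real.rpow_nonneg (M.occ_nonneg (hI.policy t ht ω) s a) (1 / α - 1)
    have : C ≤ R * C := le_mul_of_one_le_left hC.le hR
    gcongr
  · have h0 : ∀ s a, M.expNext (fun _ => 0) s a = 0 := fun s a => by simp [expNext]
    simp only [h0, sub_zero, add_zero, Fintype.sum_prod_type]
    exact le_rfl

/-- The regret in terms of the Tsallis potential of the occupancies of the actions that `p` does
not take. -/
lemma regret_le_sum_offSum {C β R : ℝ}
    (hI : M.IsInteraction α σ T μ ℱ ν π traj ℓ) (hA : M.IsHTFTRLOM α σ C β T x π traj ℓ)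
    (hα : 1 < α) (hα2 : α ≤ 2) (hσ : 0 < σ) (hC : 0 < C) (hβ : 0 < β)
    (hR : 2 * ((Fintype.card S : ℝ) * Fintype.card A) ≤ R)
    (htune : β * (R * C + C ^ (1 - α)) ≤ 1 / α * (1 - 1 / α) / 4) (p : S → A) :
    M.regret T μ π ℓ p ≤ ∑ t ∈ Finset.Icc 1 T,
      ((2 * C ^ (1 - α) * (1 + Fintype.card S) + (1 + Fintype.card S) / β +
          2 * tsallisStab (1 / α) * (β * C ^ (2 - α)) *
            (8 * Fintype.card A * (Fintype.card S * Fintype.card A) ^ 2)) *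
          (σ * (t : ℝ) ^ (1 / α - 1)) *
          ∫ ω, offSum p (fun s a => M.occ (π t ω) s a ^ (1 / α)) ∂μ +
        2 * tsallisStab (1 / α) * (β * (C ^ (1 - α)) ^ 2) * (σ * (t : ℝ) ^ (1 / α - 2)) *
          ∫ ω, powSum (1 / α) (M.occ (π t ω)) ∂μ) := by
  have hα0 : 0 < α := by linarith
  have hq0 : 0 < 1 / α := by positivity
  have hq1 : 1 / α ≤ 1 := by rw [div_le_one hα0]; exact hα.le
  have hid : ∀ s a, Measurable fun ρ : S → A → ℝ => ρ s a := fun s a => by fun_prop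
  have hocc : ∀ s a, Measurable fun ρ : S → A → ℝ => M.occ ρ s a := fun s a =>
    M.measurable_occ (pol := fun ρ => ρ) hid s a
  set n : ℝ := Fintype.card S * Fintype.card A with hn
  have hn0 : 0 ≤ n := by positivity
  have hΦ0 : ∀ ρ, IsPolicy ρ → 0 ≤ offSum p (fun s a => M.occ ρ s a ^ (1 / α)) := fun ρ hρ =>
    offSum_nonneg p fun s a => Real.rpow_nonneg (M.occ_nonneg hρ _ _) _
  have hΦ1 : ∀ ρ, IsPolicy ρ → offSum p (fun s a => M.occ ρ s a ^ (1 / α)) ≤ n := fun ρ hρ =>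
    (offSum_le_powSum p (M.occ_nonneg hρ)).trans (M.powSum_occ_le_card hρ hq0.le)
  have hcard : (Fintype.card (S × A) : ℝ) = n := by simp [hn]
  set V : (S → A → ℝ) → ℝ := fun ρ => offSum p (fun s a => M.occ ρ s a ^ (1 / α)) with hV
  -- The weights come from the shift by the value function of the loss estimate itself. After
  -- multiplication by x(c)^(2/α-2) their bound `B` no longer depends on `c`, so the sum over `c`
  -- costs a second factor SA.
  set W : S × A → (S → A → ℝ) → ℝ := fun c ρ =>
    n * ∑ s, ∑ a, M.occ ρ s a ^ (2 - 1 / α) * M.unitAdv ρ c s a ^ 2 with hW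
  set B : S × A → (S → A → ℝ) → ℝ := fun _ ρ => n * (8 * Fintype.card A * V ρ) with hB
  have hVm : Measurable V := M.measurable_offSum_occ p _
  have hWm : ∀ c, Measurable (W c) := fun c =>
    (Finset.measurable_fun_sum _ fun s _ => Finset.measurable_fun_sum _ fun a _ =>
      ((hocc s a).pow_const _).mul ((M.measurable_unitAdv (pol := fun ρ => ρ) hid c s a).pow_const
        2)).const_mul _
  have hW0 : ∀ c ρ, IsPolicy ρ → 0 ≤ W c ρ := fun c ρ hρ =>
    mul_nonneg hn0 (Finset.sum_nonneg fun s _ => Finset.sum_nonneg fun a _ =>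
      mul_nonneg (Real.rpow_nonneg (M.occ_nonneg hρ _ _) _) (sq_nonneg _))
  have hBm : ∀ c, Measurable (B c) := fun c => (hVm.const_mul _).const_mul _
  have hB0 : ∀ c ρ, IsPolicy ρ → 0 ≤ B c ρ := fun c ρ hρ =>
    mul_nonneg hn0 (mul_nonneg (by positivity) (hΦ0 ρ hρ))
  have hnn : 0 ≤ n * (8 * Fintype.card A * n) := by positivity
  have hBb : ∀ c ρ, IsPolicy ρ → |B c ρ| ≤ n + n * (8 * Fintype.card A * n) := by
    intro c ρ hρ
    rw [abs_of_nonneg (hB0 c ρ hρ)]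
    have : n * (8 * Fintype.card A * V ρ) ≤ n * (8 * Fintype.card A * n) := by
      have := hΦ1 ρ hρ
      gcongr
    linarith
  have hVb : ∀ ρ, IsPolicy ρ → |V ρ| ≤ n + n * (8 * Fintype.card A * n) := by
    intro ρ hρ
    rw [abs_of_nonneg (hΦ0 ρ hρ)]
    linarith [hΦ1 ρ hρ]
  have hWB : ∀ c ρ, IsPolicy ρ → 0 < M.occ ρ c.1 c.2 →
      W c ρ * M.occ ρ c.1 c.2 ^ (2 / α - 2) ≤ B c ρ := by
    intro c ρ hρ hc
    have h := M.sum_rpow_mul_unitAdv_sq_le hρ p hc hq0 hq1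
    have e : M.occ ρ c.1 c.2 ^ (2 / α - 2) = (M.occ ρ c.1 c.2 ^ (1 / α - 1)) ^ 2 := by
      rw [← Real.rpow_mul_natCast hc.le]
      congr 1
      push_cast
      ring
    rw [hW, hB]
    beta_reduce
    rw [mul_assoc, e]
    refine mul_le_mul_of_nonneg_left (le_of_eq_of_le ?_ h) hn0
    simp only [Finset.sum_mul]
    exact Finset.sum_congr rfl fun s _ => Finset.sum_congr rfl fun a _ => by ring
  have hBV : ∀ ρ, IsPolicy ρ → ∑ c, B c ρ ≤ 8 * Fintype.card A * n ^ 2 * V ρ := by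
    intro ρ _
    rw [hB, Finset.sum_const, Finset.card_univ, nsmul_eq_mul, hcard]
    exact le_of_eq (by ring)
  exact M.regret_le_sum hI hA hα hα2 hσ hC hβ htune p hWm hW0 hBm hB0 hBb hVm hVb hWB hBV
    (fun ρ hρ => M.sum_max_mul_rpow_le_offSum hρ p hq0 hq1)
    (fun ρ hρ => M.powSum_sub_le hρ p hq0 hq1)
    (fun t ht ω => ⟨_, fun s a hs =>
      M.abs_shifted_lossEstimate_le hα hσ hC hR (hI.policy t ht ω) t _ _ hs,
      M.sum_shifted_sq_le (hI.policy t ht ω) _ _⟩)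

/-- Under positive gaps the potential is controlled by the expected gaps. -/
lemma sum_offSum_le (hI : M.IsInteraction α σ T μ ℱ ν π traj ℓ)
    (hα : 1 < α) (hσ : 0 < σ) (p : S → A) {Δ : S → A → ℝ} (hΔ0 : ∀ s a, 0 ≤ Δ s a)
    (hΔ : ∀ s a, a ≠ p s → 0 < Δ s a) {lam : ℝ} (hlam : 0 < lam) :
    ∑ t ∈ Finset.Icc 1 T, σ * (t : ℝ) ^ (1 / α - 1) *
        ∫ ω, offSum p (fun s a => M.occ (π t ω) s a ^ (1 / α)) ∂μ ≤
      lam * ∫ ω, ∑ t ∈ Finset.Icc 1 T, ∑ s, ∑ a, M.occ (π t ω) s a * Δ s a ∂μ +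
        lam ^ (-(1 / (α - 1))) * (σ ^ (α / (α - 1)) * gapSum α p Δ) *
          ∑ t ∈ Finset.Icc 1 T, (t : ℝ)⁻¹ := by
  have hα0 : 0 < α := by linarith
  have hq0 : 0 < 1 / α := by positivity
  have hΦi : ∀ t ∈ Finset.Icc 1 T,
      Integrable (fun ω => offSum p (fun s a => M.occ (π t ω) s a ^ (1 / α))) μ := fun t ht =>
    hI.integrable_comp_policy ht (M.measurable_offSum_occ p _) fun ρ hρ => by
      rw [abs_of_nonneg (offSum_nonneg p fun s a => Real.rpow_nonneg (M.occ_nonneg hρ _ _) _)]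
      exact (offSum_le_powSum p (M.occ_nonneg hρ)).trans (M.powSum_occ_le_card hρ hq0.le)
  have hXi : ∀ t ∈ Finset.Icc 1 T,
      Integrable (fun ω => ∑ s, ∑ a, M.occ (π t ω) s a * Δ s a) μ := fun t ht =>
    integrable_finsetSum _ fun s _ => integrable_finsetSum _ fun a _ =>
      (hI.integrable_comp_policy ht (M.measurable_occ (pol := fun ρ => ρ)
        (fun s a => by fun_prop) s a) (b := 1) fun ρ hρ => by
          rw [abs_of_nonneg (M.occ_nonneg hρ s a)]
          exact M.occ_le_one hρ s a).mul_const _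
  rw [integral_finsetSum _ hXi, Finset.mul_sum, Finset.mul_sum, ← Finset.sum_add_distrib]
  refine Finset.sum_le_sum fun t ht => ?_
  have ht0 : (0 : ℝ) < t := by exact_mod_cast (Finset.mem_Icc.1 ht).1
  rw [← integral_const_mul, ← integral_const_mul]
  have hpt : ∀ ω, σ * (t : ℝ) ^ (1 / α - 1) * offSum p (fun s a => M.occ (π t ω) s a ^ (1 / α)) ≤
      lam * ∑ s, ∑ a, M.occ (π t ω) s a * Δ s a +
        lam ^ (-(1 / (α - 1))) * (σ ^ (α / (α - 1)) * gapSum α p Δ) * (t : ℝ)⁻¹ := by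
    intro ω
    have hρ := hI.policy t ht ω
    simp only [offSum, gapSum, Finset.mul_sum, Finset.sum_mul, ← Finset.sum_add_distrib]
    refine Finset.sum_le_sum fun s _ => Finset.sum_le_sum fun a _ => ?_
    split_ifs with h
    · have := M.occ_nonneg hρ s a
      have := hΔ0 s a
      rw [mul_zero, mul_zero, mul_zero, zero_mul, add_zero]
      positivity
    · have hd := hΔ s a h
      -- Young's inequality with δ = λΔ(s,a); pairs chosen by p do not occur in the potential and
      -- need no gap.
      have := mul_rpow_le_add_of_conj hα hσ ht0 (M.occ_nonneg hρ s a) (mul_pos hlam hd)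
      rw [Real.mul_rpow hlam.le hd.le] at this
      linarith
  calc _ ≤ ∫ ω, (lam * ∑ s, ∑ a, M.occ (π t ω) s a * Δ s a +
        lam ^ (-(1 / (α - 1))) * (σ ^ (α / (α - 1)) * gapSum α p Δ) * (t : ℝ)⁻¹) ∂μ :=
        integral_mono ((hΦi t ht).const_mul _) (((hXi t ht).const_mul _).add
          (integrable_const _)) hpt
    _ = _ := by
        rw [integral_add ((hXi t ht).const_mul _) (integrable_const _), integral_const]
        simp

end Interaction

end LayeredMDP

/-! ### Regret bounds for the tuned algorithm. -/

namespace LayeredMDP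

variable {S A : Type*} [Fintype S] [DecidableEq S] [Fintype A] [DecidableEq A]
  {M : LayeredMDP S A} [Nonempty A] {α σ : ℝ} {T : ℕ}
  {Ω : Type*} {mΩ : MeasurableSpace Ω} {μ : Measure Ω} [IsProbabilityMeasure μ]
  {ℱ : Filtration ℕ mΩ} {ν : ℕ → Ω → Measure (S → A → ℝ)}
  {x π : ℕ → Ω → S → A → ℝ} {traj : ℕ → Ω → M.Traj} {ℓ : ℕ → Ω → S → A → ℝ}

/-- The regret of a tuned learner in terms of horizon length and sizes. -/
lemma regret_le_adversarial
    (hI : M.IsInteraction α σ T μ ℱ ν π traj ℓ)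
    (hA : M.IsHTFTRLOM α σ (tuningC α M.H (Fintype.card S) (Fintype.card A))
      (tuningBeta α M.H (Fintype.card S) (Fintype.card A)) T x π traj ℓ)
    (hα : 1 < α) (hα2 : α ≤ 2) (hσ : 0 < σ) (p : S → A) {k : ℝ} (hk0 : 0 < k)
    (hk : ∀ H S A : ℕ,
      tuningC α H S A ^ (1 - α) ≤ k * tuningR α H S A ^ (1 - 1 / α) ∧
      1 / tuningBeta α H S A ≤ k * tuningR α H S A ^ (1 - 1 / α) ∧
      tuningBeta α H S A * tuningC α H S A ^ (2 - α) ≤ k * tuningR α H S A ^ (1 - 1 / α) ∧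
      tuningBeta α H S A * (tuningC α H S A ^ (1 - α)) ^ 2 ≤
        k * tuningR α H S A ^ (1 - 1 / α)) :
    M.regret T μ π ℓ p ≤ 3 * α * (k * (3 + 4 * tsallisStab (1 / α))) *
      ((M.H : ℝ) ^ (α + 1) * (Fintype.card S : ℝ) ^ (2 - 2 / α) *
        (Fintype.card A : ℝ) ^ (4 - 4 / α) * (σ * (T : ℝ) ^ (1 / α))) := by
  have hα0 : 0 < α := by linarith
  have hq0 : 0 < 1 / α := by positivity
  have hq1 : 1 / α < 1 := by rw [div_lt_one hα0]; exact hα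
  have : Nonempty S := ⟨M.s₁⟩
  obtain ⟨hk1, hk2, hk3, hk4⟩ := hk M.H (Fintype.card S) (Fintype.card A)
  have hR1 := one_le_tuningR α M.H (Fintype.card S) (Fintype.card A)
  have hRle := tuningR_le hα M.one_le_H (Fintype.card_pos : 0 < Fintype.card S)
    (Fintype.card_pos : 0 < Fintype.card A)
  have hC := tuningC_pos hα M.H (Fintype.card S) (Fintype.card A)
  have hβ := tuningBeta_pos hα M.H (Fintype.card S) (Fintype.card A)
  have hmain := regret_le_sum_powSum hI hA hα hα2 hσ hC hβ hR1 (tuning_identity hα _ _ _).le p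
  have hK := tsallisStab_pos hq0 hq1
  set K := tsallisStab (1 / α)
  have hH1 : (1 : ℝ) ≤ M.H := by exact_mod_cast M.one_le_H
  have hS1 : (1 : ℝ) ≤ Fintype.card S := by exact_mod_cast Fintype.card_pos
  have hA1 : (1 : ℝ) ≤ Fintype.card A := by exact_mod_cast Fintype.card_pos
  set R := tuningR α M.H (Fintype.card S) (Fintype.card A)
  set C := tuningC α M.H (Fintype.card S) (Fintype.card A)
  set β := tuningBeta α M.H (Fintype.card S) (Fintype.card A)
  set h : ℝ := (M.H : ℝ)
  set m : ℝ := (Fintype.card S : ℝ)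
  set n : ℝ := (Fintype.card A : ℝ)
  have hR' : R ^ (1 - 1 / α) ≤ 3 * (h ^ (1 - 1 / α) * m ^ (1 - 1 / α) *
      n ^ ((2 - 1 / α) * (1 - 1 / α))) := by
    have h0 : 0 ≤ 1 - 1 / α := by linarith
    calc _ ≤ (3 * (h * m * n ^ (2 - 1 / α))) ^ (1 - 1 / α) :=
          Real.rpow_le_rpow (by linarith) hRle h0
      _ = 3 ^ (1 - 1 / α) * (h ^ (1 - 1 / α) * m ^ (1 - 1 / α) *
          n ^ ((2 - 1 / α) * (1 - 1 / α))) := by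
          rw [Real.mul_rpow (by norm_num) (by positivity), Real.mul_rpow (by positivity)
            (by positivity), Real.mul_rpow (by positivity) (by positivity),
            ← Real.rpow_mul (by positivity)]
      _ ≤ _ := by
          refine mul_le_mul_of_nonneg_right ?_ (by positivity)
          exact Real.rpow_le_self_of_one_le (by norm_num) (by linarith)
  set V := h ^ (1 / α) * (m * n) ^ (1 - 1 / α) with hV
  have hV0 : 0 ≤ V := by positivity
  have hRV : R ^ (1 - 1 / α) * V ≤ 3 * (h ^ (α + 1) * m ^ (2 - 2 / α) * n ^ (4 - 4 / α)) := by
    calc _ ≤ 3 * (h ^ (1 - 1 / α) * m ^ (1 - 1 / α) * n ^ ((2 - 1 / α) * (1 - 1 / α))) * V :=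
          mul_le_mul_of_nonneg_right hR' hV0
      _ = 3 * ((h ^ (1 - 1 / α) * h ^ (1 / α)) * (m ^ (1 - 1 / α) * m ^ (1 - 1 / α)) *
          (n ^ ((2 - 1 / α) * (1 - 1 / α)) * n ^ (1 - 1 / α))) := by
          rw [hV, Real.mul_rpow (by positivity) (by positivity)]
          ring
      _ = 3 * (h ^ (1 : ℝ) * m ^ (2 - 2 / α) * n ^ ((3 - 1 / α) * (1 - 1 / α))) := by
          rw [← Real.rpow_add (by positivity), ← Real.rpow_add (by positivity),
            ← Real.rpow_add (by positivity)]
          ring_nf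
      _ ≤ _ := by
          -- The bound obtained has H to the power 1 and a smaller power of A; it is relaxed to the
          -- stated exponents.
          have e1 : h ^ (1 : ℝ) ≤ h ^ (α + 1) :=
            Real.rpow_le_rpow_of_exponent_le hH1 (by linarith)
          have e2 : n ^ ((3 - 1 / α) * (1 - 1 / α)) ≤ n ^ (4 - 4 / α) := by
            refine Real.rpow_le_rpow_of_exponent_le hA1 ?_
            have : 4 - 4 / α = 4 * (1 - 1 / α) := by ring
            rw [this]
            exact mul_le_mul_of_nonneg_right (by linarith) (by linarith)
          gcongr
  have hRp : 0 < R ^ (1 - 1 / α) := Real.rpow_pos_of_pos (by linarith) _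
  have hterm : ∀ t ∈ Finset.Icc 1 T,
      ((2 * C ^ (1 - α) * 1 + 1 / β + 2 * K * (β * C ^ (2 - α)) * 1) *
          (σ * (t : ℝ) ^ (1 / α - 1)) * ∫ ω, powSum (1 / α) (M.occ (π t ω)) ∂μ +
        2 * K * (β * (C ^ (1 - α)) ^ 2) * (σ * (t : ℝ) ^ (1 / α - 2)) *
          ∫ ω, powSum (1 / α) (M.occ (π t ω)) ∂μ) ≤
      k * (3 + 4 * K) * (R ^ (1 - 1 / α) * V) * σ * (t : ℝ) ^ (1 / α - 1) := by
    intro t ht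
    have ht1 : (1 : ℝ) ≤ t := by exact_mod_cast (Finset.mem_Icc.1 ht).1
    have hE0 : 0 ≤ ∫ ω, powSum (1 / α) (M.occ (π t ω)) ∂μ := integral_nonneg fun ω =>
      powSum_nonneg (M.occ_nonneg (hI.policy t ht ω))
    have hE1 : ∫ ω, powSum (1 / α) (M.occ (π t ω)) ∂μ ≤ V := by
      calc _ ≤ ∫ _, V ∂μ := by
            refine integral_mono (hI.integrable_comp_policy ht (M.measurable_powSum_occ _)
              (b := m * n) fun ρ hρ => ?_) (integrable_const _)
              fun ω => M.powSum_occ_le (hI.policy t ht ω) hα.le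
            rw [abs_of_nonneg (powSum_nonneg (M.occ_nonneg hρ))]
            exact M.powSum_occ_le_card hρ hq0.le
        _ = V := by simp
    have hCC : 2 * C ^ (1 - α) * 1 + 1 / β + 2 * K * (β * C ^ (2 - α)) * 1 ≤
        k * R ^ (1 - 1 / α) * (3 + 2 * K) := by
      have := mul_le_mul_of_nonneg_left hk3 (by positivity : 0 ≤ 2 * K)
      linarith
    -- Here the squared bonuses are simply absorbed into the leading rate.
    have ht2 : (t : ℝ) ^ (1 / α - 2) ≤ (t : ℝ) ^ (1 / α - 1) :=
      Real.rpow_le_rpow_of_exponent_le ht1 (by linarith)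
    calc _ ≤ k * R ^ (1 - 1 / α) * (3 + 2 * K) * (σ * (t : ℝ) ^ (1 / α - 1)) * V +
          2 * K * (k * R ^ (1 - 1 / α)) * (σ * (t : ℝ) ^ (1 / α - 1)) * V := by gcongr
      _ = _ := by ring
  refine hmain.trans ((Finset.sum_le_sum hterm).trans ?_)
  rw [← Finset.mul_sum]
  have hT := sum_rpow_sub_one_le hq0 hq1.le T
  have hTe : (T : ℝ) ^ (1 / α) / (1 / α) = α * (T : ℝ) ^ (1 / α) := by field_simp
  rw [hTe] at hT
  calc _ ≤ k * (3 + 4 * K) * (3 * (h ^ (α + 1) * m ^ (2 - 2 / α) * n ^ (4 - 4 / α))) * σ *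
        (α * (T : ℝ) ^ (1 / α)) := by gcongr
    _ = _ := by ring

/-- The regret of a tuned learner in terms of the off-comparator potential. -/
lemma regret_le_offSum_add_log
    (hI : M.IsInteraction α σ T μ ℱ ν π traj ℓ)
    (hA : M.IsHTFTRLOM α σ (tuningC α M.H (Fintype.card S) (Fintype.card A))
      (tuningBeta α M.H (Fintype.card S) (Fintype.card A)) T x π traj ℓ)
    (hα : 1 < α) (hα2 : α ≤ 2) (hσ : 0 < σ) (hT : 2 ≤ T) (p : S → A) {k : ℝ} (hk0 : 0 < k)
    (hk : ∀ H S A : ℕ,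
      tuningC α H S A ^ (1 - α) ≤ k * tuningR α H S A ^ (1 - 1 / α) ∧
      1 / tuningBeta α H S A ≤ k * tuningR α H S A ^ (1 - 1 / α) ∧
      tuningBeta α H S A * tuningC α H S A ^ (2 - α) ≤ k * tuningR α H S A ^ (1 - 1 / α) ∧
      tuningBeta α H S A * (tuningC α H S A ^ (1 - α)) ^ 2 ≤
        k * tuningR α H S A ^ (1 - 1 / α)) :
    M.regret T μ π ℓ p ≤ 3 * (k * (6 + 16 * tsallisStab (1 / α))) *
      ((M.H : ℝ) * Fintype.card S * Fintype.card A) ^ 5 *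
      (∑ t ∈ Finset.Icc 1 T, σ * (t : ℝ) ^ (1 / α - 1) *
        ∫ ω, offSum p (fun s a => M.occ (π t ω) s a ^ (1 / α)) ∂μ + σ * Real.log T) := by
  have hα0 : 0 < α := by linarith
  have hq0 : 0 < 1 / α := by positivity
  have hq1 : 1 / α < 1 := by rw [div_lt_one hα0]; exact hα
  have : Nonempty S := ⟨M.s₁⟩
  obtain ⟨hk1, hk2, hk3, hk4⟩ := hk M.H (Fintype.card S) (Fintype.card A)
  have hR1 := one_le_tuningR α M.H (Fintype.card S) (Fintype.card A)
  have hRle := tuningR_le hα M.one_le_H (Fintype.card_pos : 0 < Fintype.card S)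
    (Fintype.card_pos : 0 < Fintype.card A)
  have hC := tuningC_pos hα M.H (Fintype.card S) (Fintype.card A)
  have hβ := tuningBeta_pos hα M.H (Fintype.card S) (Fintype.card A)
  have hmain := regret_le_sum_offSum hI hA hα hα2 hσ hC hβ
    (two_mul_le_tuningR hα M.one_le_H (Fintype.card_pos : 0 < Fintype.card A))
    (tuning_identity hα _ _ _).le p
  have hK := tsallisStab_pos hq0 hq1
  set K := tsallisStab (1 / α)
  have hH1 : (1 : ℝ) ≤ M.H := by exact_mod_cast M.one_le_H
  have hS1 : (1 : ℝ) ≤ Fintype.card S := by exact_mod_cast Fintype.card_pos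
  have hA1 : (1 : ℝ) ≤ Fintype.card A := by exact_mod_cast Fintype.card_pos
  set R := tuningR α M.H (Fintype.card S) (Fintype.card A)
  set C := tuningC α M.H (Fintype.card S) (Fintype.card A)
  set β := tuningBeta α M.H (Fintype.card S) (Fintype.card A)
  set h : ℝ := (M.H : ℝ)
  set m : ℝ := (Fintype.card S : ℝ)
  set n : ℝ := (Fintype.card A : ℝ)
  set N := h * m * n with hN
  have hhm : 1 ≤ h * m := one_le_mul_of_one_le_of_one_le hH1 hS1
  have hN1 : 1 ≤ N := one_le_mul_of_one_le_of_one_le hhm hA1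
  have hmN : m ≤ N := by
    calc m = 1 * m * 1 := by ring
      _ ≤ h * m * n := by gcongr
  have hmnN : m * n ≤ N := by
    calc m * n = 1 * m * n := by ring
      _ ≤ h * m * n := by gcongr
  have hnN : n ≤ N := le_mul_of_one_le_left (by positivity) hhm
  have hR' : R ^ (1 - 1 / α) ≤ 3 * N ^ 2 := by
    have hn2 : n ^ (2 - 1 / α) ≤ n ^ (2 : ℝ) :=
      Real.rpow_le_rpow_of_exponent_le hA1 (by linarith)
    rw [Real.rpow_two] at hn2
    calc _ ≤ R := Real.rpow_le_self_of_one_le hR1 (by linarith)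
      _ ≤ 3 * (h * m * n ^ (2 - 1 / α)) := hRle
      _ ≤ 3 * (h * m * n ^ 2) := by gcongr
      _ = 3 * (N * n) := by ring
      _ ≤ 3 * (N * N) := by gcongr
      _ = _ := by ring
  have hN12 : N ≤ N ^ 3 := le_self_pow₀ hN1 (by norm_num)
  have hN35 : N ^ 3 ≤ N ^ 5 := pow_le_pow_right₀ hN1 (by norm_num)
  -- Every tuning coefficient is at most 3kN², and the largest remaining factor, 8A(SA)², is at most
  -- 8N³; this gives N⁵.
  have hCC : 2 * C ^ (1 - α) * (1 + m) + (1 + m) / β + 2 * K * (β * C ^ (2 - α)) *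
      (8 * n * (m * n) ^ 2) ≤ 3 * (k * (6 + 16 * K)) * N ^ 5 := by
    have h1 : 1 + m ≤ 2 * N := by linarith
    have e : (1 + m) / β = 1 / β * (1 + m) := by ring
    rw [e]
    calc _ ≤ 2 * (k * (3 * N ^ 2)) * (2 * N) + k * (3 * N ^ 2) * (2 * N) +
          2 * K * (k * (3 * N ^ 2)) * (8 * N * N ^ 2) := by
          have f1 : C ^ (1 - α) ≤ k * (3 * N ^ 2) := hk1.trans (by gcongr)
          have f2 : 1 / β ≤ k * (3 * N ^ 2) := hk2.trans (by gcongr)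
          have f3 : β * C ^ (2 - α) ≤ k * (3 * N ^ 2) := hk3.trans (by gcongr)
          gcongr
      _ = 3 * k * 6 * N ^ 3 + 3 * k * 16 * K * N ^ 5 := by ring
      _ ≤ 3 * k * 6 * N ^ 5 + 3 * k * 16 * K * N ^ 5 := by gcongr
      _ = _ := by ring
  have hDD : 2 * K * (β * (C ^ (1 - α)) ^ 2) ≤ 6 * (K * k) * N ^ 2 := by
    calc _ ≤ 2 * K * (k * (3 * N ^ 2)) := by
          have f4 : β * (C ^ (1 - α)) ^ 2 ≤ k * (3 * N ^ 2) := hk4.trans (by gcongr)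
          gcongr
      _ = _ := by ring
  have hterm : ∀ t ∈ Finset.Icc 1 T,
      ((2 * C ^ (1 - α) * (1 + m) + (1 + m) / β + 2 * K * (β * C ^ (2 - α)) *
            (8 * n * (m * n) ^ 2)) * (σ * (t : ℝ) ^ (1 / α - 1)) *
          ∫ ω, offSum p (fun s a => M.occ (π t ω) s a ^ (1 / α)) ∂μ +
        2 * K * (β * (C ^ (1 - α)) ^ 2) * (σ * (t : ℝ) ^ (1 / α - 2)) *
          ∫ ω, powSum (1 / α) (M.occ (π t ω)) ∂μ) ≤
      3 * (k * (6 + 16 * K)) * N ^ 5 * (σ * (t : ℝ) ^ (1 / α - 1) *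
        ∫ ω, offSum p (fun s a => M.occ (π t ω) s a ^ (1 / α)) ∂μ) +
      6 * (K * k) * N ^ 3 * σ * (t : ℝ)⁻¹ := by
    intro t ht
    have ht1 : (1 : ℝ) ≤ t := by exact_mod_cast (Finset.mem_Icc.1 ht).1
    have hF0 : 0 ≤ ∫ ω, offSum p (fun s a => M.occ (π t ω) s a ^ (1 / α)) ∂μ :=
      integral_nonneg fun ω => offSum_nonneg p fun s a =>
        Real.rpow_nonneg (M.occ_nonneg (hI.policy t ht ω) _ _) _
    have hE0 : 0 ≤ ∫ ω, powSum (1 / α) (M.occ (π t ω)) ∂μ := integral_nonneg fun ω =>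
      powSum_nonneg (M.occ_nonneg (hI.policy t ht ω))
    have hE1 : ∫ ω, powSum (1 / α) (M.occ (π t ω)) ∂μ ≤ N := by
      calc _ ≤ ∫ _, N ∂μ := by
            refine integral_mono (hI.integrable_comp_policy ht (M.measurable_powSum_occ _)
              (b := m * n) fun ρ hρ => ?_) (integrable_const _)
              fun ω => (M.powSum_occ_le_card (hI.policy t ht ω) hq0.le).trans hmnN
            rw [abs_of_nonneg (powSum_nonneg (M.occ_nonneg hρ))]
            exact M.powSum_occ_le_card hρ hq0.le
        _ = N := by simp
    -- Since 1/α - 2 ≤ -1, the squared bonuses sum to order log T.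
    have ht2 : (t : ℝ) ^ (1 / α - 2) ≤ (t : ℝ)⁻¹ := by
      rw [← Real.rpow_neg_one]
      exact Real.rpow_le_rpow_of_exponent_le ht1 (by linarith)
    calc _ ≤ 3 * (k * (6 + 16 * K)) * N ^ 5 * (σ * (t : ℝ) ^ (1 / α - 1)) *
            ∫ ω, offSum p (fun s a => M.occ (π t ω) s a ^ (1 / α)) ∂μ +
          6 * (K * k) * N ^ 2 * (σ * (t : ℝ)⁻¹) * N := by gcongr
      _ = _ := by ring
  refine hmain.trans ((Finset.sum_le_sum hterm).trans ?_)
  rw [Finset.sum_add_distrib, ← Finset.mul_sum, ← Finset.mul_sum,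
    mul_add (3 * (k * (6 + 16 * K)) * N ^ 5)]
  refine add_le_add le_rfl ?_
  have hL0 : 0 ≤ Real.log T := Real.log_natCast_nonneg T
  calc _ ≤ 6 * (K * k) * N ^ 3 * σ * (3 * Real.log T) := by
        have := sum_inv_le_three_mul_log hT
        gcongr
    _ = 18 * (K * k) * N ^ 3 * (σ * Real.log T) := by ring
    _ ≤ 18 * (K * k) * N ^ 5 * (σ * Real.log T) := by gcongr
    _ ≤ 3 * (k * (6 + 16 * K)) * N ^ 5 * (σ * Real.log T) := by
        have : 18 * (K * k) ≤ 3 * (k * (6 + 16 * K)) := by nlinarith [mul_pos hK hk0]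
        gcongr

end LayeredMDP

/-! ### The theorem. -/

theorem mainTheorem1 (α : ℝ) (hα₁ : 1 < α) (hα₂ : α ≤ 2) :
    ∃ K : ℝ, 0 < K ∧ ∃ d : ℕ,
      ∀ (S A : Type*) [Fintype S] [DecidableEq S] [Fintype A] [DecidableEq A]
        (M : LayeredMDP S A) (σ : ℝ) (T : ℕ)
        (Ω : Type*) [mΩ : MeasurableSpace Ω] (μ : Measure Ω) [IsProbabilityMeasure μ]
        (ℱ : Filtration ℕ mΩ) (ν : ℕ → Ω → Measure (S → A → ℝ))
        (x π : ℕ → Ω → S → A → ℝ) (traj : ℕ → Ω → M.Traj) (ℓ : ℕ → Ω → S → A → ℝ)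
        (p : S → A),
        0 < σ → 1 ≤ T →
        M.IsInteraction α σ T μ ℱ ν π traj ℓ →
        M.IsHTFTRLOM α σ
          (LayeredMDP.tuningC α M.H (Fintype.card S) (Fintype.card A))
          (LayeredMDP.tuningBeta α M.H (Fintype.card S) (Fintype.card A)) T x π traj ℓ →
        (M.regret T μ π ℓ p ≤
          K * ((M.H : ℝ) ^ (1 - 1 / α) * (Fintype.card S : ℝ) ^ (2 - 1 / α) *
                (Fintype.card A : ℝ) ^ (5 - 5 / α) * (σ * Real.log T) +
              (M.H : ℝ) ^ (α + 1) * (Fintype.card S : ℝ) ^ (2 - 2 / α) *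
                (Fintype.card A : ℝ) ^ (4 - 4 / α) * (σ * (T : ℝ) ^ (1 / α)))) ∧
        (∀ (Δ : S → A → ℝ) (Csb : ℝ), 2 ≤ T →
          M.SelfBounding T μ π ℓ p Δ Csb →
          (∀ s a, a ≠ p s → 0 < Δ s a) →
          ∀ W : ℝ, W = σ ^ (α / (α - 1)) * LayeredMDP.gapSum α p Δ * Real.log T →
          M.regret T μ π ℓ p ≤
            K * ((M.H : ℝ) * Fintype.card S * Fintype.card A) ^ d *
              (W + Csb ^ (1 / α) * W ^ ((α - 1) / α) + σ * Real.log T)) := by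
  have hα0 : 0 < α := by linarith
  have ha : 0 < α - 1 := by linarith
  have hq0 : 0 < 1 / α := by positivity
  have hq1 : 1 / α < 1 := by rw [div_lt_one hα0]; exact hα₁
  have hst := tsallisStab_pos hq0 hq1
  obtain ⟨k, hk0, hk⟩ := LayeredMDP.exists_tuning_const hα₁
  set K₁ := 3 * α * (k * (3 + 4 * tsallisStab (1 / α))) with hK₁
  set κ := 3 * (k * (6 + 16 * tsallisStab (1 / α))) with hκ
  have hK₁0 : 0 < K₁ := by positivity
  have hκ0 : 0 < κ := by positivity
  set r := α / (α - 1) with hr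
  have hr0 : 0 < r := by positivity
  -- The constant of `le_of_forall_self_bounding` for Q = (1 + 3κ) N⁵, without the power of N. That
  -- power, N^(5r), gives the exponent ⌈5r⌉ chosen next.
  set K₂ := 2 * (2 * (1 + 3 * κ)) ^ r with hK₂
  have hK₂0 : 0 < K₂ := by positivity
  refine ⟨K₁ + K₂, by positivity, ⌈5 * r⌉₊, ?_⟩
  intro S A _ _ _ _ M σ T Ω mΩ μ _ ℱ ν x π traj ℓ p hσ hT hI hA
  have : Nonempty A := ⟨p M.s₁⟩
  have : Nonempty S := ⟨M.s₁⟩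
  have hlog : 0 ≤ Real.log T := Real.log_natCast_nonneg T
  refine ⟨?_, fun Δ Csb hT2 hsb hΔ W hW => ?_⟩
  -- The T^(1/α) term alone bounds the regret; the logarithmic term is nonnegative and is added for
  -- free.
  · refine (LayeredMDP.regret_le_adversarial hI hA hα₁ hα₂ hσ p hk0 hk).trans ?_
    exact mul_le_mul (by linarith) (le_add_of_nonneg_left (by positivity)) (by positivity)
      (by positivity)
  · have hmain := LayeredMDP.regret_le_offSum_add_log hI hA hα₁ hα₂ hσ hT2 p hk0 hk
    rw [← hκ] at hmain
    have hgap : 0 ≤ LayeredMDP.gapSum α p Δ := Finset.sum_nonneg fun s _ =>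
      Finset.sum_nonneg fun a _ => by
        split_ifs
        · exact le_rfl
        · exact Real.rpow_nonneg (hsb.gap_nonneg s a) _
    have hW0 : 0 ≤ W := by rw [hW]; positivity
    have hH1 : (1 : ℝ) ≤ M.H := by exact_mod_cast M.one_le_H
    have hS1 : (1 : ℝ) ≤ Fintype.card S := by exact_mod_cast Fintype.card_pos
    have hA1 : (1 : ℝ) ≤ Fintype.card A := by exact_mod_cast Fintype.card_pos
    have hN1 : 1 ≤ (M.H : ℝ) * Fintype.card S * Fintype.card A :=
      one_le_mul_of_one_le_of_one_le (one_le_mul_of_one_le_of_one_le hH1 hS1) hA1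
    set N := (M.H : ℝ) * Fintype.card S * Fintype.card A
    have hN5 : 1 ≤ N ^ 5 := one_le_pow₀ hN1
    have hC0 := hsb.corruption_nonneg
    have hl : 0 ≤ σ * Real.log T := by positivity
    have key := le_of_forall_self_bounding (Q := (1 + 3 * κ) * N ^ 5) hα₁
      (one_le_mul_of_one_le_of_one_le (by linarith) hN5) hC0 hW0 hl
      (r := M.regret T μ π ℓ p) fun lam hlam => by
        have h1 := LayeredMDP.sum_offSum_le hI hα₁ hσ p hsb.gap_nonneg hΔ hlam
        have h2 := hsb.le_regret
        have hX0 : 0 ≤ ∫ ω, ∑ t ∈ Finset.Icc 1 T, ∑ s, ∑ a, M.occ (π t ω) s a * Δ s a ∂μ :=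
          integral_nonneg fun ω => Finset.sum_nonneg fun t ht => Finset.sum_nonneg fun s _ =>
            Finset.sum_nonneg fun a _ => mul_nonneg (M.occ_nonneg (hI.policy t ht ω) s a)
              (hsb.gap_nonneg s a)
        set X := ∫ ω, ∑ t ∈ Finset.Icc 1 T, ∑ s, ∑ a, M.occ (π t ω) s a * Δ s a ∂μ
        have hlr := Real.rpow_pos_of_pos hlam (-(1 / (α - 1)))
        have h3 : lam ^ (-(1 / (α - 1))) * (σ ^ (α / (α - 1)) * LayeredMDP.gapSum α p Δ) *
            ∑ t ∈ Finset.Icc 1 T, (t : ℝ)⁻¹ ≤ 3 * (lam ^ (-(1 / (α - 1))) * W) := by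
          calc _ ≤ lam ^ (-(1 / (α - 1))) * (σ ^ (α / (α - 1)) * LayeredMDP.gapSum α p Δ) *
                (3 * Real.log T) := by
                have := sum_inv_le_three_mul_log hT2
                gcongr
            _ = _ := by rw [hW]; ring
        -- The self-bounding hypothesis returns the expected gaps to the regret. It also shows that
        -- regret plus corruption is nonnegative, which allows enlarging 3κ to 1 + 3κ below.
        have h4 : lam * X ≤ lam * (M.regret T μ π ℓ p + Csb) :=
          mul_le_mul_of_nonneg_left (by linarith) hlam.le
        have h5 : 0 ≤ lam * X := by positivity
        have h6 : 0 ≤ lam ^ (-(1 / (α - 1))) * W := by positivity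
        calc _ ≤ κ * N ^ 5 * (3 * (lam * (M.regret T μ π ℓ p + Csb) +
              lam ^ (-(1 / (α - 1))) * W + σ * Real.log T)) :=
              hmain.trans (mul_le_mul_of_nonneg_left (by linarith) (by positivity))
          _ = 3 * κ * (N ^ 5 * (lam * (M.regret T μ π ℓ p + Csb) +
              lam ^ (-(1 / (α - 1))) * W + σ * Real.log T)) := by ring
          _ ≤ (1 + 3 * κ) * (N ^ 5 * (lam * (M.regret T μ π ℓ p + Csb) +
              lam ^ (-(1 / (α - 1))) * W + σ * Real.log T)) := by
              refine mul_le_mul_of_nonneg_right (by linarith) (mul_nonneg (by positivity) ?_)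
              linarith
          _ = _ := by ring
    refine key.trans (mul_le_mul_of_nonneg_right ?_ (by positivity))
    rw [← hr, ← mul_assoc, Real.mul_rpow (by positivity) (by positivity), ← mul_assoc, ← hK₂]
    have h7 : (N ^ 5) ^ r ≤ N ^ ⌈5 * r⌉₊ := by
      rw [← Real.rpow_natCast, ← Real.rpow_natCast, ← Real.rpow_mul (by positivity)]
      refine Real.rpow_le_rpow_of_exponent_le hN1 ?_
      push_cast
      exact Nat.le_ceil _
    exact mul_le_mul (by linarith) h7 (by positivity) (by positivity)
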